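/- Let $n\ge 0$. Let $\mathcal G_n$ be the set of isotopy classes (rel boundary) of finite planar graphs $G$ embedded in a rectangle $R$ which meet $\partial R$ exactly in $n$ fixed points at the top and $n$ fixed points at the bottom, each of these $2n$ points being the endpoint of exactly one edge. Loops, multiple edges, isolated vertices, and components which are simple closed curves without vertices are allowed in the interior of $R$. An edge is called outer if it has an endpoint on $\partial R$, and inner otherwise (a simple closed curve component counts as an inner edge). Let $\mathcal F_n$ be the $\mathbb C[Q]$-algebra which is free as a $\mathbb C[Q]$-module on $\mathcal G_n$, with multiplication given by vertical stacking. The chromatic algebra $\mathcal C_n$ is the quotient of $\mathcal F_n$ by the two-sided ideal generated by the relations 1. $G = G/e - G\setminus e$ if $e$ is an inner edge of $G$ which is not a loop (or closed curve); 2. $G=(Q-1)\,G\setminus e$ if $e$ is an inner edge of $G$ which is a loop or a simple closed curve component; 3. $G=0$ if $G$ has a $1$-valent vertex in the interior of $R$; 4. $G=G'$ if $G'$ is obtained from $G$ by deleting a $2$-valent vertex and merging the two adjacent edges, or by deleting an isolated vertex. Let $B_n\subset\mathcal G_n$ be the set of isotopy classes of graphs which have no inner edges and all of whose vertices in the interior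 of $R$ have valence at least $3$. Then: (a) The images of the elements of $B_n$ in $\mathcal C_n$ form a basis of $\mathcal C_n$ as a $\mathbb C[Q]$-module (distinct elements of $B_n$ giving distinct basis elements). (b) The class in $\mathcal C_n$ of any graph without inner edges is either $0$ or equal to the class of an element of $B_n$. (c) Sending a graph to the partition of the $2n$ boundary points in which two points lie in the same block if and only if they lie in the same connected component of the graph defines a bijection from $B_n$ onto the set of planar (that is, non-crossing with respect to the cyclic order along $\partial R$) partitions of the $2n$ boundary points in which every block has at least two points. -/

import Mathlib

namespace Chromatic

/-!
Planar graphs in a rectangle, up to isotopy.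

A planar graph in the rectangle, in general position with respect to the height function, is cut by
horizontal lines into slices.  Each slice contains exactly one elementary piece (a local minimum of
an edge, a local maximum of an edge, or a vertex with `a` legs going down and `b` legs going up);
all other strands pass through the slice vertically.  A graph is thus a list of slices, read from
the bottom to the top, and isotopy (rel boundary) is generated by the usual local moves.
-/

/-- Elementary pieces: `cup` is a local minimum `∪` of an edge, `cap` is a local maximum `∩` of an
edge, `vertex a b` is a vertex of valence `a + b` with `a` legs below and `b` legs above it. -/
inductive Piece where
  | cup : Piece
  | cap : Piece
  | vertex (a b : ℕ) : Piece

/-- Number of strands entering a piece from below. -/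
def Piece.dom : Piece → ℕ
  | .cup => 0
  | .cap => 2
  | .vertex a _ => a

/-- Number of strands leaving a piece at the top. -/
def Piece.cod : Piece → ℕ
  | .cup => 2
  | .cap => 0
  | .vertex _ b => b

/-- A slice: one elementary piece with `offset` vertical strands to the left of it
(the number of strands to the right of it is determined by the context). -/
structure Slice where
  offset : ℕ
  piece : Piece

/-- `IsDiagram m w n`: the list of slices `w` (from bottom to top) fits together to a planar graph
with `m` endpoints at the bottom and `n` endpoints at the top. -/
def IsDiagram : ℕ → List Slice → ℕ → Prop
  | m, [], n => m = n
  | m, s :: w, n => ∃ r, m = s.offset + s.piece.dom + r ∧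
      IsDiagram (s.offset + s.piece.cod + r) w n

theorem IsDiagram.append {w w' : List Slice} {m k n : ℕ}
    (h : IsDiagram m w k) (h' : IsDiagram k w' n) : IsDiagram m (w ++ w') n := by
  induction w generalizing m with
  | nil => cases h; exact h'
  | cons s w ih =>
    obtain ⟨r, hr, hw⟩ := h
    exact ⟨r, hr, ih hw⟩

/-- A planar graph in the rectangle, in general position, with `n` endpoints at the bottom and
`n` endpoints at the top. -/
structure Diagram (n : ℕ) where
  slices : List Slice
  isDiagram : IsDiagram n slices n

/-- Place a picture to the right of `i` further vertical strands. -/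
def shift (i : ℕ) (w : List Slice) : List Slice :=
  w.map fun s => ⟨i + s.offset, s.piece⟩

/-! ### Isotopy -/

/-- The elementary isotopies. -/
inductive Move : List Slice → List Slice → Prop
  /-- Pieces over disjoint intervals can exchange their heights. -/
  | interchange (i k : ℕ) (p q : Piece) :
      Move [⟨i, p⟩, ⟨i + p.cod + k, q⟩] [⟨i + p.dom + k, q⟩, ⟨i, p⟩]
  /-- Straightening of a zigzag. -/
  | zigzag_left (i : ℕ) : Move [⟨i, .cup⟩, ⟨i + 1, .cap⟩] []
  /-- Straightening of the mirror image of the zigzag. -/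
  | zigzag_right (i : ℕ) : Move [⟨i + 1, .cup⟩, ⟨i, .cap⟩] []
  /-- The rightmost lower leg of a vertex may leave the vertex upwards, and then bend down. -/
  | rotate_right (i a b : ℕ) :
      Move [⟨i, .vertex (a + 1) b⟩] [⟨i, .vertex a (b + 1)⟩, ⟨i + b, .cap⟩]
  /-- The leftmost lower leg of a vertex may leave the vertex upwards, and then bend down. -/
  | rotate_left (i a b : ℕ) :
      Move [⟨i, .vertex (a + 1) b⟩] [⟨i + 1, .vertex a (b + 1)⟩, ⟨i, .cap⟩]

/-- An elementary isotopy carried out inside a graph. -/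
def Step {n : ℕ} (G H : Diagram n) : Prop :=
  ∃ u v x y : List Slice, Move x y ∧ G.slices = u ++ x ++ v ∧ H.slices = u ++ y ++ v

/-- Isotopy of planar graphs in the rectangle. -/
def isotopy (n : ℕ) : Setoid (Diagram n) := Relation.EqvGen.setoid Step

/-- Vertical stacking, `G` on top of `H`. -/
def stack {n : ℕ} (G H : Diagram n) : Diagram n :=
  ⟨H.slices ++ G.slices, H.isDiagram.append G.isDiagram⟩

theorem isotopy_stack {n : ℕ} {G G' H H' : Diagram n}
    (hG : isotopy n G G') (hH : isotopy n H H') : isotopy n (stack G H) (stack G' H') := by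
  have h1 : isotopy n (stack G H) (stack G' H) := by
    induction hG with
    | rel A B h =>
      obtain ⟨u, v, x, y, hm, hA, hB⟩ := h
      exact .rel _ _ ⟨H.slices ++ u, v, x, y, hm, by simp [stack, hA], by simp [stack, hB]⟩
    | refl A => exact .refl _
    | symm A B _ ih => exact .symm _ _ ih
    | trans A B C _ _ ih ih' => exact .trans _ _ _ ih ih'
  have h2 : isotopy n (stack G' H) (stack G' H') := by
    clear h1 hG
    induction hH with
    | rel A B h =>
      obtain ⟨u, v, x, y, hm, hA, hB⟩ := h
      exact .rel _ _ ⟨u, v ++ G'.slices, x, y, hm, by simp [stack, hA], by simp [stack, hB]⟩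
    | refl A => exact .refl _
    | symm A B _ ih => exact .symm _ _ ih
    | trans A B C _ _ ih ih' => exact .trans _ _ _ ih ih'
  exact .trans _ _ _ h1 h2

/-- The set of isotopy classes of planar graphs in the rectangle
with `n` endpoints at the bottom and `n` endpoints at the top. -/
def Graph (n : ℕ) : Type := Quotient (isotopy n)

/-- The isotopy class of a planar graph. -/
def Graph.mk {n : ℕ} (G : Diagram n) : Graph n := Quotient.mk (isotopy n) G

/-- Isotopy classes form a monoid under vertical stacking; the unit is the graph that
consists of `n` vertical arcs. -/
instance (n : ℕ) : Monoid (Graph n) where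
  mul := Quotient.map₂ stack fun _ _ h _ _ h' => isotopy_stack h h'
  one := Graph.mk ⟨[], rfl⟩
  mul_assoc a b c := by
    induction a using Quotient.inductionOn
    induction b using Quotient.inductionOn
    induction c using Quotient.inductionOn
    exact congrArg Graph.mk (by simp [stack])
  one_mul a := by
    induction a using Quotient.inductionOn
    exact congrArg Graph.mk (by simp [stack])
  mul_one a := by
    induction a using Quotient.inductionOn
    exact congrArg Graph.mk (by simp [stack])

/-! ### The chromatic algebra -/

/-- The free algebra over `ℂ[Q]` with additive generators the isotopy classes of graphs, and
multiplication given by vertical stacking. -/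
abbrev FreeAlg (n : ℕ) : Type := MonoidAlgebra (Polynomial ℂ) (Graph n)

/-- The additive generator given by a planar graph. -/
noncomputable def gen {n : ℕ} (G : Diagram n) : FreeAlg n :=
  MonoidAlgebra.of (Polynomial ℂ) (Graph n) (Graph.mk G)

/-- The defining relations of the chromatic algebra.  In each of them, the graphs agree outside of
a disk in the rectangle; up to isotopy, the disk can be brought into the position used here. -/
inductive Rel (n : ℕ) : FreeAlg n → FreeAlg n → Prop
  /-- `G = G/e - G∖e` for an inner edge `e` which is not a loop: `e` is drawn vertically,
  the other legs of its lower end go down, the other legs of its upper end go up. -/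
  | contract_delete (u v : List Slice) (i a b : ℕ) (G Gc Gd : Diagram n)
      (hG : G.slices = u ++ [⟨i, .vertex a 1⟩, ⟨i, .vertex 1 b⟩] ++ v)
      (hc : Gc.slices = u ++ [⟨i, .vertex a b⟩] ++ v)
      (hd : Gd.slices = u ++ [⟨i, .vertex a 0⟩, ⟨i, .vertex 0 b⟩] ++ v) :
      Rel n (gen G) (gen Gc - gen Gd)
  /-- `G = (Q - 1) G∖e` for a loop `e` at a vertex: `w` is the part of the graph in the interior of
  the disk bounded by `e`, which is attached to the vertex by `k` legs. -/
  | loop (u v w : List Slice) (i a k : ℕ) (hw : IsDiagram k w 0) (G Gd : Diagram n)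
      (hG : G.slices = u ++ [⟨i, .vertex a (k + 2)⟩] ++ shift (i + 1) w ++ [⟨i, .cap⟩] ++ v)
      (hd : Gd.slices = u ++ [⟨i, .vertex a k⟩] ++ shift i w ++ v) :
      Rel n (gen G) ((Polynomial.X - 1 : Polynomial ℂ) • gen Gd)
  /-- `G = (Q - 1) G∖e` for a component `e` which is a simple closed curve:
  `w` is the part of the graph in the interior of the disk bounded by `e`. -/
  | closed_curve (u v w : List Slice) (i : ℕ) (hw : IsDiagram 0 w 0) (G Gd : Diagram n)
      (hG : G.slices = u ++ [⟨i, .cup⟩] ++ shift (i + 1) w ++ [⟨i, .cap⟩] ++ v)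
      (hd : Gd.slices = u ++ shift i w ++ v) :
      Rel n (gen G) ((Polynomial.X - 1 : Polynomial ℂ) • gen Gd)
  /-- `G = 0` if `G` has a `1`-valent vertex in the interior of the rectangle. -/
  | univalent (u v : List Slice) (i : ℕ) (G : Diagram n)
      (hG : G.slices = u ++ [⟨i, .vertex 1 0⟩] ++ v) :
      Rel n (gen G) 0
  /-- A `2`-valent vertex may be deleted, and the two adjacent edges merged. -/
  | bivalent (u v : List Slice) (i : ℕ) (G Gd : Diagram n)
      (hG : G.slices = u ++ [⟨i, .vertex 1 1⟩] ++ v)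
      (hd : Gd.slices = u ++ v) :
      Rel n (gen G) (gen Gd)
  /-- An isolated vertex may be deleted. -/
  | isolated (u v : List Slice) (i : ℕ) (G Gd : Diagram n)
      (hG : G.slices = u ++ [⟨i, .vertex 0 0⟩] ++ v)
      (hd : Gd.slices = u ++ v) :
      Rel n (gen G) (gen Gd)

/-- The chromatic algebra `𝒞ₙ` over `ℂ[Q]`: the quotient of the free algebra by the two-sided ideal
generated by the relations. -/
abbrev ChromaticAlgebra (n : ℕ) : Type := RingQuot (Rel n)

/-- The element of the chromatic algebra given by an isotopy class of graphs. -/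
noncomputable def classOf {n : ℕ} (g : Graph n) : ChromaticAlgebra n :=
  RingQuot.mkAlgHom (Polynomial ℂ) (Rel n) (MonoidAlgebra.of (Polynomial ℂ) (Graph n) g)

/-! ### Edges, connected components, and the induced partition of the boundary points -/

/-- The number of points in which the graph meets the horizontal line number `t` (the line
number `0` is the bottom of the rectangle, slice number `t` lies between the lines `t` and
`t + 1`); it is `0` for the lines above the top of the rectangle. -/
def width : ℕ → List Slice → ℕ → ℕ
  | m, _, 0 => m
  | _, [], _ + 1 => 0
  | m, s :: w, t + 1 => width (m - s.piece.dom + s.piece.cod) w t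

/-- `StrandStep w p q`: the points `p` and `q`, where `(t, j)` is the point number `j` (from the
left) on the horizontal line number `t`, are joined by a piece of an edge inside of a slice. -/
inductive StrandStep (w : List Slice) : ℕ × ℕ → ℕ × ℕ → Prop
  | left (t j : ℕ) (s : Slice) (hs : w[t]? = some s) (hj : j < s.offset) :
      StrandStep w (t, j) (t + 1, j)
  | right (t j : ℕ) (s : Slice) (hs : w[t]? = some s) :
      StrandStep w (t, s.offset + s.piece.dom + j) (t + 1, s.offset + s.piece.cod + j)
  | cup (t i : ℕ) (hs : w[t]? = some ⟨i, .cup⟩) : StrandStep w (t + 1, i) (t + 1, i + 1)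
  | cap (t i : ℕ) (hs : w[t]? = some ⟨i, .cap⟩) : StrandStep w (t, i) (t, i + 1)

/-- Two points of the graph on the horizontal lines lie on the same edge. -/
def SameEdge (w : List Slice) : ℕ × ℕ → ℕ × ℕ → Prop := Relation.EqvGen (StrandStep w)

/-- The point `p` lies on a leg of the vertex in slice number `t`. -/
inductive IsLeg (w : List Slice) (t : ℕ) : ℕ × ℕ → Prop
  | lower (i a b j : ℕ) (hs : w[t]? = some ⟨i, .vertex a b⟩) (hj : j < a) : IsLeg w t (t, i + j)
  | upper (i a b j : ℕ) (hs : w[t]? = some ⟨i, .vertex a b⟩) (hj : j < b) :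
      IsLeg w t (t + 1, i + j)

/-- Two points of the graph lie in the same connected component. -/
def sameComponent (w : List Slice) : Setoid (ℕ × ℕ) :=
  Relation.EqvGen.setoid fun p q => StrandStep w p q ∨ ∃ t, IsLeg w t p ∧ IsLeg w t q

/-- No inner edges: every edge has an endpoint on the boundary of the rectangle.
(A component which is a simple closed curve counts as an inner edge.) -/
def Diagram.NoInnerEdges {n : ℕ} (G : Diagram n) : Prop :=
  ∀ t j, j < width n G.slices t →
    ∃ k < n, SameEdge G.slices (t, j) (0, k) ∨ SameEdge G.slices (t, j) (G.slices.length, k)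

/-- A planar graph without inner edges (all vertices in the interior of the rectangle being
genuine, i.e. of valence at least three). -/
def Diagram.IsBasic {n : ℕ} (G : Diagram n) : Prop :=
  G.NoInnerEdges ∧ ∀ i a b, (⟨i, .vertex a b⟩ : Slice) ∈ G.slices → 3 ≤ a + b

/-- The set `Bₙ` of isotopy classes of graphs without inner edges. -/
def BasicGraph (n : ℕ) : Type := {g : Graph n // ∃ G : Diagram n, G.IsBasic ∧ Graph.mk G = g}

/-- The `2n` boundary points, numbered along the boundary of the rectangle: first the bottom ones
from left to right, then the top ones from right to left. -/
def Diagram.boundaryPoint {n : ℕ} (G : Diagram n) (p : Fin (2 * n)) : ℕ × ℕ :=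
  if (p : ℕ) < n then (0, (p : ℕ)) else (G.slices.length, 2 * n - 1 - (p : ℕ))

/-- The partition of the boundary points induced by a graph: two boundary points lie in the same
block if they lie in the same connected component. -/
def Diagram.boundaryPartition {n : ℕ} (G : Diagram n) : Setoid (Fin (2 * n)) :=
  (sameComponent G.slices).comap G.boundaryPoint

/-- A partition of points on a circle, in their cyclic order, is planar if no two different blocks
cross. -/
def IsPlanar {N : ℕ} (π : Setoid (Fin N)) : Prop :=
  ∀ a b c d : Fin N, a < b → b < c → c < d → π a c → π b d → π a b

/-- The planar partitions of the `2n` boundary points in which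
every block has at least two points. -/
def PlanarPartition (n : ℕ) : Type :=
  {π : Setoid (Fin (2 * n)) // IsPlanar π ∧ ∀ p, ∃ q, q ≠ p ∧ π p q}

end Chromatic

/-!
A graph with `n` endpoints at the bottom and `n` at the top may be turned, by bending the bottom
endpoints, into a graph with `2 n` endpoints at the top (`isot_bend`), and the legs of its vertices
may be turned upwards (`exists_isSimple`).  The normal form of a basic graph is then a forest: a
sequence of arcs and of stars with at least three legs, which are inserted one after the other
between the strands that are already there.  Such sequences are encoded by `StarWord`.

Invariants of isotopy come from state sums (`StrandModel.ev`): the strands are labelled by the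
elements of a finite set, subject to a local condition at each vertex, and the labellings with given
values at the boundary are counted.  Invariance under the elementary isotopies is checked once and
for all in `StrandModel.ev_isot`.  Three instances are used.  Labelling the edges by two colours
detects inner edges (`noInnerEdges_iff`), labelling the components by two colours determines the
induced partition (`boundaryPartition_iff`), and labelling the edges by nonzero elements of
`ZMod q`, with the conservation law at the vertices, counts nowhere-zero flows.

The main geometric step is that joining two adjacent endpoints of a forest by a cap gives, up to
isotopy, a forest or a forest with one inner edge (`resolves_cap`).  If a graph has no inner edges,
the second case is excluded by counting edge colourings, whence every basic graph is isotopic to a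
forest (`exists_isForest`).  Forests with the same partition of the endpoints are isotopic, since
a component whose legs form an interval can be inserted last (`isot_of_conn`), and every planar
partition without singletons has a block that is an interval (`exists_interval_block`).  This gives
the bijection `basicGraphEquiv` with planar partitions.

In the chromatic algebra, the one inner edge that a cap may create is removed by the relations for
contraction and deletion, loops and closed curves.  By induction on the number of pieces every graph
is a combination of forests (`span_basicGraph`).  A graph without inner edges may have vertices of
valence less than three; removing these one at a time by the relations creates no inner edges, by
monotonicity of the number of edge colourings, and this leaves zero or a basic graph
(`classOf_eq_zero_or_basic`).

For linear independence, the flow counts satisfy the defining relations with `Q = q`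
(`flowHom_rel`), and so give functionals on the algebra (`exists_flow_functional`).  A forest
carries an integral flow for which the only sets of endpoints with total flow zero are the unions of
its blocks (`exists_generic_flow`).  Modulo a large `q` this flow can exist on another forest only
if the partition of that forest is coarser (`exists_separating_flow`).  In a linear relation, choose
a graph with maximal partition among those that occur.  Then its coefficient, a polynomial, vanishes
at all large natural numbers `q`, hence it is zero.
-/

namespace Chromatic

/-! ### Diagrams -/

theorem isDiagram_cons {m n : ℕ} {s : Slice} {w : List Slice} :
    IsDiagram m (s :: w) n ↔
      s.offset + s.piece.dom ≤ m ∧ IsDiagram (m - s.piece.dom + s.piece.cod) w n := by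
  constructor
  · rintro ⟨r, rfl, h⟩
    refine ⟨by omega, ?_⟩
    convert h using 1
    omega
  · rintro ⟨h, h'⟩
    refine ⟨m - s.offset - s.piece.dom, by omega, ?_⟩
    convert h' using 1
    omega

theorem isDiagram_nil {m n : ℕ} : IsDiagram m [] n ↔ m = n := Iff.rfl

theorem isDiagram_append {m n : ℕ} {u v : List Slice} :
    IsDiagram m (u ++ v) n ↔ ∃ k, IsDiagram m u k ∧ IsDiagram k v n := by
  induction u generalizing m with
  | nil => simp [isDiagram_nil]
  | cons s u ih => simp [isDiagram_cons, ih, and_assoc]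

theorem IsDiagram.unique {m k k' : ℕ} {w : List Slice} (h : IsDiagram m w k)
    (h' : IsDiagram m w k') : k = k' := by
  induction w generalizing m with
  | nil => exact h.symm.trans h'
  | cons s w ih =>
    rw [isDiagram_cons] at h h'
    exact ih h.2 h'.2

/-- Further vertical strands may be added at the right. -/
theorem IsDiagram.widen {m k : ℕ} {w : List Slice} (h : IsDiagram m w k) (r : ℕ) :
    IsDiagram (m + r) w (k + r) := by
  induction w generalizing m with
  | nil => cases h; rfl
  | cons s w ih =>
    rw [isDiagram_cons] at h ⊢
    refine ⟨by omega, ?_⟩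
    convert ih h.2 using 1
    omega

theorem IsDiagram.shift {m k : ℕ} {w : List Slice} (h : IsDiagram m w k) (i : ℕ) :
    IsDiagram (i + m) (shift i w) (i + k) := by
  induction w generalizing m with
  | nil => cases h; rfl
  | cons s w ih =>
    rw [isDiagram_cons] at h
    simp only [Chromatic.shift, List.map_cons, isDiagram_cons]
    refine ⟨by omega, ?_⟩
    have := ih h.2
    rw [Chromatic.shift] at this
    convert this using 1
    omega

@[simp] theorem Piece.dom_cup : Piece.cup.dom = 0 := rfl
@[simp] theorem Piece.cod_cup : Piece.cup.cod = 2 := rfl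
@[simp] theorem Piece.dom_cap : Piece.cap.dom = 2 := rfl
@[simp] theorem Piece.cod_cap : Piece.cap.cod = 0 := rfl
@[simp] theorem Piece.dom_vertex (a b : ℕ) : (Piece.vertex a b).dom = a := rfl
@[simp] theorem Piece.cod_vertex (a b : ℕ) : (Piece.vertex a b).cod = b := rfl

@[simp] theorem shift_nil (i : ℕ) : shift i [] = [] := rfl
@[simp] theorem shift_cons (i : ℕ) (s : Slice) (w : List Slice) :
    shift i (s :: w) = ⟨i + s.offset, s.piece⟩ :: shift i w := rfl
@[simp] theorem shift_append (i : ℕ) (u w : List Slice) :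
    shift i (u ++ w) = shift i u ++ shift i w := List.map_append

/-! ### Isotopy of diagrams with arbitrary numbers of endpoints -/

/-- An elementary isotopy between diagrams with `m` endpoints at the bottom and `n` at the top. -/
def TStep (m n : ℕ) (w w' : List Slice) : Prop :=
  IsDiagram m w n ∧ IsDiagram m w' n ∧
    ∃ u v x y : List Slice, Move x y ∧ w = u ++ x ++ v ∧ w' = u ++ y ++ v

/-- Isotopy of diagrams with `m` endpoints at the bottom and `n` endpoints at the top. -/
def Isot (m n : ℕ) (w w' : List Slice) : Prop :=
  IsDiagram m w n ∧ Relation.EqvGen (TStep m n) w w'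

theorem Isot.left {m n : ℕ} {w w' : List Slice} (h : Isot m n w w') : IsDiagram m w n := h.1

theorem isDiagram_iff_of_eqvGen {m n : ℕ} {w w' : List Slice}
    (h : Relation.EqvGen (TStep m n) w w') : IsDiagram m w n ↔ IsDiagram m w' n := by
  induction h with
  | rel x y h => exact ⟨fun _ => h.2.1, fun _ => h.1⟩
  | refl x => rfl
  | symm x y _ ih => exact ih.symm
  | trans x y z _ _ h h' => exact h.trans h'

theorem Isot.right {m n : ℕ} {w w' : List Slice} (h : Isot m n w w') : IsDiagram m w' n :=
  (isDiagram_iff_of_eqvGen h.2).1 h.1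

theorem Isot.refl {m n : ℕ} {w : List Slice} (h : IsDiagram m w n) : Isot m n w w :=
  ⟨h, .refl _⟩

theorem Isot.symm {m n : ℕ} {w w' : List Slice} (h : Isot m n w w') : Isot m n w' w :=
  ⟨h.right, .symm _ _ h.2⟩

theorem Isot.trans {m n : ℕ} {w w' w'' : List Slice} (h : Isot m n w w')
    (h' : Isot m n w' w'') : Isot m n w w'' :=
  ⟨h.left, .trans _ _ _ h.2 h'.2⟩

theorem Isot.of_move {m n : ℕ} {x y : List Slice} (h : Move x y) (hx : IsDiagram m x n)
    (hy : IsDiagram m y n) : Isot m n x y :=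
  ⟨hx, .rel _ _ ⟨hx, hy, [], [], x, y, h, by simp, by simp⟩⟩

theorem Isot.append_right {m k n : ℕ} {w w' v : List Slice} (h : Isot m k w w')
    (hv : IsDiagram k v n) : Isot m n (w ++ v) (w' ++ v) := by
  refine ⟨h.left.append hv, ?_⟩
  replace h := h.2
  induction h with
  | rel A B h =>
    obtain ⟨hA, hB, u, v', x, y, hm, rfl, rfl⟩ := h
    exact .rel _ _ ⟨hA.append hv, hB.append hv, u, v' ++ v, x, y, hm, by simp, by simp⟩
  | refl A => exact .refl _
  | symm A B _ ih => exact .symm _ _ ih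
  | trans A B C _ _ ih ih' => exact .trans _ _ _ ih ih'

theorem Isot.append_left {m k n : ℕ} {w w' u : List Slice} (hu : IsDiagram m u k)
    (h : Isot k n w w') : Isot m n (u ++ w) (u ++ w') := by
  refine ⟨hu.append h.left, ?_⟩
  replace h := h.2
  induction h with
  | rel A B h =>
    obtain ⟨hA, hB, u', v', x, y, hm, rfl, rfl⟩ := h
    exact .rel _ _ ⟨hu.append hA, hu.append hB, u ++ u', v', x, y, hm, by simp, by simp⟩
  | refl A => exact .refl _
  | symm A B _ ih => exact .symm _ _ ih
  | trans A B C _ _ ih ih' => exact .trans _ _ _ ih ih'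

theorem Isot.append {m k n : ℕ} {w w' v v' : List Slice} (h : Isot m k w w')
    (h' : Isot k n v v') : Isot m n (w ++ v) (w' ++ v') :=
  (h.append_right h'.left).trans (.append_left h.right h')

theorem Isot.widen {m n : ℕ} {w w' : List Slice} (h : Isot m n w w') (r : ℕ) :
    Isot (m + r) (n + r) w w' := by
  refine ⟨h.left.widen r, ?_⟩
  replace h := h.2
  induction h with
  | rel A B h => exact .rel _ _ ⟨h.1.widen r, h.2.1.widen r, h.2.2⟩
  | refl A => exact .refl _
  | symm A B _ ih => exact .symm _ _ ih
  | trans A B C _ _ ih ih' => exact .trans _ _ _ ih ih'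

theorem Move.shift {x y : List Slice} (h : Move x y) (i : ℕ) :
    Move (shift i x) (shift i y) := by
  cases h with
  | interchange j k p q => simpa [add_assoc] using Move.interchange (i + j) k p q
  | zigzag_left j => exact .zigzag_left (i + j)
  | zigzag_right j => exact .zigzag_right (i + j)
  | rotate_right j a b => simpa [add_assoc] using Move.rotate_right (i + j) a b
  | rotate_left j a b => simpa [add_assoc] using Move.rotate_left (i + j) a b

theorem Isot.shift {m n : ℕ} {w w' : List Slice} (h : Isot m n w w') (i : ℕ) :
    Isot (i + m) (i + n) (shift i w) (shift i w') := by
  refine ⟨h.left.shift i, ?_⟩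
  replace h := h.2
  induction h with
  | rel A B h =>
    obtain ⟨hA, hB, u, v, x, y, hm, rfl, rfl⟩ := h
    exact .rel _ _ ⟨hA.shift i, hB.shift i, Chromatic.shift i u, Chromatic.shift i v, _, _,
      hm.shift i, by simp, by simp⟩
  | refl A => exact .refl _
  | symm A B _ ih => exact .symm _ _ ih
  | trans A B C _ _ ih ih' => exact .trans _ _ _ ih ih'

theorem Isot.mk_eq {n : ℕ} {w w' : List Slice} (h : Isot n n w w') :
    Graph.mk ⟨w, h.left⟩ = Graph.mk ⟨w', h.right⟩ := by
  have key : ∀ w w', Relation.EqvGen (TStep n n) w w' →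
      ∀ (h : IsDiagram n w n) (h' : IsDiagram n w' n), isotopy n ⟨w, h⟩ ⟨w', h'⟩ := by
    intro w w' h
    induction h with
    | rel A B h =>
      intro _ _
      exact .rel _ _ h.2.2
    | refl A => intro _ _; exact .refl _
    | symm A B _ ih => intro h h'; exact .symm _ _ (ih h' h)
    | trans A B C h _ ih ih' =>
      intro hA hC
      have hB := (isDiagram_iff_of_eqvGen h).1 hA
      exact .trans _ _ _ (ih hA hB) (ih' hB hC)
  exact Quotient.sound (key _ _ h.2 _ _)

theorem isot_of_isotopy {n : ℕ} {G H : Diagram n} (h : isotopy n G H) :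
    Isot n n G.slices H.slices := by
  refine ⟨G.isDiagram, ?_⟩
  induction h with
  | rel A B h => exact .rel _ _ ⟨A.isDiagram, B.isDiagram, h⟩
  | refl A => exact .refl _
  | symm A B _ ih => exact .symm _ _ ih
  | trans A B C _ _ ih ih' => exact .trans _ _ _ ih ih'

/-! ### Elementary isotopies -/

theorem isot_interchange {m : ℕ} (i k : ℕ) (p q : Piece) (hm : i + p.dom + k + q.dom ≤ m) :
    Isot m (m - p.dom - q.dom + p.cod + q.cod) [⟨i, p⟩, ⟨i + p.cod + k, q⟩]
      [⟨i + p.dom + k, q⟩, ⟨i, p⟩] := by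
  refine .of_move (.interchange i k p q) ?_ ?_ <;>
  · simp only [isDiagram_cons, isDiagram_nil]
    omega

theorem isot_zigzag_left {m : ℕ} (i : ℕ) (hm : i + 1 ≤ m) :
    Isot m m [⟨i, .cup⟩, ⟨i + 1, .cap⟩] [] := by
  refine .of_move (.zigzag_left i) ?_ rfl
  simp only [isDiagram_cons, isDiagram_nil, Piece.dom_cup, Piece.cod_cup, Piece.dom_cap,
    Piece.cod_cap]
  omega

theorem isot_zigzag_right {m : ℕ} (i : ℕ) (hm : i + 1 ≤ m) :
    Isot m m [⟨i + 1, .cup⟩, ⟨i, .cap⟩] [] := by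
  refine .of_move (.zigzag_right i) ?_ rfl
  simp only [isDiagram_cons, isDiagram_nil, Piece.dom_cup, Piece.cod_cup, Piece.dom_cap,
    Piece.cod_cap]
  omega

theorem isot_rotate_right {m : ℕ} (i a b : ℕ) (hm : i + a + 1 ≤ m) :
    Isot m (m - (a + 1) + b) [⟨i, .vertex (a + 1) b⟩]
      [⟨i, .vertex a (b + 1)⟩, ⟨i + b, .cap⟩] := by
  refine .of_move (.rotate_right i a b) ?_ ?_ <;>
  · simp only [isDiagram_cons, isDiagram_nil, Piece.dom_vertex, Piece.cod_vertex, Piece.dom_cap,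
      Piece.cod_cap, and_true]
    omega

theorem isot_rotate_left {m : ℕ} (i a b : ℕ) (hm : i + a + 1 ≤ m) :
    Isot m (m - (a + 1) + b) [⟨i, .vertex (a + 1) b⟩]
      [⟨i + 1, .vertex a (b + 1)⟩, ⟨i, .cap⟩] := by
  refine .of_move (.rotate_left i a b) ?_ ?_ <;>
  · simp only [isDiagram_cons, isDiagram_nil, Piece.dom_vertex, Piece.cod_vertex, Piece.dom_cap,
      Piece.cod_cap, and_true]
    omega

/-- The leftmost upper leg of a vertex may leave the vertex downwards, and then bend up. -/
theorem isot_unrotate_left {m : ℕ} (i a b : ℕ) (hm : i + a ≤ m) :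
    Isot m (m - a + (b + 1)) [⟨i, .vertex a (b + 1)⟩]
      [⟨i, .cup⟩, ⟨i + 1, .vertex (a + 1) b⟩] := by
  have h1 := Isot.append_left (u := [⟨i, .cup⟩]) (m := m) (k := m + 2)
    (by simp [isDiagram_cons, isDiagram_nil]; omega)
    (isot_rotate_left (m := m + 2) (i + 1) a b (by omega))
  have h2 := (isot_interchange (m := m) i 0 .cup (.vertex a (b + 1)) (by simp; omega)).append_right
    (v := [⟨i + 1, .cap⟩]) (n := m - a + (b + 1))
    (by simp [isDiagram_cons, isDiagram_nil]; omega)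
  have h3 := Isot.append_left (u := [⟨i, .vertex a (b + 1)⟩]) (m := m) (k := m - a + (b + 1))
    (by simp [isDiagram_cons, isDiagram_nil]; omega) (isot_zigzag_left i (by omega))
  have e : m + 2 - (a + 1) + b = m - a + (b + 1) := by omega
  rw [e] at h1
  exact ((h1.trans h2).trans h3).symm

/-- The rightmost upper leg of a vertex may leave the vertex downwards, and then bend up. -/
theorem isot_unrotate_right {m : ℕ} (i a b : ℕ) (hm : i + a ≤ m) :
    Isot m (m - a + (b + 1)) [⟨i, .vertex a (b + 1)⟩]
      [⟨i + a, .cup⟩, ⟨i, .vertex (a + 1) b⟩] := by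
  have h1 := Isot.append_left (u := [⟨i + a, .cup⟩]) (m := m) (k := m + 2)
    (by simp [isDiagram_cons, isDiagram_nil]; omega)
    (isot_rotate_right (m := m + 2) i a b (by omega))
  have h2 := (isot_interchange (m := m) i 0 (.vertex a (b + 1)) .cup
    (by simp; omega)).symm.append_right
    (v := [⟨i + b, .cap⟩]) (n := m - a + (b + 1))
    (by simp [isDiagram_cons, isDiagram_nil]; omega)
  have h3 := Isot.append_left (u := [⟨i, .vertex a (b + 1)⟩]) (m := m) (k := m - a + (b + 1))
    (by simp [isDiagram_cons, isDiagram_nil]; omega) (isot_zigzag_right (i + b) (by omega))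
  have e : m + 2 - (a + 1) + b = m - a + (b + 1) := by omega
  rw [e] at h1
  exact ((h1.trans h2).trans h3).symm

/-- Conditions on the pieces of a diagram: all vertices have their legs at the top, and
satisfy a condition on their valence. -/
def IsSimple (P : ℕ → Prop) (w : List Slice) : Prop :=
  ∀ s ∈ w, s.piece = .cup ∨ s.piece = .cap ∨ ∃ k, P k ∧ s.piece = .vertex 0 k

theorem IsSimple.append {P : ℕ → Prop} {u v : List Slice} (hu : IsSimple P u)
    (hv : IsSimple P v) : IsSimple P (u ++ v) := by
  intro s hs
  rcases List.mem_append.1 hs with h | h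
  exacts [hu s h, hv s h]

theorem exists_isSimple_vertex (P : ℕ → Prop) (m i a b : ℕ) (hm : i + a ≤ m) (h : P (a + b)) :
    ∃ w, Isot m (m - a + b) [⟨i, .vertex a b⟩] w ∧ IsSimple P w := by
  induction a generalizing b with
  | zero =>
    refine ⟨_, .refl (by simp [isDiagram_cons, isDiagram_nil]; omega), ?_⟩
    intro s hs
    rw [List.mem_singleton] at hs
    exact .inr (.inr ⟨b, by simpa using h, by rw [hs]⟩)
  | succ a ih =>
    obtain ⟨w, hw, hs⟩ := ih (b + 1) (by omega) (by convert h using 1; omega)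
    refine ⟨w ++ [⟨i + b, .cap⟩], (isot_rotate_right i a b (by omega)).trans ?_, ?_⟩
    · exact hw.append_right (v := [⟨i + b, .cap⟩])
        (by simp [isDiagram_cons, isDiagram_nil]; omega)
    · refine hs.append ?_
      intro s hs
      rw [List.mem_singleton] at hs
      exact .inr (.inl (by rw [hs]))

/-- Every diagram is isotopic to one in which all the legs of vertices point upwards. -/
theorem exists_isSimple (P : ℕ → Prop) {m n : ℕ} {w : List Slice} (hw : IsDiagram m w n)
    (h : ∀ i a b, (⟨i, .vertex a b⟩ : Slice) ∈ w → P (a + b)) :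
    ∃ w', Isot m n w w' ∧ IsSimple P w' := by
  induction w generalizing m with
  | nil => exact ⟨[], .refl hw, by simp [IsSimple]⟩
  | cons s w ih =>
    have hw' := hw
    rw [isDiagram_cons] at hw
    obtain ⟨w', h1, h2⟩ := ih hw.2 fun i a b hm => h i a b (List.mem_cons_of_mem _ hm)
    have hs : ∃ w', Isot m (m - s.piece.dom + s.piece.cod) [s] w' ∧ IsSimple P w' := by
      obtain ⟨i, p⟩ := s
      cases p with
      | vertex a b => exact exists_isSimple_vertex P m i a b hw.1 (h i a b List.mem_cons_self)
      | _ => exact ⟨_, .refl (isDiagram_cons.2 ⟨hw.1, rfl⟩), by simp [IsSimple]⟩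
    obtain ⟨w'', h3, h4⟩ := hs
    exact ⟨w'' ++ w', h3.append h1, h4.append h2⟩

/-! ### Bending the bottom endpoints to the top -/

/-- `n` nested local minima. -/
def cups (n : ℕ) : List Slice := (List.range n).map fun i => ⟨i, .cup⟩

/-- `k` nested local maxima, joining the `k` strands after the first `c` ones to the next `k`
strands. -/
def caps (c : ℕ) : ℕ → List Slice
  | 0 => []
  | k + 1 => ⟨c + k, .cap⟩ :: caps c k

theorem cups_succ (n : ℕ) : cups (n + 1) = ⟨0, .cup⟩ :: shift 1 (cups n) := by
  simp [cups, List.range_succ_eq_map, shift, Function.comp_def, add_comm]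

theorem caps_add (c d k : ℕ) : caps (c + d) k = shift c (caps d k) := by
  induction k with
  | zero => rfl
  | succ k ih => simp [caps, ih, add_assoc]

theorem isDiagram_cups (m n : ℕ) : IsDiagram m (cups n) (2 * n + m) := by
  induction n generalizing m with
  | zero => simp [cups, isDiagram_nil]
  | succ n ih =>
    rw [cups_succ, isDiagram_cons]
    refine ⟨by simp, ?_⟩
    have := (ih (m + 1)).shift 1
    convert this using 1
    · simp; omega
    · omega

theorem isDiagram_caps {c k m : ℕ} (h : c + 2 * k ≤ m) : IsDiagram m (caps c k) (m - 2 * k) := by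
  induction k generalizing m with
  | zero => simp [caps, isDiagram_nil]
  | succ k ih =>
    rw [caps, isDiagram_cons]
    refine ⟨by simp; omega, ?_⟩
    convert ih (m := m - 2) (by omega) using 1
    simp; omega

/-- A local maximum at the right of a diagram may be moved below it. -/
theorem isot_append_cap {m k r : ℕ} {w : List Slice} (hw : IsDiagram m w k) (c : ℕ)
    (hr : c + 2 ≤ r) :
    Isot (m + r) (k + r - 2) (w ++ [⟨k + c, .cap⟩]) (⟨m + c, .cap⟩ :: w) := by
  induction w generalizing m with
  | nil =>
    cases hw
    exact .refl (by simp [isDiagram_cons, isDiagram_nil]; omega)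
  | cons s w ih =>
    rw [isDiagram_cons] at hw
    have h1 := Isot.append_left (u := [s]) (m := m + r)
      (by rw [isDiagram_cons]; exact ⟨by omega, by rw [isDiagram_nil]; omega⟩) (ih hw.2)
    refine h1.trans ?_
    have h2 := isot_interchange (m := m + r) s.offset (m - s.offset - s.piece.dom + c) s.piece .cap
      (by simp; omega)
    have h3 := h2.append_right (v := w) (n := k + r - 2)
      (by convert hw.2.widen (r - 2) using 1 <;> (try simp only [Piece.dom_cap, Piece.cod_cap]) <;> omega)
    have e1 : s.offset + s.piece.cod + (m - s.offset - s.piece.dom + c) =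
      m - s.piece.dom + s.piece.cod + c := by omega
    have e2 : s.offset + s.piece.dom + (m - s.offset - s.piece.dom + c) = m + c := by omega
    rw [e1, e2] at h3
    exact h3

/-- The iterated zigzag. -/
theorem isot_cups_caps (m n : ℕ) (hm : n ≤ m) : Isot m m (cups n ++ caps n n) [] := by
  induction n generalizing m with
  | zero => exact .refl rfl
  | succ n ih =>
    rw [cups_succ, caps]
    have e : caps (n + 1) n = shift 1 (caps n n) := by rw [add_comm, caps_add]
    have h1 := isot_append_cap ((isDiagram_cups 0 n).shift 1) 0
      (r := m + 1) (by omega)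
    rw [show 1 + (2 * n + 0) + 0 = n + 1 + n by omega] at h1
    have h2 := Isot.append_left (u := [⟨0, .cup⟩]) (m := m) (k := 1 + 0 + (m + 1))
      (by simp [isDiagram_cons, isDiagram_nil]; omega) h1
    have h3 := h2.append_right (v := caps (n + 1) n) (n := m)
      (by convert isDiagram_caps (c := n + 1) (k := n) (m := 2 * n + m) (by omega) using 1 <;> omega)
    have h4 := (isot_zigzag_left (m := m) 0 (by omega)).append_right
      (v := shift 1 (cups n) ++ caps (n + 1) n) (n := m) (by
        rw [e, ← shift_append]
        have := (ih (m - 1) (by omega)).left.shift 1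
        rwa [show 1 + (m - 1) = m by omega] at this)
    have h5 : Isot m m (shift 1 (cups n) ++ caps (n + 1) n) [] := by
      rw [e, ← shift_append]
      have := (ih (m - 1) (by omega)).shift 1
      rwa [show 1 + (m - 1) = m by omega] at this
    refine Isot.trans ?_ ((h3.trans ?_).trans h5)
    · simpa using Isot.refl h3.left
    · simpa using h4

/-- Bending all bottom endpoints to the top and back again does not change a diagram. -/
theorem isot_bend {n : ℕ} {w : List Slice} (hw : IsDiagram n w n) :
    Isot n n w (cups n ++ w ++ caps n n) := by
  have key : ∀ k, k ≤ n → Isot (n + 2 * k) n (w ++ caps n k) (caps n k ++ w) := by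
    intro k hk
    induction k with
    | zero => simpa [caps] using Isot.refl hw
    | succ k ih =>
      have h1 := (isot_append_cap (r := 2 * (k + 1)) hw k (by omega)).append_right
        (v := caps n k) (n := n)
        (by convert isDiagram_caps (c := n) (k := k) (m := n + 2 * k) (by omega) using 1 <;> omega)
      have h2 := Isot.append_left (u := [⟨n + k, .cap⟩]) (m := n + 2 * (k + 1)) (k := n + 2 * k)
        (by simp [isDiagram_cons, isDiagram_nil]; omega) (ih (by omega))
      simpa [caps] using h1.trans (by simpa using h2)
  have h1 := Isot.append_left (isDiagram_cups n n) (by simpa [add_comm] using key n le_rfl)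
  have h2 := (isot_cups_caps n n le_rfl).append_right hw
  simpa using (h1.trans (by simpa using h2)).symm

/-! ### Forests of stars -/

/-- A slice that adds a new component to a forest: an arc, or a star with at least three legs. -/
def Slice.IsStar (s : Slice) : Prop := s.piece = .cup ∨ ∃ k, 3 ≤ k ∧ s.piece = .vertex 0 k

/-- A forest: all components are arcs or stars, and they are inserted one after the other. -/
def IsForest (w : List Slice) : Prop := ∀ s ∈ w, s.IsStar

theorem IsForest.append {u v : List Slice} (hu : IsForest u) (hv : IsForest v) :
    IsForest (u ++ v) := by
  intro s hs
  rcases List.mem_append.1 hs with h | h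
  exacts [hu s h, hv s h]

theorem IsForest.of_append_left {u v : List Slice} (h : IsForest (u ++ v)) : IsForest u :=
  fun s hs => h s (List.mem_append_left _ hs)

theorem isForest_singleton {s : Slice} : IsForest [s] ↔ s.IsStar := by simp [IsForest]

theorem IsForest.last {u : List Slice} {s : Slice} (h : IsForest (u ++ [s])) : s.IsStar :=
  h s (by simp)

theorem Slice.IsStar.dom_eq {s : Slice} (h : s.IsStar) : s.piece.dom = 0 := by
  rcases h with h | ⟨k, -, h⟩ <;> rw [h] <;> rfl

theorem isDiagram_singleton {m n : ℕ} {s : Slice} :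
    IsDiagram m [s] n ↔ s.offset + s.piece.dom ≤ m ∧ m - s.piece.dom + s.piece.cod = n := by
  rw [isDiagram_cons, isDiagram_nil]

theorem isDiagram_snoc {m n : ℕ} {w : List Slice} {s : Slice} :
    IsDiagram m (w ++ [s]) n ↔ ∃ k, IsDiagram m w k ∧ s.offset + s.piece.dom ≤ k ∧
      k - s.piece.dom + s.piece.cod = n := by
  simp [isDiagram_append, isDiagram_singleton]

/-- The local pictures of inner edges that can arise from a forest: a loop bounding an empty disk,
a simple closed curve bounding an empty disk, and an edge between two vertices. -/
inductive InnerEdge : List Slice → Prop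
  | loop (j p q : ℕ) : InnerEdge [⟨j, .vertex 0 (p + 2 + q)⟩, ⟨j + p, .cap⟩]
  | closed (j : ℕ) : InnerEdge [⟨j, .cup⟩, ⟨j, .cap⟩]
  | edge (j p q l : ℕ) :
      InnerEdge [⟨j, .vertex 0 (p + 1 + q)⟩, ⟨j + p, .vertex 1 l⟩]

/-- A diagram is isotopic to a forest, or to a forest with one inner edge. -/
def Resolves (N : ℕ) (w : List Slice) : Prop :=
  (∃ F, Isot 0 N w F ∧ IsForest F) ∨
    ∃ F x F', Isot 0 N w (F ++ x ++ F') ∧ IsForest F ∧ InnerEdge x ∧ IsForest F'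

theorem Resolves.of_isot {N : ℕ} {w w' : List Slice} (h : Isot 0 N w w') (h' : Resolves N w') :
    Resolves N w := by
  rcases h' with ⟨F, h1, h2⟩ | ⟨F, x, F', h1, h2⟩
  · exact .inl ⟨F, h.trans h1, h2⟩
  · exact .inr ⟨F, x, F', h.trans h1, h2⟩

theorem Resolves.snoc {M N : ℕ} {w : List Slice} {s : Slice} (h : Resolves M w) (hs : s.IsStar)
    (hM : s.offset ≤ M) (hN : N = M + s.piece.cod) : Resolves N (w ++ [s]) := by
  have hd : IsDiagram M [s] N :=
    isDiagram_singleton.2 ⟨by rw [hs.dom_eq]; omega, by rw [hs.dom_eq]; omega⟩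
  rcases h with ⟨F, h1, h2⟩ | ⟨F, x, F', h1, h2, h3, h4⟩
  · exact .inl ⟨F ++ [s], h1.append_right hd, h2.append (isForest_singleton.2 hs)⟩
  · exact .inr ⟨F, x, F' ++ [s], by simpa using h1.append_right hd, h2, h3,
      h4.append (isForest_singleton.2 hs)⟩

/-- A piece to the left of a newly inserted star may be moved below it. -/
theorem isot_swap_left {M N i j : ℕ} {u : List Slice} {p q : Piece} (hu : IsDiagram 0 u M)
    (hq : q.dom = 0) (hi : i + p.dom ≤ j) (hj : j ≤ M) (hN : N = M - p.dom + p.cod + q.cod) :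
    Isot 0 N (u ++ [⟨j, q⟩] ++ [⟨i, p⟩]) (u ++ [⟨i, p⟩] ++ [⟨j - p.dom + p.cod, q⟩]) := by
  have h := (isot_interchange (m := M) i (j - i - p.dom) p q (by omega)).symm.append_left hu
  rw [show i + p.dom + (j - i - p.dom) = j by omega,
    show i + p.cod + (j - i - p.dom) = j - p.dom + p.cod by omega,
    show M - p.dom - q.dom + p.cod + q.cod = N by omega] at h
  simpa using h

/-- A piece to the right of a newly inserted star may be moved below it. -/
theorem isot_swap_right {M N i j : ℕ} {u : List Slice} {p q : Piece} (hu : IsDiagram 0 u M)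
    (hq : q.dom = 0) (hi : j + q.cod ≤ i) (hj : i + p.dom ≤ M + q.cod)
    (hN : N = M - p.dom + p.cod + q.cod) :
    Isot 0 N (u ++ [⟨j, q⟩] ++ [⟨i, p⟩]) (u ++ [⟨i - q.cod, p⟩] ++ [⟨j, q⟩]) := by
  have h := (isot_interchange (m := M) j (i - j - q.cod) q p (by omega)).append_left hu
  rw [show j + q.cod + (i - j - q.cod) = i by omega,
    show j + q.dom + (i - j - q.cod) = i - q.cod by omega,
    show M - q.dom - p.dom + q.cod + p.cod = N by omega] at h
  simpa using h

/-- Splitting a boundary endpoint of a forest into `l` endpoints by a new vertex: if the endpoint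
lies on an arc the result is a forest, otherwise there is exactly one inner edge. -/
theorem resolves_split {l : ℕ} (hl : 2 ≤ l) {w : List Slice} (hw : IsForest w) {N i : ℕ}
    (hd : IsDiagram 0 w N) (hi : i + 1 ≤ N) :
    Resolves (N - 1 + l) (w ++ [⟨i, .vertex 1 l⟩]) := by
  induction w using List.reverseRecOn generalizing N i with
  | nil => cases hd; omega
  | append_singleton u s ih =>
    obtain ⟨M, hu, hs, hN⟩ := isDiagram_snoc.1 hd
    have hstar := hw.last
    have hs0 := hstar.dom_eq
    have huf := hw.of_append_left
    obtain ⟨j, q⟩ := s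
    simp only at hs hs0 hN
    rcases lt_or_ge i j with hij | hij
    · refine .of_isot (isot_swap_left hu hs0 (by simp; omega) (by omega) (by simp; omega)) ?_
      exact (ih huf hu (by omega)).snoc hstar (by simp; omega) (by simp; omega)
    rcases le_or_gt (j + q.cod) i with hij' | hij'
    · refine .of_isot (isot_swap_right hu hs0 (by omega) (by simp; omega) (by simp; omega)) ?_
      exact (ih huf hu (by omega)).snoc hstar (by simp; omega) (by simp; omega)
    rcases hstar with h | ⟨k, hk, h⟩ <;> simp only at h <;> subst h
    · -- The endpoint lies on an arc: the arc becomes a leg of the new vertex.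
      refine .inl ⟨u ++ [⟨j, .vertex 0 (l + 1)⟩], ?_,
        huf.append (isForest_singleton.2 (.inr ⟨l + 1, by omega, rfl⟩))⟩
      simp only [Piece.cod_cup, Piece.dom_cup] at *
      obtain rfl | rfl : i = j ∨ i = j + 1 := by omega
      · have h := (isot_unrotate_right (m := M) i 0 l (by omega)).symm.append_left hu
        rw [show M - 0 + (l + 1) = N - 1 + l by omega] at h
        simpa using h
      · have h := (isot_unrotate_left (m := M) j 0 l (by omega)).symm.append_left hu
        rw [show M - 0 + (l + 1) = N - 1 + l by omega] at h
        simpa using h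
    · simp only [Piece.cod_vertex, Piece.dom_vertex] at *
      refine .inr ⟨u, _, [], ?_, huf, .edge j (i - j) (k - 1 - (i - j)) l, by simp [IsForest]⟩
      rw [show i - j + 1 + (k - 1 - (i - j)) = k by omega, show j + (i - j) = i by omega]
      simp only [List.append_nil, List.append_assoc, List.cons_append, List.nil_append]
      refine .refl (hu.append ?_)
      simp [isDiagram_cons, isDiagram_nil]
      omega

/-- Joining two adjacent boundary endpoints of a forest: the result is a forest, or it has exactly
one inner edge. -/
theorem resolves_cap {w : List Slice} (hw : IsForest w) {N i : ℕ}
    (hd : IsDiagram 0 w N) (hi : i + 2 ≤ N) :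
    Resolves (N - 2) (w ++ [⟨i, .cap⟩]) := by
  induction w using List.reverseRecOn generalizing N i with
  | nil => cases hd; omega
  | append_singleton u s ih =>
    obtain ⟨M, hu, hs, hN⟩ := isDiagram_snoc.1 hd
    have hstar := hw.last
    have hs0 := hstar.dom_eq
    have huf := hw.of_append_left
    obtain ⟨j, q⟩ := s
    simp only at hs hs0 hN
    rcases le_or_gt (i + 2) j with hij | hij
    · refine .of_isot (isot_swap_left hu hs0 (by simp; omega) (by omega) (by simp; omega)) ?_
      exact (ih huf hu (by omega)).snoc hstar (by simp; omega) (by simp; omega)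
    rcases le_or_gt (j + q.cod) i with hij' | hij'
    · refine .of_isot (isot_swap_right hu hs0 (by omega) (by simp; omega) (by simp; omega)) ?_
      exact (ih huf hu (by omega)).snoc hstar (by simp; omega) (by simp; omega)
    rcases hstar with h | ⟨k, hk, h⟩ <;> simp only at h <;> subst h
    · simp only [Piece.cod_cup, Piece.dom_cup] at *
      obtain rfl | rfl | rfl : j = i + 1 ∨ i = j ∨ i = j + 1 := by omega
      · refine .inl ⟨u, ?_, huf⟩
        have h := (isot_zigzag_right (m := M) i (by omega)).append_left hu
        rw [show N - 2 = M by omega]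
        simpa using h
      · refine .inr ⟨u, _, [], ?_, huf, .closed i, by simp [IsForest]⟩
        simp only [List.append_nil, List.append_assoc, List.cons_append, List.nil_append]
        refine .refl (hu.append ?_)
        simp [isDiagram_cons, isDiagram_nil]
        omega
      · refine .inl ⟨u, ?_, huf⟩
        have h := (isot_zigzag_left (m := M) j (by omega)).append_left hu
        rw [show N - 2 = M by omega]
        simpa using h
    · simp only [Piece.cod_vertex, Piece.dom_vertex] at *
      obtain ⟨k, rfl⟩ : ∃ l, k = l + 1 := ⟨k - 1, by omega⟩
      obtain rfl | hij'' | hij'' : j = i + 1 ∨ (j ≤ i ∧ i + 2 ≤ j + (k + 1)) ∨ i = j + k := by omega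
      · have h := (isot_rotate_left (m := M) i 0 k (by omega)).symm.append_left hu
        rw [show M - (0 + 1) + k = N - 2 by omega] at h
        refine .of_isot (by simpa using h) ?_
        convert resolves_split (l := k) (by omega) huf hu (i := i) (by omega) using 1
        omega
      · refine .inr ⟨u, _, [], ?_, huf, .loop j (i - j) (k - 1 - (i - j)), by simp [IsForest]⟩
        rw [show i - j + 2 + (k - 1 - (i - j)) = k + 1 by omega, show j + (i - j) = i by omega]
        simp only [List.append_nil, List.append_assoc, List.cons_append, List.nil_append]
        refine .refl (hu.append ?_)
        simp [isDiagram_cons, isDiagram_nil]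
        omega
      · subst hij''
        have h := (isot_rotate_right (m := M) j 0 k (by omega)).symm.append_left hu
        rw [show M - (0 + 1) + k = N - 2 by omega] at h
        refine .of_isot (by simpa using h) ?_
        convert resolves_split (l := k) (by omega) huf hu (i := j) (by omega) using 1
        omega

/-! ### State sums -/

theorem exists_append_of_le {i d : ℕ} {α : Type} {x : List α} (h : i + d ≤ x.length) :
    ∃ l a r, x = l ++ (a ++ r) ∧ l.length = i ∧ a.length = d :=
  ⟨x.take i, (x.drop i).take d, (x.drop i).drop d, by simp, by simp; omega, by simp; omega⟩

/-- A rule for labelling the strands of planar graphs, with labels in `α`.  All strands are directed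
upwards; a local extremum joins a label `d` to the label `dual d`, and `vertex x y` says which
labels `x` on the lower and `y` on the upper legs are allowed at a vertex. -/
structure StrandModel (α : Type) where
  dual : α → α
  dual_dual : ∀ d, dual (dual d) = d
  vertex : List α → List α → Prop
  rotate_right : ∀ x y d, vertex (x ++ [d]) y ↔ vertex x (y ++ [dual d])
  rotate_left : ∀ x y d, vertex (d :: x) y ↔ vertex x (dual d :: y)

variable {α : Type}

/-- The labels `x` below and `y` above a piece are allowed. -/
def StrandModel.Adm (M : StrandModel α) : Piece → List α → List α → Prop
  | .cup, _, y => ∃ d, y = [d, M.dual d]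
  | .cap, x, _ => ∃ d, x = [d, M.dual d]
  | .vertex _ _, x, y => M.vertex x y

section words

variable [Fintype α]

variable (α) in
/-- The words of length `k`. -/
noncomputable def words (k : ℕ) : Finset (List α) := (List.finite_length_eq α k).toFinset

@[simp] theorem mem_words {k : ℕ} {x : List α} : x ∈ words α k ↔ x.length = k := by
  simp [words]

variable {R : Type} [CommSemiring R]

theorem sum_words_zero (f : List α → R) : ∑ b ∈ words α 0, f b = f [] := by
  rw [show words α 0 = {[]} by ext; simp, Finset.sum_singleton]

theorem sum_words_cons (k : ℕ) (f : List α → R) :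
    ∑ b ∈ words α (k + 1), f b = ∑ t ∈ words α k, ∑ d, f (d :: t) := by
  rw [← Finset.sum_product']
  symm
  refine Finset.sum_bij (fun p _ => p.2 :: p.1) ?_ ?_ ?_ ?_
  · simp
  · rintro ⟨a, b⟩ _ ⟨c, d⟩ _ h
    simp_all
  · rintro (_ | ⟨d, t⟩) h
    · simp at h
    · exact ⟨(t, d), by simpa using h, rfl⟩
  · simp

theorem sum_words_snoc (k : ℕ) (f : List α → R) :
    ∑ b ∈ words α (k + 1), f b = ∑ t ∈ words α k, ∑ d, f (t ++ [d]) := by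
  rw [← Finset.sum_product']
  symm
  refine Finset.sum_bij (fun p _ => p.1 ++ [p.2]) ?_ ?_ ?_ ?_
  · simp
  · rintro ⟨a, b⟩ _ ⟨c, d⟩ _ h
    have := List.append_inj' h rfl
    simp_all
  · intro x h
    obtain rfl | ⟨t, d, rfl⟩ := List.eq_nil_or_concat x
    · simp at h
    · exact ⟨(t, d), by simpa using h, by simp⟩
  · simp

theorem sum_words_one (f : List α → R) : ∑ b ∈ words α 1, f b = ∑ d, f [d] := by
  rw [sum_words_cons, sum_words_zero]

end words

open Classical in
/-- The function that is `1` at the word `y` and `0` at all other words. -/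
noncomputable def delta {R : Type} [CommSemiring R] (y z : List α) : R := if z = y then 1 else 0

theorem delta_self {R : Type} [CommSemiring R] (y : List α) : (delta y y : R) = 1 := if_pos rfl

theorem eq_of_delta_ne_zero {R : Type} [CommSemiring R] {y z : List α}
    (h : (delta y z : R) ≠ 0) : z = y := by
  by_contra hne
  exact h (if_neg hne)

namespace StrandModel

variable [Fintype α] {R : Type} [CommSemiring R] (M : StrandModel α)

open Classical in
/-- The operator of a slice: it pulls back functions of the labels above the slice to functions of
the labels below it, by summation over all allowed labellings. -/
noncomputable def act (s : Slice) (f : List α → R) (x : List α) : R :=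
  ∑ b ∈ words α s.piece.cod,
    if M.Adm s.piece ((x.drop s.offset).take s.piece.dom) b then
      f (x.take s.offset ++ (b ++ x.drop (s.offset + s.piece.dom))) else 0

/-- The state sum of a graph, as an operator pulling back functions of the labels at the top to
functions of the labels at the bottom. -/
noncomputable def ev : List Slice → (List α → R) → List α → R
  | [], f => f
  | s :: w, f => M.act s (ev w f)

@[simp] theorem ev_nil (f : List α → R) : M.ev [] f = f := rfl

theorem ev_cons (s : Slice) (w : List Slice) (f : List α → R) :
    M.ev (s :: w) f = M.act s (M.ev w f) := rfl

theorem ev_append (u w : List Slice) (f : List α → R) :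
    M.ev (u ++ w) f = M.ev u (M.ev w f) := by
  induction u with
  | nil => rfl
  | cons s u ih => simp only [List.cons_append, ev_cons, ih]

open Classical in
theorem act_append {i : ℕ} {p : Piece} {l a r : List α} (hl : l.length = i)
    (ha : a.length = p.dom) (f : List α → R) :
    M.act ⟨i, p⟩ f (l ++ (a ++ r)) =
      ∑ b ∈ words α p.cod, if M.Adm p a b then f (l ++ (b ++ r)) else 0 := by
  simp only [act]
  subst hl
  rw [← ha]
  simp

theorem act_congr {s : Slice} {x : List α} (hx : s.offset + s.piece.dom ≤ x.length)
    {f g : List α → R}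
    (h : ∀ y, y.length = x.length - s.piece.dom + s.piece.cod → f y = g y) :
    M.act s f x = M.act s g x := by
  obtain ⟨l, a, r, rfl, hl, ha⟩ := exists_append_of_le hx
  obtain ⟨i, p⟩ := s
  rw [act_append _ hl ha, act_append _ hl ha]
  refine Finset.sum_congr rfl fun b hb => ?_
  rw [h]
  simp at *
  omega

theorem ev_congr {n : ℕ} {w : List Slice} {x : List α} (hx : IsDiagram x.length w n)
    {f g : List α → R} (h : ∀ y, y.length = n → f y = g y) : M.ev w f x = M.ev w g x := by
  induction w generalizing x with
  | nil => exact h _ hx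
  | cons s w ih =>
    rw [isDiagram_cons] at hx
    exact M.act_congr hx.1 fun y hy => ih (by rw [hy]; exact hx.2)

theorem act_cup {i : ℕ} {l r : List α} (hl : l.length = i) (f : List α → R) :
    M.act ⟨i, .cup⟩ f (l ++ r) = ∑ d, f (l ++ (d :: M.dual d :: r)) := by
  classical
  have h := M.act_append (p := .cup) (a := []) (r := r) hl rfl f
  rw [List.nil_append] at h
  rw [h, Piece.cod_cup, sum_words_snoc, sum_words_one]
  refine Finset.sum_congr rfl fun d _ => ?_
  rw [Finset.sum_eq_single (M.dual d)]
  · simp [Adm]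
  · intro e _ he
    rw [if_neg]
    simp only [Adm, not_exists]
    intro x hx
    simp at hx
    exact he (by rw [hx.2, hx.1])
  · simp

open Classical in
theorem act_cap {i : ℕ} {l r : List α} {d e : α} (hl : l.length = i) (f : List α → R) :
    M.act ⟨i, .cap⟩ f (l ++ (d :: e :: r)) = if e = M.dual d then f (l ++ r) else 0 := by
  have h := M.act_append (p := .cap) (a := [d, e]) (r := r) hl rfl f
  simp only [List.cons_append, List.nil_append, Piece.cod_cap, sum_words_zero] at h
  rw [h]
  congr 1
  simp [Adm]

open Classical in
theorem act_vertex {i a b : ℕ} {l x r : List α} (hl : l.length = i) (hx : x.length = a)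
    (f : List α → R) :
    M.act ⟨i, .vertex a b⟩ f (l ++ (x ++ r)) =
      ∑ y ∈ words α b, if M.vertex x y then f (l ++ (y ++ r)) else 0 :=
  M.act_append hl hx f

/-- State sums are invariant under the elementary isotopies. -/
theorem ev_move {n : ℕ} {w w' : List Slice} (h : Move w w') {x : List α}
    (hx : IsDiagram x.length w n) (hx' : IsDiagram x.length w' n) (f : List α → R) :
    M.ev w f x = M.ev w' f x := by
  classical
  cases h with
  | interchange i k p q =>
    simp only [isDiagram_cons, isDiagram_nil] at hx hx'
    obtain ⟨l, a, r, rfl, hl, ha⟩ := exists_append_of_le hx.1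
    obtain ⟨m, c, r, rfl, hm, hc⟩ := exists_append_of_le (x := r) (i := k) (d := q.dom)
      (by simp at hx'; omega)
    simp only [ev_cons, ev_nil]
    rw [M.act_append hl ha]
    have e1 : l ++ (a ++ (m ++ (c ++ r))) = (l ++ (a ++ m)) ++ (c ++ r) := by simp
    rw [e1, M.act_append (by simp; omega) hc]
    have e2 : ∀ b ∈ words α p.cod,
        (if M.Adm p a b then M.act ⟨i + p.cod + k, q⟩ f (l ++ (b ++ (m ++ (c ++ r)))) else 0) =
        ∑ d ∈ words α q.cod, if M.Adm p a b then if M.Adm q c d then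
          f (l ++ (b ++ (m ++ (d ++ r)))) else 0 else 0 := by
      intro b hb
      rw [mem_words] at hb
      have e : l ++ (b ++ (m ++ (c ++ r))) = (l ++ (b ++ m)) ++ (c ++ r) := by simp
      rw [e, M.act_append (by simp; omega) hc]
      split_ifs <;> simp
    rw [Finset.sum_congr rfl e2, Finset.sum_comm]
    refine Finset.sum_congr rfl fun d hd => ?_
    have e : (l ++ (a ++ m)) ++ (d ++ r) = l ++ (a ++ (m ++ (d ++ r))) := by simp
    rw [e, M.act_append hl ha]
    by_cases hq : M.Adm q c d <;> simp [hq]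
  | zigzag_left i =>
    simp only [isDiagram_cons, isDiagram_nil] at hx
    obtain ⟨l, a, r, rfl, hl, ha⟩ := exists_append_of_le (x := x) (i := i) (d := 1)
      (by simp at hx; omega)
    obtain ⟨e, rfl⟩ := List.length_eq_one_iff.1 ha
    simp only [ev_cons, ev_nil]
    rw [M.act_cup hl]
    have : ∀ d, M.act ⟨i + 1, .cap⟩ f (l ++ (d :: M.dual d :: ([e] ++ r))) =
        if e = d then f (l ++ (d :: r)) else 0 := by
      intro d
      have h := M.act_cap (i := i + 1) (l := l ++ [d]) (r := r) (d := M.dual d) (e := e)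
        (by simpa using hl) f
      rw [M.dual_dual] at h
      simpa using h
    simp only [this]
    simp
  | zigzag_right i =>
    simp only [isDiagram_cons, isDiagram_nil] at hx
    obtain ⟨l, a, r, rfl, hl, ha⟩ := exists_append_of_le (x := x) (i := i) (d := 1)
      (by simp at hx; omega)
    obtain ⟨e, rfl⟩ := List.length_eq_one_iff.1 ha
    simp only [ev_cons, ev_nil]
    have h1 := M.act_cup (i := i + 1) (l := l ++ [e]) (r := r) (by simpa using hl)
      (M.act ⟨i, .cap⟩ f)
    rw [List.append_assoc] at h1
    rw [h1]
    have : ∀ d, M.act ⟨i, .cap⟩ f (l ++ [e] ++ (d :: M.dual d :: r)) =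
        if d = M.dual e then f (l ++ (e :: r)) else 0 := by
      intro d
      have h := M.act_cap (i := i) (l := l) (r := M.dual d :: r) (d := e) (e := d) hl f
      simp only [List.append_assoc, List.cons_append, List.nil_append]
      rw [h]
      split_ifs with hd
      · rw [hd, M.dual_dual]
      · rfl
    simp only [this]
    simp
  | rotate_right i a b =>
    simp only [isDiagram_cons, isDiagram_nil] at hx
    obtain ⟨l, x, r, rfl, hl, hx⟩ := exists_append_of_le hx.1
    obtain rfl | ⟨x, e, rfl⟩ := List.eq_nil_or_concat x
    · simp at hx
    simp only [List.concat_eq_append, Piece.dom_vertex, List.length_append, List.length_cons,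
      List.length_nil, zero_add, Nat.add_right_cancel_iff] at hx ⊢
    simp only [ev_cons, ev_nil]
    rw [M.act_vertex hl (by simpa using hx), List.append_assoc, M.act_vertex hl hx, sum_words_snoc]
    refine Finset.sum_congr rfl fun y hy => ?_
    rw [mem_words] at hy
    have : ∀ d, M.act ⟨i + b, .cap⟩ f (l ++ (y ++ [d] ++ ([e] ++ r))) =
        if d = M.dual e then f (l ++ (y ++ r)) else 0 := by
      intro d
      have h := M.act_cap (i := i + b) (l := l ++ y) (r := r) (d := d) (e := e)
        (by simp; omega) f
      simp only [List.append_assoc, List.cons_append, List.nil_append] at h ⊢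
      rw [h]
      congr 1
      exact propext ⟨fun h => by rw [h, M.dual_dual], fun h => by rw [h, M.dual_dual]⟩
    simp only [this]
    rw [Finset.sum_eq_single (M.dual e)]
    · simp [M.rotate_right]
    · intro d _ hd
      simp [hd]
    · simp
  | rotate_left i a b =>
    simp only [isDiagram_cons, isDiagram_nil] at hx
    obtain ⟨l, x, r, rfl, hl, hx⟩ := exists_append_of_le hx.1
    obtain _ | ⟨e, x⟩ := x
    · simp at hx
    simp only [Piece.dom_vertex, List.length_cons, Nat.add_right_cancel_iff] at hx ⊢
    simp only [ev_cons, ev_nil]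
    have e1 : l ++ (e :: x ++ r) = (l ++ [e]) ++ (x ++ r) := by simp
    rw [M.act_vertex hl (by simpa using hx), e1, M.act_vertex (by simp; omega) hx, sum_words_cons]
    refine Finset.sum_congr rfl fun y hy => ?_
    rw [mem_words] at hy
    have : ∀ d, M.act ⟨i, .cap⟩ f (l ++ [e] ++ (d :: y ++ r)) =
        if d = M.dual e then f (l ++ (y ++ r)) else 0 := by
      intro d
      have h := M.act_cap (i := i) (l := l) (r := y ++ r) (d := e) (e := d) hl f
      simpa using h
    simp only [this]
    rw [Finset.sum_eq_single (M.dual e)]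
    · simp [M.rotate_left]
    · intro d _ hd
      simp [hd]
    · simp

theorem ev_isot {m n : ℕ} {w w' : List Slice} (h : Isot m n w w') {x : List α}
    (hx : x.length = m) (f : List α → R) : M.ev w f x = M.ev w' f x := by
  subst hx
  replace h := h.2
  induction h with
  | rel A B h =>
    obtain ⟨hA, hB, u, v, y, z, hm, rfl, rfl⟩ := h
    obtain ⟨k, hk, hv⟩ := isDiagram_append.1 hA
    obtain ⟨k', hk', hv'⟩ := isDiagram_append.1 hB
    obtain ⟨j, hj, hy⟩ := isDiagram_append.1 hk
    obtain ⟨j', hj', hz⟩ := isDiagram_append.1 hk'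
    obtain rfl := hj.unique hj'
    simp only [ev_append, List.append_assoc]
    refine M.ev_congr hj fun t ht => ?_
    subst ht
    have : IsDiagram t.length (y ++ v) n := hy.append hv
    have key : k = k' := by
      -- An elementary isotopy does not change the number of strands above it.
      cases hm <;> simp [isDiagram_cons, isDiagram_nil] at hy hz <;> omega
    subst key
    exact M.ev_move hm hy hz _
  | refl A => rfl
  | symm A B _ ih => exact ih.symm
  | trans A B C _ _ ih ih' => exact ih.trans ih'

/-- Strands at the right of a diagram do not matter. -/
theorem ev_widen {n : ℕ} {w : List Slice} {x : List α} (hx : IsDiagram x.length w n)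
    (r : List α) (f : List α → R) :
    M.ev w f (x ++ r) = M.ev w (fun y => f (y ++ r)) x := by
  induction w generalizing x with
  | nil => rfl
  | cons s w ih =>
    rw [isDiagram_cons] at hx
    obtain ⟨l, a, t, rfl, hl, ha⟩ := exists_append_of_le hx.1
    obtain ⟨i, p⟩ := s
    simp only at hl ha
    simp only [ev_cons]
    rw [M.act_append hl ha, List.append_assoc, List.append_assoc, M.act_append hl ha]
    refine Finset.sum_congr rfl fun b hb => ?_
    rw [mem_words] at hb
    have := ih (x := l ++ (b ++ t)) (by
      rw [show (l ++ (b ++ t)).length = (l ++ (a ++ t)).length - p.dom + p.cod by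
        simp only [List.length_append]; omega]
      exact hx.2)
    simp only [List.append_assoc] at this
    rw [this]

/-- Strands at the left of a diagram do not matter. -/
theorem ev_shift {n : ℕ} {w : List Slice} {x : List α} (hx : IsDiagram x.length w n)
    (l : List α) (f : List α → R) :
    M.ev (shift l.length w) f (l ++ x) = M.ev w (fun y => f (l ++ y)) x := by
  induction w generalizing x with
  | nil => rfl
  | cons s w ih =>
    rw [isDiagram_cons] at hx
    obtain ⟨k, a, t, rfl, hl, ha⟩ := exists_append_of_le hx.1
    obtain ⟨i, p⟩ := s
    simp only at hl ha
    simp only [ev_cons, shift_cons]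
    rw [M.act_append hl ha, ← List.append_assoc, M.act_append (by simp [hl]) ha]
    refine Finset.sum_congr rfl fun b hb => ?_
    rw [mem_words] at hb
    have := ih (x := k ++ (b ++ t)) (by
      rw [show (k ++ (b ++ t)).length = (k ++ (a ++ t)).length - p.dom + p.cod by
        simp only [List.length_append]; omega]
      exact hx.2)
    rw [List.append_assoc, this]

open Classical in
theorem ev_caps {l a b : List α} {c k : ℕ} (hl : l.length = c) (ha : a.length = k)
    (hb : b.length = k) (f : List α → R) :
    M.ev (caps c k) f (l ++ (a ++ b)) = if a = (b.map M.dual).reverse then f l else 0 := by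
  induction k generalizing a b with
  | zero =>
    obtain rfl := List.length_eq_zero_iff.1 ha
    obtain rfl := List.length_eq_zero_iff.1 hb
    simp [caps]
  | succ k ih =>
    obtain rfl | ⟨a, d, rfl⟩ := List.eq_nil_or_concat a
    · simp at ha
    obtain _ | ⟨e, b⟩ := b
    · simp at hb
    simp only [List.concat_eq_append, List.length_append, List.length_cons,
      List.length_nil, zero_add, Nat.add_right_cancel_iff] at ha hb ⊢
    rw [caps, ev_cons]
    have h := M.act_cap (i := c + k) (l := l ++ a) (r := b) (d := d) (e := e)
        (by simp; omega) (M.ev (caps c k) f)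
    have e1 : l ++ (a ++ [d] ++ e :: b) = l ++ a ++ (d :: e :: b) := by simp
    rw [e1, h, List.append_assoc, ih ha hb, ← ite_and]
    congr 1
    rw [List.map_cons, List.reverse_cons]
    refine propext ⟨fun h => by rw [h.1, h.2, M.dual_dual], fun h => ?_⟩
    have := List.append_inj' h rfl
    have h2 : d = M.dual e := by simpa using this.2
    exact ⟨by rw [h2, M.dual_dual], this.1⟩

open Classical in
/-- The state sum of a diagram that arises by bending half of the top endpoints down. -/
theorem ev_append_caps {n : ℕ} {w : List Slice} (hw : IsDiagram 0 w (2 * n)) {x y : List α}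
    (hx : x.length = n) (hy : y.length = n) :
    M.ev (w ++ caps n n) (delta y : List α → R) x =
      M.ev w (delta (y ++ (x.map M.dual).reverse) : List α → R) [] := by
  rw [ev_append]
  have h := M.ev_widen (x := []) hw x (M.ev (caps n n) (delta y : List α → R))
  rw [List.nil_append] at h
  rw [h]
  refine M.ev_congr (x := []) hw fun z hz => ?_
  obtain ⟨l, a, r, rfl, hl, ha⟩ := exists_append_of_le (x := z) (i := n) (d := n) (by omega)
  obtain rfl : r = [] := by
    rw [← List.length_eq_zero_iff]
    simp at hz; omega
  rw [List.append_nil, List.append_assoc, M.ev_caps hl ha hx, delta, delta, ← ite_and]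
  congr 1
  refine propext ⟨fun h => by rw [h.1, h.2], fun h => ?_⟩
  have := List.append_inj h (by omega)
  exact ⟨this.2, this.1⟩

end StrandModel

/-! ### Colourings of the strands of a graph -/

namespace StrandModel

variable {α : Type} (M : StrandModel α)

/-- The labels `x` below and `y` above a slice are allowed. -/
def Compat (s : Slice) (x y : List α) : Prop :=
  ∃ l a b r, x = l ++ (a ++ r) ∧ y = l ++ (b ++ r) ∧ l.length = s.offset ∧
    a.length = s.piece.dom ∧ b.length = s.piece.cod ∧ M.Adm s.piece a b

/-- The words `σ t` label the points on the horizontal lines of the graph `w` in an allowed way. -/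
def IsColouring (w : List Slice) (σ : ℕ → List α) : Prop :=
  ∀ t s, w[t]? = some s → M.Compat s (σ t) (σ (t + 1))

theorem isColouring_cons {s : Slice} {w : List Slice} {σ : ℕ → List α} :
    M.IsColouring (s :: w) σ ↔
      M.Compat s (σ 0) (σ 1) ∧ M.IsColouring w fun t => σ (t + 1) := by
  constructor
  · intro h
    exact ⟨h 0 s rfl, fun t s' hs => h (t + 1) s' (by simpa using hs)⟩
  · rintro ⟨h, h'⟩ (_ | t) s' hs
    · obtain rfl : s = s' := by simpa using hs
      exact h
    · exact h' t s' (by simpa using hs)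

theorem Compat.length {M : StrandModel α} {s : Slice} {x y : List α} (h : M.Compat s x y) :
    s.offset + s.piece.dom ≤ x.length ∧ y.length = x.length - s.piece.dom + s.piece.cod := by
  obtain ⟨l, a, b, r, rfl, rfl, hl, ha, hb, -⟩ := h
  simp only [List.length_append]
  omega

variable [Fintype α]

theorem act_ne_zero_iff {s : Slice} {x : List α} (hx : s.offset + s.piece.dom ≤ x.length)
    (f : List α → ℕ) : M.act s f x ≠ 0 ↔ ∃ y, M.Compat s x y ∧ f y ≠ 0 := by
  obtain ⟨l, a, r, rfl, hl, ha⟩ := exists_append_of_le hx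
  obtain ⟨i, p⟩ := s
  rw [M.act_append hl ha, Ne, Finset.sum_eq_zero_iff]
  push Not
  constructor
  · rintro ⟨b, hb, h⟩
    rw [mem_words] at hb
    split_ifs at h with hadm
    · exact ⟨_, ⟨l, a, b, r, rfl, rfl, hl, ha, hb, hadm⟩, h⟩
    · exact absurd rfl h
  · rintro ⟨y, ⟨l', a', b, r', hx', rfl, hl', ha', hb, hadm⟩, hf⟩
    have h1 := List.append_inj hx' (by omega)
    have h2 := List.append_inj h1.2 (by omega)
    obtain ⟨rfl, -⟩ := h1
    obtain ⟨rfl, rfl⟩ := h2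
    exact ⟨b, by simpa using hb, by simpa [hadm] using hf⟩

/-- A state sum does not vanish if and only if there is a suitable colouring. -/
theorem ev_ne_zero_iff {n : ℕ} {w : List Slice} {x : List α} (hx : IsDiagram x.length w n)
    (f : List α → ℕ) :
    M.ev w f x ≠ 0 ↔ ∃ σ, σ 0 = x ∧ M.IsColouring w σ ∧ f (σ w.length) ≠ 0 := by
  induction w generalizing x with
  | nil =>
    constructor
    · intro h
      exact ⟨fun _ => x, rfl, by intro t s hs; simp at hs, h⟩
    · rintro ⟨σ, rfl, -, h⟩
      exact h
  | cons s w ih =>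
    rw [isDiagram_cons] at hx
    rw [ev_cons, act_ne_zero_iff _ hx.1]
    constructor
    · rintro ⟨y, hy, h⟩
      obtain ⟨σ, h0, h1, h2⟩ := (ih (by rw [hy.length.2]; exact hx.2)).1 h
      refine ⟨fun t => Nat.casesOn t x σ, rfl, (M.isColouring_cons).2 ⟨?_, h1⟩, h2⟩
      simpa [h0] using hy
    · rintro ⟨σ, rfl, hσ, h⟩
      rw [isColouring_cons] at hσ
      exact ⟨_, hσ.1, (ih (by rw [hσ.1.length.2]; exact hx.2)).2 ⟨_, rfl, hσ.2, h⟩⟩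

end StrandModel

theorem width_zero (m : ℕ) (w : List Slice) : width m w 0 = m := by
  cases w <;> rfl

theorem width_length {m n : ℕ} {w : List Slice} (h : IsDiagram m w n) :
    width m w w.length = n := by
  induction w generalizing m with
  | nil => exact h
  | cons s w ih => exact ih (isDiagram_cons.1 h).2

theorem width_succ {m n t : ℕ} {w : List Slice} {s : Slice} (h : IsDiagram m w n)
    (hs : w[t]? = some s) :
    s.offset + s.piece.dom ≤ width m w t ∧
      width m w (t + 1) = width m w t - s.piece.dom + s.piece.cod := by
  induction w generalizing m t with
  | nil => simp at hs
  | cons s' w ih =>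
    rw [isDiagram_cons] at h
    cases t with
    | zero =>
      obtain rfl : s' = s := by simpa using hs
      exact ⟨h.1, width_zero _ w⟩
    | succ t => exact ih h.2 (by simpa using hs)

theorem width_eq_zero {m t : ℕ} {w : List Slice} (h : w.length < t) : width m w t = 0 := by
  induction w generalizing m t with
  | nil =>
    cases t with
    | zero => simp at h
    | succ t => rfl
  | cons s w ih =>
    cases t with
    | zero => simp at h
    | succ t => exact ih (by simpa using h)

/-- The colours of the points on the horizontal lines of a graph, as words. -/
def rows (m : ℕ) (w : List Slice) (χ : ℕ × ℕ → Bool) (t : ℕ) : List Bool :=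
  (List.range (width m w t)).map fun j => χ (t, j)

theorem length_rows (m : ℕ) (w : List Slice) (χ : ℕ × ℕ → Bool) (t : ℕ) :
    (rows m w χ t).length = width m w t := by simp [rows]

theorem rows_getElem? {m t j : ℕ} {w : List Slice} {χ : ℕ × ℕ → Bool} (h : j < width m w t) :
    (rows m w χ t)[j]? = some (χ (t, j)) := by
  simp [rows, h]

theorem map_range_add_add {β : Type} (f : ℕ → β) (i d r : ℕ) :
    (List.range (i + d + r)).map f = (List.range i).map f ++
      ((List.range d).map (fun j => f (i + j)) ++ (List.range r).map fun j => f (i + d + j)) := by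
  simp [List.range_add, Function.comp_def]

/-- A labelling that is constant along the strands is a colouring, if the condition at the vertices
is satisfied. -/
theorem isColouring_rows (M : StrandModel Bool) (hdual : ∀ d, M.dual d = d) {m n : ℕ}
    {w : List Slice} (hw : IsDiagram m w n) (χ : ℕ × ℕ → Bool)
    (hχ : ∀ p q, StrandStep w p q → χ p = χ q)
    (hv : ∀ t i a b, w[t]? = some ⟨i, .vertex a b⟩ →
      M.vertex ((List.range a).map fun j => χ (t, i + j))
        ((List.range b).map fun j => χ (t + 1, i + j))) :
    M.IsColouring w (rows m w χ) := by
  intro t s hs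
  obtain ⟨h1, h2⟩ := width_succ hw hs
  obtain ⟨r, hr⟩ : ∃ r, width m w t = s.offset + s.piece.dom + r := ⟨_, (by omega :
    width m w t = s.offset + s.piece.dom + (width m w t - (s.offset + s.piece.dom)))⟩
  have hr' : width m w (t + 1) = s.offset + s.piece.cod + r := by omega
  refine ⟨_, _, (List.range s.piece.cod).map (fun j => χ (t + 1, s.offset + j)), _,
    by rw [rows, hr, map_range_add_add], ?_, by simp, by simp, by simp, ?_⟩
  · rw [rows, hr', map_range_add_add]
    congr 1
    · refine List.map_congr_left fun j hj => ?_
      exact (hχ _ _ (.left t j s hs (by simpa using hj))).symm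
    · congr 1
      refine List.map_congr_left fun j hj => ?_
      exact (hχ _ _ (.right t j s hs)).symm
  · obtain ⟨i, p⟩ := s
    cases p with
    | cup =>
      refine ⟨χ (t + 1, i), ?_⟩
      have := hχ _ _ (.cup t i hs)
      simp [List.range_succ, hdual, this]
    | cap =>
      refine ⟨χ (t, i), ?_⟩
      have := hχ _ _ (.cap t i hs)
      simp [List.range_succ, hdual, this]
    | vertex a b => exact hv t i a b hs

/-- Colourings are constant along the strands. -/
theorem StrandModel.IsColouring.strandStep {α : Type} {M : StrandModel α}
    (hdual : ∀ d, M.dual d = d) {w : List Slice} {σ : ℕ → List α} (hσ : M.IsColouring w σ)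
    {p q : ℕ × ℕ} (h : StrandStep w p q) : (σ p.1)[p.2]? = (σ q.1)[q.2]? := by
  cases h with
  | left t j s hs hj =>
    obtain ⟨l, a, b, r, h1, h2, hl, ha, hb, -⟩ := hσ t s hs
    simp only [h1, h2]
    rw [List.getElem?_append_left (by omega), List.getElem?_append_left (by omega)]
  | right t j s hs =>
    obtain ⟨l, a, b, r, h1, h2, hl, ha, hb, -⟩ := hσ t s hs
    simp only [h1, h2, ← List.append_assoc]
    rw [List.getElem?_append_right (by simp; omega), List.getElem?_append_right (by simp; omega)]
    congr 1
    simp; omega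
  | cup t i hs =>
    obtain ⟨l, a, b, r, h1, h2, hl, ha, hb, d, rfl⟩ := hσ t _ hs
    simp only at hl
    subst hl
    simp [h2, hdual]
  | cap t i hs =>
    obtain ⟨l, a, b, r, h1, h2, hl, ha, hb, d, rfl⟩ := hσ t _ hs
    simp only at hl
    subst hl
    simp [h1, hdual]

/-! ### Inner edges -/

/-- The colourings of the edges by two colours. -/
def edgeModel : StrandModel Bool where
  dual d := d
  dual_dual _ := rfl
  vertex _ _ := True
  rotate_right _ _ _ := Iff.rfl
  rotate_left _ _ _ := Iff.rfl

/-- The number of edge colourings of a graph that are trivial at the boundary. -/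
noncomputable def edgeCount (m : ℕ) (w : List Slice) (n : ℕ) : ℕ :=
  edgeModel.ev w (delta (List.replicate n false)) (List.replicate m false)

theorem edgeModel_compat_zero {s : Slice} {m : ℕ} (hm : s.offset + s.piece.dom ≤ m) :
    edgeModel.Compat s (List.replicate m false)
      (List.replicate (m - s.piece.dom + s.piece.cod) false) := by
  refine ⟨List.replicate s.offset false, List.replicate s.piece.dom false,
    List.replicate s.piece.cod false, List.replicate (m - s.piece.dom - s.offset) false,
    ?_, ?_, by simp, by simp, by simp, ?_⟩
  · simp only [List.replicate_append_replicate]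
    congr 1; omega
  · simp only [List.replicate_append_replicate]
    congr 1; omega
  · obtain ⟨i, p⟩ := s
    cases p with
    | vertex a b => trivial
    | _ => exact ⟨false, rfl⟩

theorem edgeModel_act_replicate {s : Slice} {m : ℕ} (hm : s.offset + s.piece.dom ≤ m)
    (f : List Bool → ℕ) :
    ∃ S : Finset (List Bool), (∀ y, y ∈ S ↔ edgeModel.Compat s (List.replicate m false) y) ∧
      edgeModel.act s f (List.replicate m false) = ∑ y ∈ S, f y := by
  classical
  obtain ⟨l, a, r, hx, hl, ha⟩ := exists_append_of_le
    (x := List.replicate m false) (i := s.offset) (d := s.piece.dom) (by simpa using hm)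
  obtain ⟨i, p⟩ := s
  rw [hx, StrandModel.act_append _ hl ha, ← Finset.sum_filter]
  refine ⟨((words Bool p.cod).filter fun b => edgeModel.Adm p a b).image
    fun b => l ++ (b ++ r), ?_, ?_⟩
  · intro y
    simp only [Finset.mem_image, Finset.mem_filter, mem_words]
    constructor
    · rintro ⟨b, ⟨hb, hadm⟩, rfl⟩
      exact ⟨l, a, b, r, rfl, rfl, hl, ha, hb, hadm⟩
    · rintro ⟨l', a', b, r', hx', rfl, hl', ha', hb, hadm⟩
      have h1 := List.append_inj hx' (by omega)
      have h2 := List.append_inj h1.2 (by omega)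
      obtain ⟨rfl, -⟩ := h1
      obtain ⟨rfl, rfl⟩ := h2
      exact ⟨b, ⟨hb, hadm⟩, rfl⟩
  · rw [Finset.sum_image]
    intro b _ c _ h
    simpa using h

theorem edgeCount_pos {m n : ℕ} {w : List Slice} (hw : IsDiagram m w n) :
    edgeCount m w n ≠ 0 := by
  induction w generalizing m with
  | nil => cases hw; simp [edgeCount, delta]
  | cons s w ih =>
    rw [isDiagram_cons] at hw
    rw [edgeCount, StrandModel.ev_cons, StrandModel.act_ne_zero_iff _ (by simpa using hw.1)]
    exact ⟨_, edgeModel_compat_zero hw.1, ih hw.2⟩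

/-- Inner edges are detected by the edge colourings that are trivial at the boundary: the number of
such colourings is one if and only if all of them are trivial. -/
theorem edgeCount_eq_one_iff {m n : ℕ} {w : List Slice} (hw : IsDiagram m w n) :
    edgeCount m w n = 1 ↔ ∀ σ, edgeModel.IsColouring w σ → σ 0 = List.replicate m false →
      σ w.length = List.replicate n false → ∀ t ≤ w.length, ∀ c ∈ σ t, c = false := by
  induction w generalizing m with
  | nil =>
    cases hw
    simp only [edgeCount, StrandModel.ev_nil, delta_self, true_iff]
    intro σ _ h0 _ t ht c hc
    obtain rfl : t = 0 := by simpa using ht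
    rw [h0] at hc
    exact List.eq_of_mem_replicate hc
  | cons s w ih =>
    have hpos := edgeCount_pos hw
    rw [isDiagram_cons] at hw
    have hpos' := edgeCount_pos hw.2
    obtain ⟨S, hS, hsum⟩ := edgeModel_act_replicate hw.1
      (edgeModel.ev w (delta (List.replicate n false)))
    have h0 := (hS _).2 (edgeModel_compat_zero hw.1)
    -- Separate the colourings that are trivial above the first slice from the other ones.
    have hsum' : edgeCount m (s :: w) n =
      edgeCount (m - s.piece.dom + s.piece.cod) w n +
        ∑ y ∈ S.erase (List.replicate (m - s.piece.dom + s.piece.cod) false),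
          edgeModel.ev w (delta (List.replicate n false)) y := by
      rw [edgeCount, StrandModel.ev_cons, hsum, ← Finset.add_sum_erase _ _ h0]
      rfl
    have key : edgeCount m (s :: w) n = 1 ↔
        edgeCount (m - s.piece.dom + s.piece.cod) w n = 1 ∧
        ∀ y ∈ S.erase (List.replicate (m - s.piece.dom + s.piece.cod) false),
          edgeModel.ev w (delta (List.replicate n false)) y = 0 := by
      rw [← Finset.sum_eq_zero_iff, hsum']
      omega
    have hlen : ∀ {y}, edgeModel.Compat s (List.replicate m false) y →
        IsDiagram y.length w n := by
      intro y hy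
      have := hy.length.2
      rw [List.length_replicate] at this
      rw [this]
      exact hw.2
    rw [key, ih hw.2]
    constructor
    · rintro ⟨h1, h2⟩ σ hσ hσ0 hσ1 t ht c hc
      rw [StrandModel.isColouring_cons, hσ0] at hσ
      have e : σ 1 = List.replicate (m - s.piece.dom + s.piece.cod) false := by
        by_contra hne
        have := h2 _ (Finset.mem_erase.2 ⟨hne, (hS _).2 hσ.1⟩)
        refine (edgeModel.ev_ne_zero_iff (hlen hσ.1) _).2 ⟨_, rfl, hσ.2, ?_⟩ this
        have hσ1' : σ (w.length + 1) = List.replicate n false := by simpa using hσ1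
        rw [hσ1', delta_self]
        exact one_ne_zero
      cases t with
      | zero =>
        rw [hσ0] at hc
        exact List.eq_of_mem_replicate hc
      | succ t => exact h1 _ hσ.2 e (by simpa using hσ1) t (by simpa using ht) c hc
    · intro h
      refine ⟨fun σ hσ hσ0 hσ1 t ht c hc => ?_, fun y hy => ?_⟩
      · refine h (fun t => Nat.casesOn t (List.replicate m false) σ)
          ((StrandModel.isColouring_cons _).2 ⟨?_, hσ⟩) rfl hσ1 (t + 1) (by simpa using ht) c hc
        simpa [hσ0] using edgeModel_compat_zero hw.1
      · by_contra hne
        rw [Finset.mem_erase, hS] at hy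
        obtain ⟨σ, hσ0, hσ, hσ1⟩ := (edgeModel.ev_ne_zero_iff (hlen hy.2) _).1 hne
        refine hy.1 (List.eq_replicate_iff.2 ⟨?_, fun c hc => ?_⟩)
        · simpa using hy.2.length.2
        · refine h (fun t => Nat.casesOn t (List.replicate m false) σ)
            ((StrandModel.isColouring_cons _).2 ⟨?_, hσ⟩) rfl ?_ 1 (by simp) c ?_
          · simpa [hσ0] using hy.2
          · exact eq_of_delta_ne_zero hσ1
          · simpa [hσ0] using hc

/-- A graph has no inner edges if and only if its only edge colouring that is trivial at the boundary
is the trivial one. -/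
theorem noInnerEdges_iff {n : ℕ} (G : Diagram n) :
    G.NoInnerEdges ↔ edgeCount n G.slices n = 1 := by
  classical
  obtain ⟨w, hw⟩ := G
  rw [edgeCount_eq_one_iff hw]
  constructor
  · intro h σ hσ h0 h1 t ht c hc
    obtain ⟨j, hj⟩ := List.mem_iff_getElem?.1 hc
    have hlen : (σ t).length = width n w t := by
      clear hj hc h1
      induction t with
      | zero => rw [h0, width_zero, List.length_replicate]
      | succ t ih =>
        have hs : w[t]? = some w[t] := List.getElem?_eq_getElem (by omega)
        rw [(hσ t _ hs).length.2, (width_succ hw hs).2, ih (by omega)]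
    have hj' : j < width n w t := by
      rw [← hlen]
      exact (List.getElem?_eq_some_iff.1 hj).1
    have hse : ∀ {p q}, SameEdge w p q → (σ p.1)[p.2]? = (σ q.1)[q.2]? := by
      intro p q h
      induction h with
      | rel x y h => exact hσ.strandStep (fun _ => rfl) h
      | refl x => rfl
      | symm x y _ ih => exact ih.symm
      | trans x y z _ _ ih ih' => exact ih.trans ih'
    obtain ⟨k, hk, h | h⟩ := h t j hj'
    · have := hse h
      simp only [hj, h0] at this
      simpa [hk] using this
    · have := hse h
      simp only [hj, h1] at this
      simpa [hk] using this
  · intro h t j hj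
    by_contra hcon
    -- Colour the points on outer edges by `false`, and the points on inner edges by `true`.
    let χ : ℕ × ℕ → Bool := fun p => decide (¬ ∃ k < n,
      SameEdge w p (0, k) ∨ SameEdge w p (w.length, k))
    have hχ : ∀ p q, StrandStep w p q → χ p = χ q := by
      intro p q hpq
      have : ∀ r, SameEdge w p r ↔ SameEdge w q r := fun r =>
        ⟨fun h => .trans _ _ _ (.symm _ _ (.rel _ _ hpq)) h, fun h => .trans _ _ _ (.rel _ _ hpq) h⟩
      simp only [χ, this]
    have hcol := isColouring_rows edgeModel (fun _ => rfl) hw χ hχ fun _ _ _ _ _ => trivial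
    have ht : t ≤ w.length := by
      by_contra ht
      change j < width n w t at hj
      rw [width_eq_zero (by omega)] at hj
      omega
    have := h _ hcol ?_ ?_ t ht (χ (t, j)) (List.mem_iff_getElem?.2 ⟨j, rows_getElem? hj⟩)
    · simp only [χ, decide_eq_false_iff_not] at this
      exact this hcon
    · refine List.eq_replicate_iff.2 ⟨by rw [length_rows, width_zero], fun c hc => ?_⟩
      simp only [rows, List.mem_map, List.mem_range, width_zero] at hc
      obtain ⟨k, hk, rfl⟩ := hc
      simp only [χ, decide_eq_false_iff_not, not_not]
      exact ⟨k, hk, .inl (.refl _)⟩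
    · refine List.eq_replicate_iff.2 ⟨by rw [length_rows, width_length hw], fun c hc => ?_⟩
      simp only [rows, List.mem_map, List.mem_range, width_length hw] at hc
      obtain ⟨k, hk, rfl⟩ := hc
      simp only [χ, decide_eq_false_iff_not, not_not]
      exact ⟨k, hk, .inr (.refl _)⟩

/-! ### Connected components -/

/-- The colourings of the connected components by two colours. -/
def compModel : StrandModel Bool where
  dual d := d
  dual_dual _ := rfl
  vertex x y := ∃ c, ∀ d ∈ x ++ y, d = c
  rotate_right x y d := by
    refine exists_congr fun c => forall_congr' fun e => ?_
    simp only [List.mem_append, List.mem_singleton]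
    tauto
  rotate_left x y d := by
    refine exists_congr fun c => forall_congr' fun e => ?_
    simp only [List.mem_append, List.mem_cons]
    tauto

theorem compModel_sameComponent {w : List Slice} {σ : ℕ → List Bool}
    (hσ : compModel.IsColouring w σ) {p q : ℕ × ℕ} (h : sameComponent w p q) :
    (σ p.1)[p.2]? = (σ q.1)[q.2]? := by
  have hleg : ∀ t p q, IsLeg w t p → IsLeg w t q → (σ p.1)[p.2]? = (σ q.1)[q.2]? := by
    intro t p q hp hq
    have : ∀ i a b, w[t]? = some ⟨i, .vertex a b⟩ → ∃ c, ∀ p, IsLeg w t p →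
        (σ p.1)[p.2]? = some c := by
      intro i a b hs
      obtain ⟨l, x, y, r, h1, h2, hl, hx, hy, c, hc⟩ := hσ t _ hs
      simp only [Piece.dom_vertex, Piece.cod_vertex] at hl hx hy
      refine ⟨c, fun p hp => ?_⟩
      cases hp with
      | lower i' a' b' j hs' hj =>
        rw [hs] at hs'
        simp only [Option.some.injEq, Slice.mk.injEq, Piece.vertex.injEq] at hs'
        obtain ⟨rfl, rfl, rfl⟩ := hs'
        simp only [h1]
        rw [List.getElem?_append_right (by omega), List.getElem?_append_left (by omega)]
        rw [show i + j - l.length = j by omega, List.getElem?_eq_getElem (by omega)]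
        rw [hc _ (List.mem_append_left _ (List.getElem_mem _))]
      | upper i' a' b' j hs' hj =>
        rw [hs] at hs'
        simp only [Option.some.injEq, Slice.mk.injEq, Piece.vertex.injEq] at hs'
        obtain ⟨rfl, rfl, rfl⟩ := hs'
        simp only [h2]
        rw [List.getElem?_append_right (by omega), List.getElem?_append_left (by omega)]
        rw [show i + j - l.length = j by omega, List.getElem?_eq_getElem (by omega)]
        rw [hc _ (List.mem_append_right _ (List.getElem_mem _))]
    obtain ⟨i, a, b, hs⟩ : ∃ i a b, w[t]? = some ⟨i, .vertex a b⟩ := by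
      cases hp with
      | lower i a b j hs hj => exact ⟨i, a, b, hs⟩
      | upper i a b j hs hj => exact ⟨i, a, b, hs⟩
    obtain ⟨c, hc⟩ := this i a b hs
    rw [hc p hp, hc q hq]
  change Relation.EqvGen _ p q at h
  induction h with
  | rel x y h =>
    rcases h with h | ⟨t, h, h'⟩
    · exact hσ.strandStep (fun _ => rfl) h
    · exact hleg t _ _ h h'
  | refl x => rfl
  | symm x y _ ih => exact ih.symm
  | trans x y z _ _ ih ih' => exact ih.trans ih'

theorem exists_isColouring_compModel {m n : ℕ} {w : List Slice} (hw : IsDiagram m w n)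
    (p : ℕ × ℕ) : ∃ χ : ℕ × ℕ → Bool, compModel.IsColouring w (rows m w χ) ∧
      ∀ q, χ q = true ↔ sameComponent w p q := by
  classical
  let χ : ℕ × ℕ → Bool := fun q => decide (sameComponent w p q)
  have key : ∀ q r, sameComponent w q r → χ q = χ r := by
    intro q r h
    have : sameComponent w p q ↔ sameComponent w p r :=
      ⟨fun h' => (sameComponent w).trans h' h,
        fun h' => (sameComponent w).trans h' ((sameComponent w).symm h)⟩
    simp only [χ, this]
  refine ⟨χ, isColouring_rows compModel (fun _ => rfl) hw χ
    (fun q r h => key q r (.rel _ _ (.inl h))) ?_, fun q => by simp [χ]⟩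
  intro t i a b hs
  have hleg : ∀ d ∈ ((List.range a).map fun j => χ (t, i + j)) ++
      ((List.range b).map fun j => χ (t + 1, i + j)), ∃ q, IsLeg w t q ∧ d = χ q := by
    intro d hd
    simp only [List.mem_append, List.mem_map, List.mem_range] at hd
    rcases hd with ⟨j, hj, rfl⟩ | ⟨j, hj, rfl⟩
    · exact ⟨_, .lower i a b j hs hj, rfl⟩
    · exact ⟨_, .upper i a b j hs hj, rfl⟩
  by_cases he : ∃ q, IsLeg w t q
  · obtain ⟨q, hq⟩ := he
    refine ⟨χ q, fun d hd => ?_⟩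
    obtain ⟨r, hr, rfl⟩ := hleg d hd
    exact key _ _ (.rel _ _ (.inr ⟨t, hr, hq⟩))
  · refine ⟨false, fun d hd => ?_⟩
    obtain ⟨r, hr, -⟩ := hleg d hd
    exact absurd ⟨r, hr⟩ he

/-- The labels of the boundary points, read from the top left corner of the rectangle
clockwise. -/
theorem getElem?_boundaryPoint {n : ℕ} (G : Diagram n) {σ : ℕ → List Bool}
    (h0 : (σ 0).length = n) (h1 : (σ G.slices.length).length = n) (p : Fin (2 * n)) :
    (σ G.slices.length ++ (σ 0).reverse)[2 * n - 1 - (p : ℕ)]? =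
      (σ (G.boundaryPoint p).1)[(G.boundaryPoint p).2]? := by
  have hp := p.2
  rw [Diagram.boundaryPoint]
  split_ifs with h
  · rw [List.getElem?_append_right (by omega), List.getElem?_reverse (by omega)]
    congr 1
    omega
  · rw [List.getElem?_append_left (by omega)]

/-- The induced partition is determined by the state sums: two boundary points lie in the same
component if and only if all colourings of the components agree there. -/
theorem boundaryPartition_iff {n : ℕ} (G : Diagram n) (p q : Fin (2 * n)) :
    G.boundaryPartition p q ↔ ∀ x y : List Bool, x.length = n → y.length = n →
      compModel.ev G.slices (delta y : List Bool → ℕ) x ≠ 0 →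
        (y ++ x.reverse)[2 * n - 1 - (p : ℕ)]? = (y ++ x.reverse)[2 * n - 1 - (q : ℕ)]? := by
  constructor
  · intro h x y hx hy hne
    rw [StrandModel.ev_ne_zero_iff _ (by rw [hx]; exact G.isDiagram)] at hne
    obtain ⟨σ, rfl, hσ, h1⟩ := hne
    obtain rfl : σ G.slices.length = y := eq_of_delta_ne_zero h1
    rw [getElem?_boundaryPoint G hx hy, getElem?_boundaryPoint G hx hy]
    exact compModel_sameComponent hσ h
  · intro h
    obtain ⟨χ, hχ, hχ'⟩ := exists_isColouring_compModel G.isDiagram (G.boundaryPoint p)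
    have h0 : (rows n G.slices χ 0).length = n := by rw [length_rows, width_zero]
    have h1 : (rows n G.slices χ G.slices.length).length = n := by
      rw [length_rows, width_length G.isDiagram]
    have := h _ _ h0 h1 ((StrandModel.ev_ne_zero_iff _ (by rw [h0]; exact G.isDiagram) _).2
      ⟨_, rfl, hχ, by rw [delta_self]; exact one_ne_zero⟩)
    rw [getElem?_boundaryPoint G h0 h1, getElem?_boundaryPoint G h0 h1] at this
    have hw : ∀ p, (G.boundaryPoint p).2 < width n G.slices (G.boundaryPoint p).1 := by
      intro p
      have hp := p.2
      rw [Diagram.boundaryPoint]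
      split_ifs with h
      · rwa [width_zero]
      · rw [width_length G.isDiagram]
        simp only
        omega
    rw [rows_getElem? (hw p), rows_getElem? (hw q), Option.some.injEq] at this
    exact (hχ' _).1 (by rw [← this]; exact (hχ' _).2 ((sameComponent G.slices).refl _))

/-- The induced partition is an isotopy invariant. -/
theorem boundaryPartition_eq_of_mk_eq {n : ℕ} {G H : Diagram n}
    (h : Graph.mk G = Graph.mk H) : G.boundaryPartition = H.boundaryPartition := by
  have h := isot_of_isotopy (Quotient.exact h)
  ext p q
  rw [boundaryPartition_iff, boundaryPartition_iff]
  refine forall_congr' fun x => forall_congr' fun y => forall_congr' fun hx => ?_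
  rw [compModel.ev_isot h hx]

/-! ### Star words -/

/-- A forest as the list of its components, the last inserted one first: the component `(j, k)` is
a star with `k` legs (an arc if `k = 2`) inserted to the right of `j` strands. -/
abbrev StarWord : Type := List (ℕ × ℕ)

/-- The slice that inserts a component. -/
def starSlice (x : ℕ × ℕ) : Slice := ⟨x.1, if x.2 = 2 then .cup else .vertex 0 x.2⟩

namespace StarWord

/-- The diagram given by a star word. -/
def toSlices : StarWord → List Slice
  | [] => []
  | x :: w => toSlices w ++ [starSlice x]

/-- `Valid w N`: the star word `w` describes a forest with `N` boundary points. -/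
def Valid : StarWord → ℕ → Prop
  | [], N => N = 0
  | x :: w, N => 2 ≤ x.2 ∧ x.1 + x.2 ≤ N ∧ Valid w (N - x.2)

end StarWord

open StarWord

/-- The position of a boundary point before the insertion of the component `x`. -/
def skip (x : ℕ × ℕ) (p : ℕ) : ℕ := if p < x.1 then p else p - x.2

/-- The position of a boundary point after the insertion of the component `x`. -/
def unskip (x : ℕ × ℕ) (p : ℕ) : ℕ := if p < x.1 then p else p + x.2

/-- The boundary point `p` belongs to the component `x` when this is inserted. -/
def InWindow (x : ℕ × ℕ) (p : ℕ) : Prop := x.1 ≤ p ∧ p < x.1 + x.2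

theorem skip_unskip (x : ℕ × ℕ) (p : ℕ) : skip x (unskip x p) = p := by
  unfold skip unskip; split_ifs <;> omega

theorem unskip_skip {x : ℕ × ℕ} {p : ℕ} (h : ¬ InWindow x p) : unskip x (skip x p) = p := by
  unfold skip unskip InWindow at *; split_ifs <;> omega

theorem not_inWindow_unskip (x : ℕ × ℕ) (p : ℕ) : ¬ InWindow x (unskip x p) := by
  unfold unskip InWindow; split_ifs <;> omega

theorem unskip_lt_unskip (x : ℕ × ℕ) {p q : ℕ} (h : p < q) : unskip x p < unskip x q := by
  unfold unskip; split_ifs <;> omega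

theorem skip_lt_skip {x : ℕ × ℕ} {p q : ℕ} (hp : ¬ InWindow x p) (hq : ¬ InWindow x q)
    (h : p < q) : skip x p < skip x q := by
  unfold skip InWindow at *; split_ifs <;> omega

theorem unskip_lt {x : ℕ × ℕ} {N p : ℕ} (hx : x.1 + x.2 ≤ N) (h : p < N - x.2) :
    unskip x p < N := by
  unfold unskip; split_ifs <;> omega

theorem skip_lt {x : ℕ × ℕ} {N p : ℕ} (hx : x.1 + x.2 ≤ N) (hp : ¬ InWindow x p) (h : p < N) :
    skip x p < N - x.2 := by
  unfold skip InWindow at *; split_ifs <;> omega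

namespace StarWord

/-- Two boundary points belong to the same component of the forest.  Numbers that are too large to
be boundary points are only related to themselves. -/
def Conn : StarWord → ℕ → ℕ → Prop
  | [], p, q => p = q
  | x :: w, p, q => (InWindow x p ∧ InWindow x q) ∨
      (¬ InWindow x p ∧ ¬ InWindow x q ∧ Conn w (skip x p) (skip x q))

theorem conn_refl (w : StarWord) (p : ℕ) : Conn w p p := by
  induction w generalizing p with
  | nil => rfl
  | cons x w ih =>
    by_cases h : InWindow x p
    · exact .inl ⟨h, h⟩
    · exact .inr ⟨h, h, ih _⟩

theorem Conn.symm {w : StarWord} {p q : ℕ} (h : Conn w p q) : Conn w q p := by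
  induction w generalizing p q with
  | nil => exact Eq.symm h
  | cons x w ih =>
    rcases h with ⟨h, h'⟩ | ⟨h, h', h''⟩
    · exact .inl ⟨h', h⟩
    · exact .inr ⟨h', h, ih h''⟩

theorem Conn.trans {w : StarWord} {p q r : ℕ} (h : Conn w p q) (h' : Conn w q r) :
    Conn w p r := by
  induction w generalizing p q r with
  | nil => exact Eq.trans h h'
  | cons x w ih =>
    rcases h with ⟨h1, h2⟩ | ⟨h1, h2, h3⟩ <;> rcases h' with ⟨h1', h2'⟩ | ⟨h1', h2', h3'⟩
    · exact .inl ⟨h1, h2'⟩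
    · exact absurd h2 h1'
    · exact absurd h1' h2
    · exact .inr ⟨h1, h2', ih h3 h3'⟩

theorem conn_cons_unskip {x : ℕ × ℕ} {w : StarWord} {p q : ℕ} :
    Conn (x :: w) (unskip x p) (unskip x q) ↔ Conn w p q := by
  simp [Conn, not_inWindow_unskip, skip_unskip]

/-- The components of a forest do not cross. -/
theorem Conn.planar {w : StarWord} {a b c d : ℕ} (hab : a < b) (hbc : b < c) (hcd : c < d)
    (hac : Conn w a c) (hbd : Conn w b d) : Conn w a b := by
  induction w generalizing a b c d with
  | nil =>
    have : a = c := hac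
    omega
  | cons x w ih =>
    rcases hac with ⟨h1, h2⟩ | ⟨h1, h2, h3⟩
    · exact .inl ⟨h1, h1.1.trans hab.le, hbc.trans h2.2⟩
    rcases hbd with ⟨h1', h2'⟩ | ⟨h1', h2', h3'⟩
    · exact absurd ⟨h1'.1.trans hbc.le, hcd.trans h2'.2⟩ h2
    exact .inr ⟨h1, h1', ih (skip_lt_skip h1 h1' hab) (skip_lt_skip h1' h2 hbc)
      (skip_lt_skip h2 h2' hcd) h3 h3'⟩

theorem Valid.exists_conn_ne {w : StarWord} {N p : ℕ} (hw : Valid w N) (hp : p < N) :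
    ∃ q < N, q ≠ p ∧ Conn w p q := by
  induction w generalizing N p with
  | nil => cases hw; omega
  | cons x w ih =>
    obtain ⟨h1, h2, h3⟩ := hw
    by_cases h : InWindow x p
    · by_cases hp' : p = x.1
      · refine ⟨p + 1, by omega, by omega, .inl ⟨h, ?_⟩⟩
        unfold InWindow; omega
      · refine ⟨x.1, by omega, by omega, .inl ⟨h, ?_⟩⟩
        unfold InWindow; omega
    · obtain ⟨q, hq, hne, hc⟩ := ih h3 (skip_lt h2 h hp)
      refine ⟨unskip x q, unskip_lt h2 hq, ?_, ?_⟩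
      · intro he
        rw [← he, skip_unskip] at hne
        exact hne rfl
      · rwa [← conn_cons_unskip (x := x), unskip_skip h] at hc

theorem Valid.conn_eq {w : StarWord} {N p q : ℕ} (hw : Valid w N) (h : Conn w p q)
    (hp : N ≤ p) : p = q := by
  induction w generalizing N p q with
  | nil => exact h
  | cons x w ih =>
    obtain ⟨h1, h2, h3⟩ := hw
    rcases h with ⟨h4, -⟩ | ⟨h4, h5, h6⟩
    · unfold InWindow at h4; omega
    · have := ih h3 h6 (by unfold skip; split_ifs <;> omega)
      rw [← unskip_skip h4, this, unskip_skip h5]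

end StarWord

theorem cod_starSlice (x : ℕ × ℕ) : (starSlice x).piece.cod = x.2 := by
  rw [starSlice]
  split_ifs with h
  · exact h.symm
  · rfl

theorem dom_starSlice (x : ℕ × ℕ) : (starSlice x).piece.dom = 0 := by
  rw [starSlice]
  split_ifs with h <;> rfl

namespace StarWord

theorem Valid.isDiagram {w : StarWord} {N : ℕ} (hw : Valid w N) :
    IsDiagram 0 (toSlices w) N := by
  induction w generalizing N with
  | nil => exact Eq.symm hw
  | cons x w ih =>
    obtain ⟨h1, h2, h3⟩ := hw
    refine isDiagram_snoc.2 ⟨_, ih h3, ?_, ?_⟩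
    · rw [dom_starSlice]
      change x.1 + 0 ≤ _
      omega
    · rw [dom_starSlice, cod_starSlice]
      omega

theorem Valid.isForest {w : StarWord} {N : ℕ} (hw : Valid w N) : IsForest (toSlices w) := by
  induction w generalizing N with
  | nil => simp [IsForest, toSlices]
  | cons x w ih =>
    obtain ⟨h1, h2, h3⟩ := hw
    refine (ih h3).append (isForest_singleton.2 ?_)
    rw [Slice.IsStar, starSlice]
    split_ifs with h
    · exact .inl rfl
    · exact .inr ⟨x.2, by omega, rfl⟩

end StarWord

theorem IsForest.exists_starWord {F : List Slice} (hF : IsForest F) {N : ℕ}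
    (hd : IsDiagram 0 F N) : ∃ w, Valid w N ∧ toSlices w = F := by
  induction F using List.reverseRecOn generalizing N with
  | nil => exact ⟨[], Eq.symm hd, rfl⟩
  | append_singleton F s ih =>
    obtain ⟨M, h1, h2, h3⟩ := isDiagram_snoc.1 hd
    obtain ⟨w, hw, rfl⟩ := ih hF.of_append_left h1
    obtain ⟨j, p⟩ := s
    rcases hF.last with h | ⟨k, hk, h⟩ <;> simp only at h <;> subst h
    · refine ⟨(j, 2) :: w, ⟨le_rfl, ?_, ?_⟩, ?_⟩
      · simp at h2 h3 ⊢; omega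
      · simp only [Piece.dom_cup, Piece.cod_cup] at h3
        rwa [show N - 2 = M by omega]
      · simp [toSlices, starSlice]
    · refine ⟨(j, k) :: w, ⟨by simp; omega, ?_, ?_⟩, ?_⟩
      · simp at h2 h3 ⊢; omega
      · simp only [Piece.dom_vertex, Piece.cod_vertex] at h3
        rwa [show N - k = M by omega]
      · simp [toSlices, starSlice, show k ≠ 2 by omega]

namespace StarWord

/-! ### A forest is determined by its partition of the boundary points -/

/-- Components over disjoint intervals may be inserted in both orders. -/
theorem isot_swap {w : StarWord} {N j k j' k' : ℕ}
    (hw : Valid ((j', k') :: (j, k) :: w) N) (h : j + k ≤ j') :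
    Isot 0 N (toSlices ((j', k') :: (j, k) :: w)) (toSlices ((j, k) :: (j' - k, k') :: w)) := by
  obtain ⟨h1, h2, h3, h4, h5⟩ := hw
  simp only at h1 h2 h3 h4 h5
  have h := isot_swap_right (N := N) (p := (starSlice (j', k')).piece) (q := (starSlice (j, k)).piece)
    (i := j') (j := j)
    h5.isDiagram (dom_starSlice _) (by rw [cod_starSlice]; exact h)
    (by rw [dom_starSlice, cod_starSlice]; simp only; omega)
    (by rw [dom_starSlice, cod_starSlice, cod_starSlice]; simp only; omega)
  rw [cod_starSlice] at h
  exact h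

theorem conn_swap (w : StarWord) {j k j' k' : ℕ} (h : j + k ≤ j') (p q : ℕ) :
    Conn ((j', k') :: (j, k) :: w) p q ↔ Conn ((j, k) :: (j' - k, k') :: w) p q := by
  have h1 : ∀ p, ¬ InWindow (j', k') p → (InWindow (j, k) (skip (j', k') p) ↔ InWindow (j, k) p) := by
    intro p hp
    unfold skip InWindow at *
    simp only at *
    split_ifs <;> omega
  have h2 : ∀ p, ¬ InWindow (j, k) p →
      (InWindow (j' - k, k') (skip (j, k) p) ↔ InWindow (j', k') p) := by
    intro p hp
    unfold skip InWindow at *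
    simp only at *
    split_ifs <;> omega
  have h3 : ∀ p, InWindow (j', k') p → ¬ InWindow (j, k) p := by
    intro p hp
    unfold InWindow at *
    simp only at *
    omega
  have h4 : ∀ p, ¬ InWindow (j', k') p → ¬ InWindow (j, k) p →
      skip (j, k) (skip (j', k') p) = skip (j' - k, k') (skip (j, k) p) := by
    intro p hp hp'
    unfold skip InWindow at *
    simp only at *
    split_ifs <;> omega
  simp only [Conn]
  by_cases hp : InWindow (j', k') p <;> by_cases hq : InWindow (j', k') q <;>
    by_cases hp' : InWindow (j, k) p <;> by_cases hq' : InWindow (j, k) q <;>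
      simp_all

/-- A component of a forest that contains all the boundary points of an interval, and no other
ones, may be inserted last. -/
theorem exists_isot_cons {w : StarWord} {N j k : ℕ} (hw : Valid w N) (hk : 2 ≤ k)
    (hj : j + k ≤ N) (hc : ∀ p q, InWindow (j, k) p → (Conn w p q ↔ InWindow (j, k) q)) :
    ∃ w', Valid ((j, k) :: w') N ∧ Isot 0 N (toSlices w) (toSlices ((j, k) :: w')) ∧
      ∀ p q, Conn w p q ↔ Conn ((j, k) :: w') p q := by
  induction w generalizing N j with
  | nil => cases hw; omega
  | cons x w ih =>
    obtain ⟨j', k'⟩ := x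
    have hw' := hw
    obtain ⟨h1, h2, h3⟩ := hw
    simp only at h1 h2 h3
    by_cases hi : ∃ p, InWindow (j, k) p ∧ InWindow (j', k') p
    · -- The last component is the one in question.
      obtain ⟨p, hp, hp'⟩ := hi
      have hiff : ∀ q, InWindow (j, k) q ↔ InWindow (j', k') q := by
        intro q
        rw [← hc p q hp]
        simp [Conn, hp']
      have e1 := hiff j
      have e2 := hiff j'
      have e3 := hiff (j + k - 1)
      have e4 := hiff (j' + k' - 1)
      unfold InWindow at e1 e2 e3 e4
      simp only at e1 e2 e3 e4
      obtain ⟨rfl, rfl⟩ : j = j' ∧ k = k' := by omega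
      exact ⟨w, hw', .refl hw'.isDiagram, fun _ _ => Iff.rfl⟩
    · push Not at hi
      have hdisj : j + k ≤ j' ∨ j' + k' ≤ j := by
        by_contra hcon
        have := hi (max j j')
        unfold InWindow at this
        simp only at this
        omega
      have hc' : ∀ j₂, (∀ p, InWindow (j₂, k) p ↔ InWindow (j, k) (unskip (j', k') p)) →
          ∀ p q, InWindow (j₂, k) p → (Conn w p q ↔ InWindow (j₂, k) q) := by
        intro j₂ hj₂ p q hp
        rw [← conn_cons_unskip (x := (j', k')), hc _ _ ((hj₂ p).1 hp), hj₂]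
      have hd : ∀ {s}, IsDiagram 0 (toSlices s) (N - k') →
          IsDiagram (N - k') [starSlice (j', k')] N := by
        intro s hs
        rw [isDiagram_singleton, dom_starSlice, cod_starSlice]
        change j' + 0 ≤ _ ∧ _ - 0 + k' = N
        omega
      rcases hdisj with hlt | hlt
      · obtain ⟨w', hv, his, hco⟩ := ih h3 (j := j) (by omega) (hc' j fun p => by
          unfold unskip InWindow; simp only; split_ifs <;> omega)
        have hv' : Valid ((j', k') :: (j, k) :: w') N := ⟨h1, h2, hv⟩
        refine ⟨(j' - k, k') :: w', ⟨hk, hj, h1, ?_, ?_⟩,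
          (his.append_right (hd hv.isDiagram)).trans (isot_swap hv' hlt), fun p q => ?_⟩
        · simp only; omega
        · have := hv.2.2
          simp only at this ⊢
          rwa [Nat.sub_right_comm]
        · rw [← conn_swap w' hlt]
          simp only [Conn] at hco ⊢
          simp only [hco]
      · obtain ⟨w', hv, his, hco⟩ := ih h3 (j := j - k') (by omega) (hc' (j - k') fun p => by
          unfold unskip InWindow; simp only; split_ifs <;> omega)
        have hv' : Valid ((j, k) :: (j', k') :: w') N := by
          refine ⟨hk, hj, h1, by simp only; omega, ?_⟩
          have := hv.2.2
          simp only at this ⊢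
          rwa [Nat.sub_right_comm]
        refine ⟨(j', k') :: w', hv',
          (his.append_right (hd hv.isDiagram)).trans (isot_swap hv' hlt).symm, fun p q => ?_⟩
        rw [conn_swap w' hlt]
        simp only [Conn] at hco ⊢
        simp only [hco]

/-- Forests that induce the same partition of the boundary points are isotopic. -/
theorem isot_of_conn {w w' : StarWord} {N : ℕ} (hw : Valid w N) (hw' : Valid w' N)
    (h : ∀ p < N, ∀ q < N, (Conn w p q ↔ Conn w' p q)) :
    Isot 0 N (toSlices w) (toSlices w') := by
  replace h : ∀ p q, Conn w p q ↔ Conn w' p q := by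
    intro p q
    by_cases hp : p < N
    · by_cases hq : q < N
      · exact h p hp q hq
      · constructor
        · intro hc
          have := hw.conn_eq hc.symm (by omega)
          omega
        · intro hc
          have := hw'.conn_eq hc.symm (by omega)
          omega
    · constructor
      · intro hc
        rw [hw.conn_eq hc (by omega)]
        exact conn_refl _ _
      · intro hc
        rw [hw'.conn_eq hc (by omega)]
        exact conn_refl _ _
  induction w generalizing w' N with
  | nil =>
    cases hw
    cases w' with
    | nil => exact .refl rfl
    | cons x w' =>
      obtain ⟨h1, h2, -⟩ := hw'
      omega
  | cons x w ih =>
    obtain ⟨j, k⟩ := x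
    obtain ⟨h1, h2, h3⟩ := hw
    simp only at h1 h2 h3
    obtain ⟨u, hu, his, hco⟩ := exists_isot_cons hw' h1 h2 fun p q hp => by
      rw [← h]
      simp [Conn, hp]
    refine Isot.trans ?_ his.symm
    refine Isot.append_right (k := N - k) (ih h3 hu.2.2 fun p q => ?_) ?_
    · rw [← conn_cons_unskip (x := (j, k)), h, hco, conn_cons_unskip]
    · rw [isDiagram_singleton, dom_starSlice, cod_starSlice]
      change j + 0 ≤ _ ∧ _ - 0 + k = N
      omega

/-! ### Every planar partition without singletons comes from a forest -/

/-- A planar partition of `N` points without singletons has a block that is an interval: the block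
of the first point which is the last one of its block. -/
theorem exists_interval_block {N : ℕ} (hN : 0 < N) (r : Setoid ℕ)
    (hlt : ∀ p q, r p q → p < N → q < N)
    (hpl : ∀ a b c d, a < b → b < c → c < d → d < N → r a c → r b d → r a b)
    (hsing : ∀ p < N, ∃ q, q ≠ p ∧ r p q) :
    ∃ x : ℕ × ℕ, 2 ≤ x.2 ∧ x.1 + x.2 ≤ N ∧
      ∀ p q, InWindow x p → (r p q ↔ InWindow x q) := by
  classical
  let IsMax : ℕ → Prop := fun q => q < N ∧ ∀ y, q < y → ¬ r q y
  have hmax : ∀ d x, x < N → N - x = d → ∃ y, x ≤ y ∧ IsMax y ∧ r x y := by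
    intro d
    induction d using Nat.strong_induction_on with
    | _ d ih =>
      intro x hx hd
      by_cases h : ∃ y, x < y ∧ r x y
      · obtain ⟨y, hy, hr⟩ := h
        have hyN := hlt _ _ hr hx
        obtain ⟨z, hz, hz', hrz⟩ := ih (N - y) (by omega) y hyN rfl
        exact ⟨z, by omega, hz', r.trans hr hrz⟩
      · push Not at h
        exact ⟨x, le_rfl, ⟨hx, h⟩, r.refl x⟩
  have hex : ∃ q, IsMax q := by
    obtain ⟨y, -, hy, -⟩ := hmax _ 0 hN rfl
    exact ⟨y, hy⟩
  obtain ⟨hqN, hqmax⟩ := Nat.find_spec hex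
  have hqmin : ∀ y, IsMax y → Nat.find hex ≤ y := fun y hy => Nat.find_min' hex hy
  generalize Nat.find hex = q at hqN hqmax hqmin
  have hexj : ∃ p, r p q := ⟨q, r.refl q⟩
  have hjq := Nat.find_spec hexj
  have hjmin : ∀ y, r y q → Nat.find hexj ≤ y := fun y hy => Nat.find_min' hexj hy
  generalize Nat.find hexj = j at hjq hjmin
  have hblock : ∀ x, r x q ↔ j ≤ x ∧ x ≤ q := by
    intro x
    constructor
    · intro h
      refine ⟨hjmin x h, ?_⟩
      by_contra hcon
      exact hqmax x (by omega) (r.symm h)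
    · rintro ⟨h1, h2⟩
      by_contra hcon
      have hxj : j ≠ x := fun he => hcon (he ▸ hjq)
      have hxq : x ≠ q := fun he => hcon (he ▸ r.refl x)
      obtain ⟨y, -, hy, hry⟩ := hmax _ x (by omega) rfl
      have hyq : q ≠ y := fun he => hcon (he ▸ hry)
      have := hqmin y hy
      exact hcon (r.trans (r.symm (hpl j x q y (by omega) (by omega) (by omega) hy.1 hjq hry)) hjq)
  obtain ⟨p, hp, hrp⟩ := hsing q hqN
  have := (hblock p).1 (r.symm hrp)
  refine ⟨(j, q - j + 1), by simp only; omega, by simp only; omega, fun x y hx => ?_⟩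
  have hx' : r x q := (hblock x).2 (by unfold InWindow at hx; simp only at hx; omega)
  have : r x y ↔ r y q := ⟨fun h => r.trans (r.symm h) hx', fun h => r.trans hx' (r.symm h)⟩
  rw [this, hblock]
  unfold InWindow
  simp only
  omega

theorem exists_conn_iff (N : ℕ) (r : Setoid ℕ) (hlt : ∀ p q, r p q → p < N → q < N)
    (hpl : ∀ a b c d, a < b → b < c → c < d → d < N → r a c → r b d → r a b)
    (hsing : ∀ p < N, ∃ q, q ≠ p ∧ r p q) :
    ∃ w, Valid w N ∧ ∀ p < N, ∀ q < N, (Conn w p q ↔ r p q) := by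
  induction N using Nat.strong_induction_on generalizing r with
  | _ N ih =>
    rcases Nat.eq_zero_or_pos N with rfl | hN
    · exact ⟨[], rfl, by simp⟩
    obtain ⟨x, hx2, hxN, hx⟩ := exists_interval_block hN r hlt hpl hsing
    obtain ⟨w, hw, hc⟩ := ih (N - x.2) (by omega) (r.comap (unskip x))
      (by
        intro p q hpq hp
        have h1 := hlt _ _ hpq (unskip_lt hxN hp)
        have := skip_lt hxN (not_inWindow_unskip x q) h1
        rwa [skip_unskip] at this)
      (fun a b c d hab hbc hcd hd h h' => hpl _ _ _ _ (unskip_lt_unskip x hab)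
        (unskip_lt_unskip x hbc) (unskip_lt_unskip x hcd) (unskip_lt hxN hd) h h')
      (by
        intro p hp
        obtain ⟨q, hq, hr⟩ := hsing _ (unskip_lt hxN hp)
        have hqw : ¬ InWindow x q := fun h =>
          not_inWindow_unskip x p ((hx q _ h).1 (r.symm hr))
        refine ⟨skip x q, ?_, ?_⟩
        · rintro rfl
          rw [unskip_skip hqw] at hq
          exact hq rfl
        · change r _ _
          rwa [unskip_skip hqw])
    refine ⟨x :: w, ⟨hx2, hxN, hw⟩, fun p hp q hq => ?_⟩
    by_cases hpw : InWindow x p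
    · rw [hx p q hpw]
      simp [Conn, hpw]
    by_cases hqw : InWindow x q
    · have : r p q ↔ r q p := ⟨fun h => r.symm h, fun h => r.symm h⟩
      rw [this, hx q p hqw]
      simp [Conn, hpw, hqw]
    have := hc _ (skip_lt hxN hpw hp) _ (skip_lt hxN hqw hq)
    simp only [Conn, hpw, hqw, this, Setoid.comap_rel, unskip_skip hpw, unskip_skip hqw]
    simp

/-! ### State sums of forests -/

theorem ev_zero {α : Type} [Fintype α] {R : Type} [CommSemiring R] (M : StrandModel α)
    (w : List Slice) (x : List α) : M.ev w (fun _ => (0 : R)) x = 0 := by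
  induction w generalizing x with
  | nil => rfl
  | cons s w ih => simp [StrandModel.ev_cons, StrandModel.act, ih]

open Classical in
/-- The state sum of a forest factorizes: the last component imposes a condition on its own legs
only. -/
theorem ev_snoc_star {α : Type} [Fintype α] {R : Type} [CommSemiring R] (M : StrandModel α)
    {u : List Slice} {K : ℕ} (hu : IsDiagram 0 u K) {s : Slice} (hs : s.piece.dom = 0)
    {l b r : List α} (hl : l.length = s.offset) (hb : b.length = s.piece.cod)
    (hK : l.length + r.length = K) :
    M.ev (u ++ [s]) (delta (l ++ (b ++ r)) : List α → R) [] =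
      if M.Adm s.piece [] b then M.ev u (delta (l ++ r) : List α → R) [] else 0 := by
  have key : ∀ y : List α, y.length = K →
      M.act s (delta (l ++ (b ++ r)) : List α → R) y =
        if M.Adm s.piece [] b then delta (l ++ r) y else 0 := by
    intro y hy
    obtain ⟨i, p⟩ := s
    simp only at hs hl hb ⊢
    obtain ⟨l', a, r', rfl, hl', ha⟩ := exists_append_of_le (x := y) (i := i) (d := 0) (by omega)
    rw [M.act_append hl' (by omega)]
    simp only [delta]
    obtain rfl := List.length_eq_zero_iff.1 ha
    have : ∀ c ∈ words α p.cod, (if M.Adm p [] c then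
        if l' ++ (c ++ r') = l ++ (b ++ r) then (1 : R) else 0 else 0) =
        if c = b then if M.Adm p [] b then if l' ++ ([] ++ r') = l ++ r then (1 : R) else 0
          else 0 else 0 := by
      intro c hc
      rw [mem_words] at hc
      have hiff : l' ++ (c ++ r') = l ++ (b ++ r) ↔ c = b ∧ l' ++ ([] ++ r') = l ++ r := by
        constructor
        · intro h
          have h1 := List.append_inj h (by omega)
          have h2 := List.append_inj h1.2 (by omega)
          exact ⟨h2.1, by rw [h1.1, h2.2]; rfl⟩
        · rintro ⟨rfl, h⟩
          have h1 := List.append_inj h (by omega)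
          rw [List.nil_append] at h1
          rw [h1.1, h1.2]
      by_cases hcb : c = b
      · subst hcb
        simp [hiff]
      · simp [hiff, hcb]
    rw [Finset.sum_congr rfl this, Finset.sum_ite_eq', if_pos (by simpa using hb)]
  rw [StrandModel.ev_append, StrandModel.ev_cons, StrandModel.ev_nil, M.ev_congr (x := []) hu key]
  split_ifs with h
  · rfl
  · exact ev_zero M u []

theorem getElem?_window {α : Type} {l b r : List α} {x : ℕ × ℕ} (hl : l.length = x.1)
    (hb : b.length = x.2) {p : ℕ} (hp : InWindow x p) :
    (l ++ (b ++ r))[p]? = b[p - x.1]? := by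
  unfold InWindow at hp
  rw [List.getElem?_append_right (by omega), List.getElem?_append_left (by omega), hl]

theorem getElem?_skip {α : Type} {l b r : List α} {x : ℕ × ℕ} (hl : l.length = x.1)
    (hb : b.length = x.2) {p : ℕ} (hp : ¬ InWindow x p) :
    (l ++ (b ++ r))[p]? = (l ++ r)[skip x p]? := by
  unfold skip InWindow at *
  split_ifs with h
  · rw [List.getElem?_append_left (by omega), List.getElem?_append_left (by omega)]
  · rw [List.getElem?_append_right (by omega), List.getElem?_append_right (by omega),
      List.getElem?_append_right (by omega)]
    congr 1
    omega

theorem compModel_adm_starSlice {x : ℕ × ℕ} {b : List Bool} (hb : b.length = x.2) :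
    compModel.Adm (starSlice x).piece [] b ↔ ∃ c, ∀ d ∈ b, d = c := by
  simp only [starSlice]
  split_ifs with h
  · obtain ⟨d, e, rfl⟩ := List.length_eq_two.1 (hb.trans h)
    simp only [StrandModel.Adm, compModel]
    constructor
    · rintro ⟨c, hc⟩
      exact ⟨c, by simp_all⟩
    · rintro ⟨c, hc⟩
      exact ⟨c, by simp_all⟩
  · simp [StrandModel.Adm, compModel]

theorem compModel_ev_cons {x : ℕ × ℕ} {w : StarWord} {K : ℕ} (hw : Valid w K)
    {l b r : List Bool} (hl : l.length = x.1) (hb : b.length = x.2) (hK : (l ++ r).length = K) :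
    compModel.ev (toSlices (x :: w)) (delta (l ++ (b ++ r)) : List Bool → ℕ) [] ≠ 0 ↔
      (∃ c, ∀ d ∈ b, d = c) ∧
        compModel.ev (toSlices w) (delta (l ++ r) : List Bool → ℕ) [] ≠ 0 := by
  classical
  have hev := ev_snoc_star (R := ℕ) compModel hw.isDiagram (dom_starSlice x)
    (b := b) (r := r) hl (by rw [cod_starSlice, hb]) (by simpa using hK)
  simp only [toSlices]
  rw [hev, ite_ne_right_iff, compModel_adm_starSlice hb]

/-- The admissible colourings of the components of a forest are the functions that are constant on
the blocks of the partition. -/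
theorem compModel_ev_toSlices {w : StarWord} {N : ℕ} (hw : Valid w N) {z : List Bool}
    (hz : z.length = N) :
    compModel.ev (toSlices w) (delta z : List Bool → ℕ) [] ≠ 0 ↔
      ∀ p q, Conn w p q → z[p]? = z[q]? := by
  induction w generalizing N z with
  | nil =>
    cases hw
    obtain rfl := List.length_eq_zero_iff.1 hz
    simp [toSlices, delta]
  | cons x w ih =>
    obtain ⟨h1, h2, h3⟩ := hw
    obtain ⟨l, b, r, rfl, hl, hb⟩ := exists_append_of_le (x := z) (i := x.1) (d := x.2) (by omega)
    have hlr : (l ++ r).length = N - x.2 := by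
      simp only [List.length_append] at hz ⊢
      omega
    rw [compModel_ev_cons h3 hl hb hlr, ih h3 hlr]
    constructor
    · rintro ⟨⟨c, hc⟩, hco⟩ p q (⟨hp, hq⟩ | ⟨hp, hq, hpq⟩)
      · have : ∀ p, InWindow x p → (l ++ (b ++ r))[p]? = some c := by
          intro p hp
          rw [getElem?_window hl hb hp]
          unfold InWindow at hp
          rw [List.getElem?_eq_getElem (by omega), hc _ (List.getElem_mem _)]
        rw [this p hp, this q hq]
      · rw [getElem?_skip hl hb hp, getElem?_skip hl hb hq, hco _ _ hpq]
    · intro h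
      constructor
      · refine ⟨b[0], fun d hd => ?_⟩
        obtain ⟨i, hi, rfl⟩ := List.mem_iff_getElem.1 hd
        have hwin : ∀ i < b.length, InWindow x (x.1 + i) := by
          intro i hi
          unfold InWindow; omega
        have := h (x.1 + i) (x.1 + 0) (.inl ⟨hwin i hi, hwin 0 (by omega)⟩)
        rw [getElem?_window hl hb (hwin i hi), getElem?_window hl hb (hwin 0 (by omega))] at this
        simpa [hi, show 0 < b.length by omega] using this
      · intro p q hpq
        have := h _ _ (conn_cons_unskip (x := x).2 hpq)
        rwa [getElem?_skip hl hb (not_inWindow_unskip _ _),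
          getElem?_skip hl hb (not_inWindow_unskip _ _), skip_unskip, skip_unskip] at this

/-- The components of a forest are separated by its admissible colourings. -/
theorem conn_of_forall_colouring {w : StarWord} {N p q : ℕ} (hw : Valid w N) (hp : p < N)
    (hq : q < N) (h : ∀ z : List Bool, z.length = N →
      compModel.ev (toSlices w) (delta z : List Bool → ℕ) [] ≠ 0 → z[p]? = z[q]?) :
    Conn w p q := by
  classical
  -- Colour the block of `p` by one colour, and all other blocks by the other colour.
  let χ : ℕ → Bool := fun r => decide (Conn w p r)
  have hχ : ∀ r s, Conn w r s → χ r = χ s := by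
    intro r s hrs
    have : Conn w p r ↔ Conn w p s := ⟨fun h => h.trans hrs, fun h => h.trans hrs.symm⟩
    simp only [χ, this]
  let z : List Bool := (List.range N).map χ
  have hz : ∀ r, z[r]? = if r < N then some (χ r) else none := by
    intro r
    simp only [z]
    split_ifs with h
    · simp [h]
    · simp; omega
  have hlen : z.length = N := by simp [z]
  have hconst : ∀ r s, Conn w r s → z[r]? = z[s]? := by
    intro r s hrs
    by_cases hr : r < N
    · have hs : s < N := by
        by_contra hs
        have := hw.conn_eq hrs.symm (by omega)
        omega
      rw [hz, hz, if_pos hr, if_pos hs, hχ r s hrs]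
    · rw [hw.conn_eq hrs (by omega)]
  have := h z hlen ((compModel_ev_toSlices hw hlen).2 hconst)
  rw [hz, hz, if_pos hp, if_pos hq] at this
  simpa [χ, conn_refl] using this

theorem edgeCount_toSlices {w : StarWord} {N : ℕ} (hw : Valid w N) :
    edgeCount 0 (toSlices w) N = 1 := by
  induction w generalizing N with
  | nil => cases hw; simp [edgeCount, toSlices, delta]
  | cons x w ih =>
    obtain ⟨h1, h2, h3⟩ := hw
    have hev := ev_snoc_star (R := ℕ) edgeModel h3.isDiagram (dom_starSlice x)
      (l := List.replicate x.1 false) (b := List.replicate x.2 false)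
      (r := List.replicate (N - x.2 - x.1) false) (by simp [starSlice])
      (by rw [cod_starSlice]; simp) (by simp; omega)
    have hadm : edgeModel.Adm (starSlice x).piece [] (List.replicate x.2 false) := by
      simp only [starSlice]
      split_ifs with h
      · rw [h]
        exact ⟨false, rfl⟩
      · trivial
    rw [if_pos hadm] at hev
    simp only [List.replicate_append_replicate] at hev
    rw [show x.1 + (x.2 + (N - x.2 - x.1)) = N by omega,
      show x.1 + (N - x.2 - x.1) = N - x.2 by omega] at hev
    rw [edgeCount, toSlices]
    exact hev.trans (ih h3)

end StarWord

/-! ### Graphs without inner edges are forests -/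

theorem ev_mono {α : Type} [Fintype α] (M : StrandModel α) (w : List Slice) {f g : List α → ℕ}
    (h : ∀ x, f x ≤ g x) (x : List α) : M.ev w f x ≤ M.ev w g x := by
  induction w generalizing x with
  | nil => exact h x
  | cons s w ih =>
    rw [StrandModel.ev_cons, StrandModel.ev_cons]
    refine Finset.sum_le_sum fun b _ => ?_
    split_ifs
    · exact ih _
    · exact le_rfl

theorem ev_mul_left {α : Type} [Fintype α] {R : Type} [CommSemiring R] (M : StrandModel α)
    (w : List Slice) (c : R) (f : List α → R) (x : List α) :
    M.ev w (fun z => c * f z) x = c * M.ev w f x := by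
  induction w generalizing x with
  | nil => rfl
  | cons s w ih =>
    rw [StrandModel.ev_cons, StrandModel.ev_cons, StrandModel.act, StrandModel.act,
      Finset.mul_sum]
    refine Finset.sum_congr rfl fun b _ => ?_
    rw [ih, mul_ite, mul_zero]

/-- Colourings of the two parts of a graph that are trivial at the cut fit together. -/
theorem edgeCount_mul_le (m k n : ℕ) (u v : List Slice) :
    edgeCount k v n * edgeCount m u k ≤ edgeCount m (u ++ v) n := by
  rw [edgeCount, edgeCount, ← ev_mul_left, edgeCount, StrandModel.ev_append]
  refine ev_mono _ _ (fun z => ?_) _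
  by_cases hz : z = List.replicate k false
  · rw [hz, delta_self, mul_one]
  · rw [delta, if_neg hz, mul_zero]
    exact Nat.zero_le _

/-- An inner edge has a nontrivial colouring that is trivial at the boundary: the edge itself is
coloured by `true`, and everything else by `false`. -/
theorem InnerEdge.edgeCount_ne_one {x : List Slice} (hx : InnerEdge x) {m n : ℕ}
    (hd : IsDiagram m x n) : edgeCount m x n ≠ 1 := by
  rw [Ne, edgeCount_eq_one_iff hd]
  intro h
  cases hx with
  | loop j p q =>
    simp only [isDiagram_cons, isDiagram_nil, Piece.dom_vertex, Piece.cod_vertex, Piece.dom_cap,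
      Piece.cod_cap] at hd
    obtain ⟨hj, -, rfl⟩ := hd
    have := h (fun t => match t with
      | 0 => List.replicate m false
      | 1 => List.replicate j false ++ ((List.replicate p false ++ [true, true] ++
          List.replicate q false) ++ List.replicate (m - j) false)
      | _ => List.replicate (m - 0 + (p + 2 + q) - 2 + 0) false) ?_ rfl rfl 1 (by simp) true
      (by simp)
    · simp at this
    · rw [StrandModel.isColouring_cons, StrandModel.isColouring_cons]
      refine ⟨⟨List.replicate j false, [], _, _, ?_, rfl, by simp, rfl, by simp; omega, trivial⟩,
        ⟨List.replicate (j + p) false, [true, true], [], List.replicate (q + (m - j)) false,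
          ?_, ?_, by simp, rfl, rfl, true, rfl⟩, ?_⟩
      · simp only [List.nil_append, List.replicate_append_replicate]
        congr 1; omega
      · simp only [List.append_assoc, List.replicate_add]
      · simp only [List.nil_append, List.replicate_append_replicate]
        congr 1; omega
      · intro t s hs
        simp at hs
  | closed j =>
    simp only [isDiagram_cons, isDiagram_nil, Piece.dom_cup, Piece.cod_cup, Piece.dom_cap,
      Piece.cod_cap] at hd
    obtain ⟨hj, -, rfl⟩ := hd
    have := h (fun t => match t with
      | 0 => List.replicate m false
      | 1 => List.replicate j false ++ ([true, true] ++ List.replicate (m - j) false)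
      | _ => List.replicate (m - 0 + 2 - 2 + 0) false) ?_ rfl rfl 1 (by simp) true
      (by simp)
    · simp at this
    · rw [StrandModel.isColouring_cons, StrandModel.isColouring_cons]
      refine ⟨⟨List.replicate j false, [], [true, true], _, ?_, rfl, by simp, rfl, by simp,
        true, rfl⟩,
        ⟨List.replicate j false, [true, true], [], List.replicate (m - j) false,
          rfl, ?_, by simp, rfl, rfl, true, rfl⟩, ?_⟩
      · simp only [List.nil_append, List.replicate_append_replicate]
        congr 1; omega
      · simp only [List.nil_append, List.replicate_append_replicate]
        congr 1; omega
      · intro t s hs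
        simp at hs
  | edge j p q l =>
    simp only [isDiagram_cons, isDiagram_nil, Piece.dom_vertex, Piece.cod_vertex] at hd
    obtain ⟨hj, -, rfl⟩ := hd
    have := h (fun t => match t with
      | 0 => List.replicate m false
      | 1 => List.replicate j false ++ ((List.replicate p false ++ [true] ++
          List.replicate q false) ++ List.replicate (m - j) false)
      | _ => List.replicate (m - 0 + (p + 1 + q) - 1 + l) false) ?_ rfl rfl 1 (by simp) true
      (by simp)
    · simp at this
    · rw [StrandModel.isColouring_cons, StrandModel.isColouring_cons]
      refine ⟨⟨List.replicate j false, [], _, _, ?_, rfl, by simp, rfl, by simp; omega, trivial⟩,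
        ⟨List.replicate (j + p) false, [true], List.replicate l false,
          List.replicate (q + (m - j)) false,
          ?_, ?_, by simp, rfl, by simp, trivial⟩, ?_⟩
      · simp only [List.nil_append, List.replicate_append_replicate]
        congr 1; omega
      · simp only [List.append_assoc, List.replicate_add]
      · simp only [List.replicate_append_replicate]
        congr 1; omega
      · intro t s hs
        simp at hs

/-- A graph without inner edges, all of whose vertices have valence at least three, is a forest. -/
theorem exists_isForest {E : List Slice} (hE : IsSimple (3 ≤ ·) E) {N : ℕ}
    (hd : IsDiagram 0 E N) (h1 : edgeCount 0 E N = 1) : ∃ F, Isot 0 N E F ∧ IsForest F := by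
  induction E using List.reverseRecOn generalizing N with
  | nil => exact ⟨[], .refl hd, by simp [IsForest]⟩
  | append_singleton E s ih =>
    obtain ⟨K, hK, hs, hN⟩ := isDiagram_snoc.1 hd
    have hsd : IsDiagram K [s] N := isDiagram_singleton.2 ⟨hs, hN⟩
    have hle := edgeCount_mul_le 0 K N E [s]
    have hpos := edgeCount_pos hsd
    have hpos' := edgeCount_pos hK
    obtain ⟨F, hF, hFf⟩ := ih (fun t ht => hE t (by simp [ht])) hK (by
      rw [h1] at hle
      nlinarith [Nat.pos_of_ne_zero hpos, Nat.pos_of_ne_zero hpos'])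
    have his := hF.append_right hsd
    rcases hE s (by simp) with hp | hp | ⟨k, hk, hp⟩
    · exact ⟨_, his, hFf.append (isForest_singleton.2 (.inl hp))⟩
    · obtain ⟨i, p⟩ := s
      simp only at hp
      subst hp
      simp only [Piece.dom_cap, Piece.cod_cap] at hs hN
      have hres := resolves_cap hFf hF.right hs
      rw [show K - 2 = N by omega] at hres
      rcases hres with ⟨F', h, h'⟩ | ⟨F₁, x, F₂, h, -, hx, -⟩
      · exact ⟨F', his.trans h, h'⟩
      · -- An inner edge would give a nontrivial colouring.
        exfalso
        have hiso := his.trans h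
        have e : edgeCount 0 (F₁ ++ x ++ F₂) N = 1 := by
          rw [← h1]
          exact (edgeModel.ev_isot hiso (by simp) _).symm
        obtain ⟨b, hb, hb'⟩ := isDiagram_append.1 h.right
        obtain ⟨a, ha, ha'⟩ := isDiagram_append.1 hb
        have l1 := edgeCount_mul_le 0 b N (F₁ ++ x) F₂
        have l2 := edgeCount_mul_le 0 a b F₁ x
        have p1 := edgeCount_pos ha
        have p2 := edgeCount_pos ha'
        have p3 := edgeCount_pos hb'
        have p4 := hx.edgeCount_ne_one ha'
        have l3 : 2 * 1 ≤ edgeCount a x b * edgeCount 0 F₁ a :=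
          Nat.mul_le_mul (by omega) (by omega)
        have l4 : 1 * 2 ≤ edgeCount b F₂ N * edgeCount 0 (F₁ ++ x) b :=
          Nat.mul_le_mul (by omega) (by omega)
        omega
    · exact ⟨_, his, hFf.append (isForest_singleton.2 (.inr ⟨k, hk, hp⟩))⟩

theorem edgeCount_append_caps {n : ℕ} {E : List Slice} (hE : IsDiagram 0 E (2 * n)) :
    edgeCount n (E ++ caps n n) n = edgeCount 0 E (2 * n) := by
  have h := edgeModel.ev_append_caps (R := ℕ) hE (x := List.replicate n false)
    (y := List.replicate n false) (by simp) (by simp)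
  rw [edgeCount, h, edgeCount]
  congr 2
  rw [show edgeModel.dual = id from rfl, List.map_id, List.reverse_replicate,
    List.replicate_append_replicate, two_mul]

theorem isDiagram_append_caps {n : ℕ} {E : List Slice} (hE : IsDiagram 0 E (2 * n)) :
    IsDiagram n (E ++ caps n n) n := by
  have h := (hE.widen n).append (isDiagram_caps (c := n) (k := n) (by omega))
  rwa [zero_add, show 2 * n + n - 2 * n = n by omega] at h

theorem isot_append_caps {n : ℕ} {E E' : List Slice} (h : Isot 0 (2 * n) E E') :
    Isot n n (E ++ caps n n) (E' ++ caps n n) := by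
  have h1 := (h.widen n).append_right (isDiagram_caps (c := n) (k := n) (by omega))
  rwa [zero_add, show 2 * n + n - 2 * n = n by omega] at h1

theorem isDiagram_cups_append {n : ℕ} {w : List Slice} (hw : IsDiagram n w n) :
    IsDiagram 0 (cups n ++ w) (2 * n) := by
  refine (isDiagram_cups 0 n).append ?_
  have := hw.widen n
  rwa [← two_mul] at this

/-- The graph given by a forest with `2 * n` boundary points at the top: the last `n` of them are
bent down. -/
def StarWord.diagram {n : ℕ} {w : StarWord} (hw : Valid w (2 * n)) : Diagram n :=
  ⟨toSlices w ++ caps n n, isDiagram_append_caps hw.isDiagram⟩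

theorem vertex_notMem_caps {c k : ℕ} {s : Slice} (h : s ∈ caps c k) : s.piece = .cap := by
  induction k with
  | zero => simp [caps] at h
  | succ k ih =>
    rw [caps, List.mem_cons] at h
    rcases h with rfl | h
    · rfl
    · exact ih h

theorem StarWord.isBasic_diagram {n : ℕ} {w : StarWord} (hw : Valid w (2 * n)) :
    (diagram hw).IsBasic := by
  constructor
  · rw [noInnerEdges_iff]
    exact (edgeCount_append_caps hw.isDiagram).trans (edgeCount_toSlices hw)
  · intro i a b h
    rcases List.mem_append.1 h with h | h
    · rcases hw.isForest _ h with h | ⟨k, hk, h⟩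
      · cases h
      · cases h
        omega
    · cases vertex_notMem_caps h

/-- A graph without inner edges, all of whose vertices have valence at least three, is given by a
star word. -/
theorem exists_starWord_of_slices {n : ℕ} {w : List Slice} (hw : IsDiagram n w n)
    (h1 : edgeCount n w n = 1) (hv : ∀ i a b, (⟨i, .vertex a b⟩ : Slice) ∈ w → 3 ≤ a + b) :
    ∃ (s : StarWord) (hs : Valid s (2 * n)), Graph.mk ⟨w, hw⟩ = Graph.mk (diagram hs) := by
  have hd := isDiagram_cups_append hw
  have hbend := isot_bend hw
  obtain ⟨E, hE, hsimple⟩ := exists_isSimple (3 ≤ ·) hd fun i a b h => by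
    rcases List.mem_append.1 h with h | h
    · simp [cups] at h
    · exact hv i a b h
  have e : edgeCount 0 E (2 * n) = 1 := by
    rw [← edgeCount_append_caps hE.right, ← h1]
    refine (edgeModel.ev_isot (hbend.trans (isot_append_caps hE)) (by simp) _).symm
  obtain ⟨F, hF, hFf⟩ := exists_isForest hsimple hE.right e
  obtain ⟨s, hs, rfl⟩ := hFf.exists_starWord hF.right
  exact ⟨s, hs, ((hbend.trans (isot_append_caps hE)).trans (isot_append_caps hF)).mk_eq⟩

theorem Diagram.IsBasic.exists_starWord {n : ℕ} {G : Diagram n} (hG : G.IsBasic) :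
    ∃ (s : StarWord) (hs : Valid s (2 * n)), Graph.mk G = Graph.mk (diagram hs) :=
  exists_starWord_of_slices G.isDiagram ((noInnerEdges_iff G).1 hG.1) hG.2

/-! ### The bijection with planar partitions -/

theorem Fin.rev_val_lt {n : ℕ} (p : Fin (2 * n)) : 2 * n - 1 - (p : ℕ) < 2 * n := by
  have := p.2
  omega

theorem StarWord.boundaryPartition_diagram {n : ℕ} {w : StarWord} (hw : Valid w (2 * n))
    (p q : Fin (2 * n)) : (diagram hw).boundaryPartition p q ↔
      Conn w (2 * n - 1 - (p : ℕ)) (2 * n - 1 - (q : ℕ)) := by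
  have key : ∀ x y : List Bool, x.length = n → y.length = n →
      compModel.ev (diagram hw).slices (delta y : List Bool → ℕ) x =
        compModel.ev (toSlices w) (delta (y ++ x.reverse) : List Bool → ℕ) [] := by
    intro x y hx hy
    have h := compModel.ev_append_caps (R := ℕ) hw.isDiagram hx hy
    rwa [show compModel.dual = id from rfl, List.map_id] at h
  rw [boundaryPartition_iff]
  constructor
  · intro h
    refine conn_of_forall_colouring hw (Fin.rev_val_lt p) (Fin.rev_val_lt q) fun z hz hne => ?_
    have := h (z.drop n).reverse (z.take n) (by simp; omega) (by simp; omega)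
    rw [key _ _ (by simp; omega) (by simp; omega)] at this
    simpa using this (by simpa using hne)
  · intro h x y hx hy hne
    rw [key x y hx hy, compModel_ev_toSlices hw (by simp; omega)] at hne
    exact hne _ _ h

/-- The isotopy class of graphs given by a star word. -/
def StarWord.basicGraph {n : ℕ} {w : StarWord} (hw : Valid w (2 * n)) : BasicGraph n :=
  ⟨Graph.mk (diagram hw), diagram hw, isBasic_diagram hw, rfl⟩

theorem BasicGraph.exists_starWord {n : ℕ} (g : BasicGraph n) :
    ∃ (s : StarWord) (hs : Valid s (2 * n)), g = basicGraph hs := by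
  obtain ⟨g, G, hG, rfl⟩ := g
  obtain ⟨s, hs, h⟩ := hG.exists_starWord
  exact ⟨s, hs, Subtype.ext h⟩

theorem StarWord.isPlanar_diagram {n : ℕ} {w : StarWord} (hw : Valid w (2 * n)) :
    IsPlanar (diagram hw).boundaryPartition := by
  intro a b c d hab hbc hcd hac hbd
  rw [boundaryPartition_diagram] at *
  have hd := d.2
  simp only [Fin.lt_def] at hab hbc hcd
  have := Conn.planar (by omega) (by omega) (by omega) hbd.symm hac.symm
  exact (hac.trans this.symm).trans hbd.symm

theorem StarWord.exists_ne_diagram {n : ℕ} {w : StarWord} (hw : Valid w (2 * n))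
    (p : Fin (2 * n)) : ∃ q, q ≠ p ∧ (diagram hw).boundaryPartition p q := by
  obtain ⟨q, hq, hne, hc⟩ := hw.exists_conn_ne (Fin.rev_val_lt p)
  have hp := p.2
  refine ⟨⟨2 * n - 1 - q, by omega⟩, ?_, ?_⟩
  · intro h
    have := congrArg Fin.val h
    simp only at this
    omega
  · rw [boundaryPartition_diagram]
    simp only
    rwa [show 2 * n - 1 - (2 * n - 1 - q) = q by omega]

theorem Diagram.IsBasic.boundaryPartition_mem {n : ℕ} {G : Diagram n} (hG : G.IsBasic) :
    IsPlanar G.boundaryPartition ∧ ∀ p, ∃ q, q ≠ p ∧ G.boundaryPartition p q := by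
  obtain ⟨s, hs, h⟩ := hG.exists_starWord
  rw [boundaryPartition_eq_of_mk_eq h]
  exact ⟨isPlanar_diagram hs, exists_ne_diagram hs⟩

/-- The partition of the boundary points induced by a basic graph. -/
noncomputable def BasicGraph.partition {n : ℕ} (g : BasicGraph n) : PlanarPartition n :=
  ⟨(Classical.choose g.2).boundaryPartition,
    (Classical.choose_spec g.2).1.boundaryPartition_mem⟩

theorem BasicGraph.partition_mk {n : ℕ} (G : Diagram n) (hG : G.IsBasic) :
    (BasicGraph.partition ⟨Graph.mk G, G, hG, rfl⟩).1 = G.boundaryPartition :=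
  boundaryPartition_eq_of_mk_eq
    (Classical.choose_spec (⟨G, hG, rfl⟩ : ∃ H : Diagram n, H.IsBasic ∧ Graph.mk H = Graph.mk G)).2

theorem StarWord.partition_basicGraph {n : ℕ} {w : StarWord} (hw : Valid w (2 * n)) :
    (basicGraph hw).partition.1 = (diagram hw).boundaryPartition :=
  BasicGraph.partition_mk (diagram hw) (isBasic_diagram hw)

theorem BasicGraph.partition_injective (n : ℕ) :
    Function.Injective (BasicGraph.partition (n := n)) := by
  intro g g' h
  obtain ⟨s, hs, rfl⟩ := g.exists_starWord
  obtain ⟨s', hs', rfl⟩ := g'.exists_starWord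
  have h := congrArg Subtype.val h
  rw [partition_basicGraph, partition_basicGraph] at h
  refine Subtype.ext (isot_append_caps (isot_of_conn hs hs' fun p hp q hq => ?_)).mk_eq
  have h1 := boundaryPartition_diagram hs ⟨2 * n - 1 - p, by omega⟩ ⟨2 * n - 1 - q, by omega⟩
  have h2 := boundaryPartition_diagram hs' ⟨2 * n - 1 - p, by omega⟩ ⟨2 * n - 1 - q, by omega⟩
  simp only [show 2 * n - 1 - (2 * n - 1 - p) = p by omega,
    show 2 * n - 1 - (2 * n - 1 - q) = q by omega] at h1 h2
  rw [← h1, ← h2, h]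

theorem BasicGraph.partition_surjective (n : ℕ) :
    Function.Surjective (BasicGraph.partition (n := n)) := by
  rintro ⟨π, hpl, hsing⟩
  let f : ℕ → Quotient π ⊕ ℕ := fun p =>
    if h : p < 2 * n then .inl (Quotient.mk π ⟨2 * n - 1 - p, by omega⟩) else .inr p
  have hf : ∀ p (hp : p < 2 * n) q (hq : q < 2 * n), Setoid.ker f p q ↔
      π ⟨2 * n - 1 - p, by omega⟩ ⟨2 * n - 1 - q, by omega⟩ := by
    intro p hp q hq
    rw [Setoid.ker_def]
    simp only [f, hp, hq, dite_true, Sum.inl.injEq]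
    exact Quotient.eq
  have hlt : ∀ p q, Setoid.ker f p q → p < 2 * n → q < 2 * n := by
    intro p q h hp
    by_contra hq
    rw [Setoid.ker_def] at h
    simp [f, hp, hq] at h
  obtain ⟨w, hw, hc⟩ := exists_conn_iff (2 * n) (Setoid.ker f) hlt
    (by
      intro a b c d hab hbc hcd hd hac hbd
      rw [hf _ (by omega) _ (by omega)] at *
      have := hpl ⟨2 * n - 1 - d, by omega⟩ ⟨2 * n - 1 - c, by omega⟩ ⟨2 * n - 1 - b, by omega⟩
        ⟨2 * n - 1 - a, by omega⟩ (by simp [Fin.lt_def]; omega) (by simp [Fin.lt_def]; omega)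
        (by simp [Fin.lt_def]; omega) (π.symm hbd) (π.symm hac)
      exact π.trans hac (π.trans (π.symm this) (π.symm hbd)))
    (by
      intro p hp
      obtain ⟨q, hq, hr⟩ := hsing ⟨2 * n - 1 - p, by omega⟩
      have hq2 := q.2
      refine ⟨2 * n - 1 - q, ?_, ?_⟩
      · rintro rfl
        exact hq (Fin.ext (by simp only; omega))
      · rw [hf p hp _ (by omega)]
        convert hr using 1
        exact Fin.ext (by simp only; omega))
  refine ⟨basicGraph hw, Subtype.ext ?_⟩
  rw [partition_basicGraph]
  ext p q
  rw [boundaryPartition_diagram, hc _ (Fin.rev_val_lt p) _ (Fin.rev_val_lt q),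
    hf _ (Fin.rev_val_lt p) _ (Fin.rev_val_lt q)]
  have hp := p.2
  have hq := q.2
  simp only [show 2 * n - 1 - (2 * n - 1 - (p : ℕ)) = p by omega,
    show 2 * n - 1 - (2 * n - 1 - (q : ℕ)) = q by omega]

/-- Basic graphs correspond to planar partitions of the boundary points without singletons. -/
noncomputable def basicGraphEquiv (n : ℕ) : BasicGraph n ≃ PlanarPartition n :=
  .ofBijective BasicGraph.partition
    ⟨BasicGraph.partition_injective n, BasicGraph.partition_surjective n⟩

open Polynomial

/-! ### The span of the forests -/

theorem isDiagram_append_iff {m k n : ℕ} {u v : List Slice} (hu : IsDiagram m u k) :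
    IsDiagram m (u ++ v) n ↔ IsDiagram k v n := by
  rw [isDiagram_append]
  constructor
  · rintro ⟨k', h, h'⟩
    rwa [hu.unique h]
  · exact fun h => ⟨k, hu, h⟩

section algebra

variable {n : ℕ}

open Classical in
variable (n) in
/-- The element of the chromatic algebra given by a list of slices (zero if this is not a graph with
the right numbers of endpoints). -/
noncomputable def cl (w : List Slice) : ChromaticAlgebra n :=
  if h : IsDiagram n w n then classOf (Graph.mk ⟨w, h⟩) else 0

theorem cl_of_isDiagram {w : List Slice} (h : IsDiagram n w n) :
    cl n w = classOf (Graph.mk ⟨w, h⟩) := dif_pos h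

theorem cl_slices (G : Diagram n) :
    cl n G.slices = RingQuot.mkAlgHom ℂ[X] (Rel n) (gen G) := cl_of_isDiagram G.isDiagram

theorem cl_isot {w w' : List Slice} (h : Isot n n w w') : cl n w = cl n w' := by
  rw [cl_of_isDiagram h.left, cl_of_isDiagram h.right, h.mk_eq]

variable (n) in
/-- The lower part `u` of a graph, as a function of the upper part.  An identity of such functions
may be used inside of every graph, and the functions form a module over `ℂ[Q]`. -/
noncomputable def lowerPart (u v : List Slice) : ChromaticAlgebra n := cl n (u ++ v)

theorem lowerPart_isot {k : ℕ} {u u' : List Slice} (h : Isot n k u u') :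
    lowerPart n u = lowerPart n u' := by
  funext v
  by_cases hv : IsDiagram k v n
  · exact cl_isot (h.append_right hv)
  · rw [lowerPart, cl, dif_neg (by rwa [isDiagram_append_iff h.left]), lowerPart, cl,
      dif_neg (by rwa [isDiagram_append_iff h.right])]

theorem lowerPart_eq_zero {k : ℕ} {u v : List Slice} (h : IsDiagram n u k)
    (hv : ¬ IsDiagram k v n) : lowerPart n u v = 0 := by
  rw [lowerPart, cl, dif_neg (by rwa [isDiagram_append_iff h])]

theorem mkAlgHom_eq {x y : FreeAlg n} (h : Rel n x y) :
    RingQuot.mkAlgHom ℂ[X] (Rel n) x = RingQuot.mkAlgHom ℂ[X] (Rel n) y :=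
  RingQuot.mkAlgHom_rel _ h

theorem lowerPart_contract_delete {m i a b : ℕ} {u : List Slice} (hu : IsDiagram n u m)
    (hi : i + a ≤ m) :
    lowerPart n (u ++ [⟨i, .vertex a 1⟩, ⟨i, .vertex 1 b⟩]) +
        lowerPart n (u ++ [⟨i, .vertex a 0⟩, ⟨i, .vertex 0 b⟩]) =
      lowerPart n (u ++ [⟨i, .vertex a b⟩]) := by
  have h1 : IsDiagram n (u ++ [⟨i, .vertex a 1⟩, ⟨i, .vertex 1 b⟩]) (m - a + b) :=
    hu.append (by simp [isDiagram_cons, isDiagram_nil]; omega)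
  have h2 : IsDiagram n (u ++ [⟨i, .vertex a b⟩]) (m - a + b) :=
    hu.append (by simp [isDiagram_cons, isDiagram_nil]; omega)
  have h3 : IsDiagram n (u ++ [⟨i, .vertex a 0⟩, ⟨i, .vertex 0 b⟩]) (m - a + b) :=
    hu.append (by simp [isDiagram_cons, isDiagram_nil]; omega)
  funext v
  by_cases hv : IsDiagram (m - a + b) v n
  · have h := mkAlgHom_eq (.contract_delete u v i a b ⟨_, h1.append hv⟩ ⟨_, h2.append hv⟩
      ⟨_, h3.append hv⟩ rfl rfl rfl)
    replace h := congrArg (· + RingQuot.mkAlgHom ℂ[X] (Rel n) (gen ⟨_, h3.append hv⟩)) h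
    simp only [← map_add, sub_add_cancel] at h
    rw [map_add, ← cl_slices, ← cl_slices, ← cl_slices] at h
    exact h
  · rw [Pi.add_apply, lowerPart_eq_zero h1 hv, lowerPart_eq_zero h2 hv, lowerPart_eq_zero h3 hv,
      add_zero]

/-- A loop at the only two upper legs of a vertex. -/
theorem lowerPart_loop_aux {m i a : ℕ} {u : List Slice} (hu : IsDiagram n u m)
    (hi : i + a ≤ m) :
    lowerPart n (u ++ [⟨i, .vertex a 2⟩, ⟨i, .cap⟩]) =
      (X - 1 : ℂ[X]) • lowerPart n (u ++ [⟨i, .vertex a 0⟩]) := by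
  have h1 : IsDiagram n (u ++ [⟨i, .vertex a 2⟩, ⟨i, .cap⟩]) (m - a) :=
    hu.append (by simp [isDiagram_cons, isDiagram_nil]; omega)
  have h2 : IsDiagram n (u ++ [⟨i, .vertex a 0⟩]) (m - a) :=
    hu.append (by simp [isDiagram_cons, isDiagram_nil]; omega)
  funext v
  by_cases hv : IsDiagram (m - a) v n
  · have h := mkAlgHom_eq (.loop u v [] i a 0 rfl ⟨_, h1.append hv⟩ ⟨_, h2.append hv⟩
      (by simp) (by simp))
    rw [map_smul, ← cl_slices, ← cl_slices] at h
    exact h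
  · rw [Pi.smul_apply, lowerPart_eq_zero h1 hv, lowerPart_eq_zero h2 hv, smul_zero]

theorem lowerPart_closed_curve {m i : ℕ} {u : List Slice} (hu : IsDiagram n u m)
    (hi : i ≤ m) :
    lowerPart n (u ++ [⟨i, .cup⟩, ⟨i, .cap⟩]) = (X - 1 : ℂ[X]) • lowerPart n u := by
  have h1 : IsDiagram n (u ++ [⟨i, .cup⟩, ⟨i, .cap⟩]) m :=
    hu.append (by simp [isDiagram_cons, isDiagram_nil]; omega)
  funext v
  by_cases hv : IsDiagram m v n
  · have h := mkAlgHom_eq (.closed_curve u v [] i rfl ⟨_, h1.append hv⟩ ⟨_, hu.append hv⟩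
      (by simp) (by simp))
    rw [map_smul, ← cl_slices, ← cl_slices] at h
    exact h
  · rw [Pi.smul_apply, lowerPart_eq_zero h1 hv, lowerPart_eq_zero hu hv, smul_zero]

theorem lowerPart_univalent {m i : ℕ} {u : List Slice} (hu : IsDiagram n u m)
    (hi : i + 1 ≤ m) : lowerPart n (u ++ [⟨i, .vertex 1 0⟩]) = 0 := by
  have h1 : IsDiagram n (u ++ [⟨i, .vertex 1 0⟩]) (m - 1) :=
    hu.append (by simp [isDiagram_cons, isDiagram_nil]; omega)
  funext v
  by_cases hv : IsDiagram (m - 1) v n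
  · have h := mkAlgHom_eq (.univalent u v i ⟨_, h1.append hv⟩ rfl)
    rw [map_zero, ← cl_slices] at h
    exact h
  · exact lowerPart_eq_zero h1 hv

theorem lowerPart_bivalent {m i : ℕ} {u : List Slice} (hu : IsDiagram n u m)
    (hi : i + 1 ≤ m) : lowerPart n (u ++ [⟨i, .vertex 1 1⟩]) = lowerPart n u := by
  have h1 : IsDiagram n (u ++ [⟨i, .vertex 1 1⟩]) m :=
    hu.append (by simp [isDiagram_cons, isDiagram_nil]; omega)
  funext v
  by_cases hv : IsDiagram m v n
  · have h := mkAlgHom_eq (.bivalent u v i ⟨_, h1.append hv⟩ ⟨_, hu.append hv⟩ rfl rfl)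
    rw [← cl_slices, ← cl_slices] at h
    exact h
  · rw [lowerPart_eq_zero h1 hv, lowerPart_eq_zero hu hv]

theorem lowerPart_isolated {m i : ℕ} {u : List Slice} (hu : IsDiagram n u m)
    (hi : i ≤ m) : lowerPart n (u ++ [⟨i, .vertex 0 0⟩]) = lowerPart n u := by
  have h1 : IsDiagram n (u ++ [⟨i, .vertex 0 0⟩]) m :=
    hu.append (by simp [isDiagram_cons, isDiagram_nil]; omega)
  funext v
  by_cases hv : IsDiagram m v n
  · have h := mkAlgHom_eq (.isolated u v i ⟨_, h1.append hv⟩ ⟨_, hu.append hv⟩ rfl rfl)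
    rw [← cl_slices, ← cl_slices] at h
    exact h
  · rw [lowerPart_eq_zero h1 hv, lowerPart_eq_zero hu hv]

/-- A vertex with one leg, which points upwards. -/
theorem lowerPart_univalent_up {m i : ℕ} {u : List Slice} (hu : IsDiagram n u m)
    (hi : i ≤ m) : lowerPart n (u ++ [⟨i, .vertex 0 1⟩]) = 0 := by
  have h := lowerPart_isot ((isot_unrotate_left i 0 0 (by omega)).append_left hu)
  have hu' : IsDiagram n (u ++ [⟨i, .cup⟩]) (m + 2) :=
    hu.append (by simp [isDiagram_cons, isDiagram_nil]; omega)
  have h' := lowerPart_univalent hu' (i := i + 1) (by omega)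
  rw [List.append_assoc] at h'
  exact h.trans h'

/-- A vertex with two legs, which point upwards. -/
theorem lowerPart_bivalent_up {m i : ℕ} {u : List Slice} (hu : IsDiagram n u m)
    (hi : i ≤ m) : lowerPart n (u ++ [⟨i, .vertex 0 2⟩]) = lowerPart n (u ++ [⟨i, .cup⟩]) := by
  have h := lowerPart_isot ((isot_unrotate_left i 0 1 (by omega)).append_left hu)
  have hu' : IsDiagram n (u ++ [⟨i, .cup⟩]) (m + 2) :=
    hu.append (by simp [isDiagram_cons, isDiagram_nil]; omega)
  have h' := lowerPart_bivalent hu' (i := i + 1) (by omega)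
  rw [List.append_assoc] at h'
  exact h.trans h'

variable (n) in
/-- Stacking `x` on top of the lower part of a graph. -/
noncomputable def stackOn (x : List Slice) :
    (List Slice → ChromaticAlgebra n) →ₗ[ℂ[X]] (List Slice → ChromaticAlgebra n) :=
  LinearMap.funLeft ℂ[X] (ChromaticAlgebra n) (x ++ ·)

theorem stackOn_lowerPart (x u : List Slice) :
    stackOn n x (lowerPart n u) = lowerPart n (u ++ x) := by
  funext v
  simp [stackOn, lowerPart]

/-- The relation for loops, for a loop between two neighbouring upper legs of a vertex. -/
theorem lowerPart_loop (p q : ℕ) {m j a : ℕ} {u : List Slice} (hu : IsDiagram n u m)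
    (hj : j + a ≤ m) :
    lowerPart n (u ++ [⟨j, .vertex a (p + 2 + q)⟩, ⟨j + p, .cap⟩]) =
      (X - 1 : ℂ[X]) • lowerPart n (u ++ [⟨j, .vertex a (p + q)⟩]) := by
  -- Turn the `p` legs at the left and the `q` legs at the right of the loop downwards.
  induction p generalizing u m j a with
  | succ p ih =>
    have key : ∀ b v, lowerPart n (u ++ (⟨j, .vertex a (b + 1)⟩ :: v)) =
        lowerPart n (u ++ [⟨j, .cup⟩] ++ (⟨j + 1, .vertex (a + 1) b⟩ :: v)) := by
      intro b v
      have h := lowerPart_isot ((isot_unrotate_left j a b hj).append_left hu)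
      simpa [stackOn_lowerPart] using congrArg (stackOn n v) h
    have hu' : IsDiagram n (u ++ [⟨j, .cup⟩]) (m + 2) :=
      hu.append (by simp [isDiagram_cons, isDiagram_nil]; omega)
    have h := ih hu' (j := j + 1) (a := a + 1) (by omega)
    rw [show p + 1 + 2 + q = p + 2 + q + 1 by omega, show p + 1 + q = p + q + 1 by omega, key, key,
      show j + (p + 1) = j + 1 + p by omega, h]
  | zero =>
    induction q generalizing u m j a with
    | succ q ih =>
      have key : ∀ b v, lowerPart n (u ++ (⟨j, .vertex a (b + 1)⟩ :: v)) =
          lowerPart n (u ++ [⟨j + a, .cup⟩] ++ (⟨j, .vertex (a + 1) b⟩ :: v)) := by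
        intro b v
        have h := lowerPart_isot ((isot_unrotate_right j a b hj).append_left hu)
        simpa [stackOn_lowerPart] using congrArg (stackOn n v) h
      have hu' : IsDiagram n (u ++ [⟨j + a, .cup⟩]) (m + 2) :=
        hu.append (by simp [isDiagram_cons, isDiagram_nil]; omega)
      have h := ih hu' (j := j) (a := a + 1) (by omega)
      rw [← add_assoc, ← add_assoc, key, key, h]
    | zero => exact lowerPart_loop_aux hu hj

/-- The relation for contraction and deletion, for an edge between an upper leg of a vertex and the
lower leg of a vertex on top of it. -/
theorem lowerPart_edge (p q l : ℕ) {m j a : ℕ} {u : List Slice} (hu : IsDiagram n u m)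
    (hj : j + a ≤ m) :
    lowerPart n (u ++ [⟨j, .vertex a (p + 1 + q)⟩, ⟨j + p, .vertex 1 l⟩]) +
        lowerPart n (u ++ [⟨j, .vertex a (p + q)⟩, ⟨j + p, .vertex 0 l⟩]) =
      lowerPart n (u ++ [⟨j, .vertex a (p + l + q)⟩]) := by
  -- Turn the `p` legs at the left and the `q` legs at the right of the edge downwards.
  induction p generalizing u m j a with
  | succ p ih =>
    have key : ∀ b v, lowerPart n (u ++ (⟨j, .vertex a (b + 1)⟩ :: v)) =
        lowerPart n (u ++ [⟨j, .cup⟩] ++ (⟨j + 1, .vertex (a + 1) b⟩ :: v)) := by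
      intro b v
      have h := lowerPart_isot ((isot_unrotate_left j a b hj).append_left hu)
      simpa [stackOn_lowerPart] using congrArg (stackOn n v) h
    have hu' : IsDiagram n (u ++ [⟨j, .cup⟩]) (m + 2) :=
      hu.append (by simp [isDiagram_cons, isDiagram_nil]; omega)
    have h := ih hu' (j := j + 1) (a := a + 1) (by omega)
    rw [show p + 1 + 1 + q = p + 1 + q + 1 by omega, show p + 1 + q = p + q + 1 by omega,
      show p + 1 + l + q = p + l + q + 1 by omega, key, key, key,
      show j + (p + 1) = j + 1 + p by omega, ← h]
    rw [show p + 1 + q = p + q + 1 by omega]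
  | zero =>
    induction q generalizing u m j a with
    | succ q ih =>
      have key : ∀ b v, lowerPart n (u ++ (⟨j, .vertex a (b + 1)⟩ :: v)) =
          lowerPart n (u ++ [⟨j + a, .cup⟩] ++ (⟨j, .vertex (a + 1) b⟩ :: v)) := by
        intro b v
        have h := lowerPart_isot ((isot_unrotate_right j a b hj).append_left hu)
        simpa [stackOn_lowerPart] using congrArg (stackOn n v) h
      have hu' : IsDiagram n (u ++ [⟨j + a, .cup⟩]) (m + 2) :=
        hu.append (by simp [isDiagram_cons, isDiagram_nil]; omega)
      have h := ih hu' (j := j) (a := a + 1) (by omega)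
      rw [← add_assoc, ← add_assoc, ← add_assoc, key, key, key, h]
    | zero =>
      simpa using lowerPart_contract_delete hu hj

/-- Submodules are closed under differences.  The structure of `V` is only that of an additive
monoid, negatives being given by the scalar `-1`. -/
theorem mem_of_add_mem {A V : Type*} [CommRing A] [AddCommMonoid V] [Module A V]
    {S : Submodule A V} {x y : V} (hy : y ∈ S) (hxy : x + y ∈ S) : x ∈ S := by
  have h : x = x + y + (-1 : A) • y := by
    have : y + (-1 : A) • y = 0 := by
      rw [← one_smul A y, smul_smul, ← add_smul]
      simp
    rw [add_assoc, this, add_zero]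
  rw [h]
  exact S.add_mem hxy (S.smul_mem _ hy)

variable (n) in
/-- The span of the forests with `N` boundary points, as lower parts of graphs. -/
noncomputable def forestSpan (N : ℕ) : Submodule ℂ[X] (List Slice → ChromaticAlgebra n) :=
  Submodule.span ℂ[X] {f | ∃ F, IsForest F ∧ IsDiagram 0 F N ∧ lowerPart n F = f}

theorem lowerPart_mem_forestSpan {N : ℕ} {F : List Slice} (hF : IsForest F)
    (hd : IsDiagram 0 F N) : lowerPart n F ∈ forestSpan n N :=
  Submodule.subset_span ⟨F, hF, hd, rfl⟩

theorem stackOn_mem_forestSpan {M N : ℕ} {x : List Slice}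
    (h : ∀ F, IsForest F → IsDiagram 0 F M → lowerPart n (F ++ x) ∈ forestSpan n N)
    {f : List Slice → ChromaticAlgebra n} (hf : f ∈ forestSpan n M) :
    stackOn n x f ∈ forestSpan n N := by
  have : forestSpan n M ≤ (forestSpan n N).comap (stackOn n x) := by
    refine Submodule.span_le.2 ?_
    rintro _ ⟨F, hF, hd, rfl⟩
    rw [SetLike.mem_coe, Submodule.mem_comap, stackOn_lowerPart]
    exact h F hF hd
  exact this hf

theorem isDiagram_bottom {N : ℕ} {F : List Slice} (hd : IsDiagram 0 F N) :
    IsDiagram n F (N + n) := by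
  simpa using hd.widen n

theorem lowerPart_append_vertex_mem {M j k : ℕ} {F : List Slice} (hF : IsForest F)
    (hd : IsDiagram 0 F M) (hj : j ≤ M) :
    lowerPart n (F ++ [⟨j, .vertex 0 k⟩]) ∈ forestSpan n (M + k) := by
  have hd' : IsDiagram n F (M + n) := isDiagram_bottom hd
  match k with
  | 0 =>
    rw [lowerPart_isolated hd' (by omega)]
    exact lowerPart_mem_forestSpan hF hd
  | 1 =>
    rw [lowerPart_univalent_up hd' (by omega)]
    exact Submodule.zero_mem _
  | 2 =>
    rw [lowerPart_bivalent_up hd' (by omega)]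
    exact lowerPart_mem_forestSpan (hF.append (isForest_singleton.2 (.inl rfl)))
      (hd.append (by simp [isDiagram_cons, isDiagram_nil]; omega))
  | k + 3 =>
    exact lowerPart_mem_forestSpan
      (hF.append (isForest_singleton.2 (.inr ⟨k + 3, by omega, rfl⟩)))
      (hd.append (by simp [isDiagram_cons, isDiagram_nil]; omega))

/-- The relations express a forest with an inner edge by forests. -/
theorem lowerPart_append_innerEdge_mem {M N : ℕ} {F x : List Slice} (hF : IsForest F)
    (hd : IsDiagram 0 F M) (hx : InnerEdge x) (hxd : IsDiagram M x N) :
    lowerPart n (F ++ x) ∈ forestSpan n N := by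
  have hd' : IsDiagram n F (M + n) := isDiagram_bottom hd
  cases hx with
  | loop j p q =>
    simp only [isDiagram_cons, isDiagram_nil, Piece.dom_vertex, Piece.cod_vertex, Piece.dom_cap,
      Piece.cod_cap] at hxd
    rw [lowerPart_loop p q hd' (by omega)]
    refine Submodule.smul_mem _ _ ?_
    rw [show N = M + (p + q) by omega]
    exact lowerPart_append_vertex_mem hF hd (by omega)
  | closed j =>
    simp only [isDiagram_cons, isDiagram_nil, Piece.dom_cup, Piece.cod_cup, Piece.dom_cap,
      Piece.cod_cap] at hxd
    rw [lowerPart_closed_curve hd' (by omega)]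
    refine Submodule.smul_mem _ _ ?_
    rw [show N = M by omega]
    exact lowerPart_mem_forestSpan hF hd
  | edge j p q l =>
    simp only [isDiagram_cons, isDiagram_nil, Piece.dom_vertex, Piece.cod_vertex] at hxd
    have hedge := lowerPart_edge p q l hd' (show j + 0 ≤ M + n by omega)
    have hmem := lowerPart_append_vertex_mem (n := n) (j := j) (k := p + l + q) hF hd (by omega)
    rw [← hedge, show M + (p + l + q) = N by omega] at hmem
    refine mem_of_add_mem ?_ hmem
    have h := lowerPart_append_vertex_mem (n := n) (j := j) (k := p + q) hF hd (by omega)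
    have h' := stackOn_mem_forestSpan (N := M + (p + q) + l) (x := [⟨j + p, .vertex 0 l⟩])
      (fun F' hF' hd'' => lowerPart_append_vertex_mem hF' hd'' (by omega)) h
    rw [stackOn_lowerPart, List.append_assoc] at h'
    rw [show N = M + (p + q) + l by omega]
    exact h'

theorem lowerPart_append_cap_mem {M i : ℕ} {F : List Slice} (hF : IsForest F)
    (hd : IsDiagram 0 F M) (hi : i + 2 ≤ M) :
    lowerPart n (F ++ [⟨i, .cap⟩]) ∈ forestSpan n (M - 2) := by
  have hisot : ∀ {w w' : List Slice}, Isot 0 (M - 2) w w' → lowerPart n w = lowerPart n w' :=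
    fun h => lowerPart_isot (by simpa using h.widen n)
  rcases resolves_cap hF hd hi with ⟨F', h, hF'⟩ | ⟨F₁, x, F₂, h, hF₁, hx, hF₂⟩
  · rw [hisot h]
    exact lowerPart_mem_forestSpan hF' h.right
  · rw [hisot h, ← stackOn_lowerPart]
    obtain ⟨b, hb, hb'⟩ := isDiagram_append.1 h.right
    obtain ⟨a, ha, ha'⟩ := isDiagram_append.1 hb
    exact stackOn_mem_forestSpan
      (fun F' hF' hd' => lowerPart_mem_forestSpan (hF'.append hF₂) (hd'.append hb'))
      (lowerPart_append_innerEdge_mem hF₁ ha hx ha')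

/-- Every lower part of a graph is a linear combination of forests. -/
theorem lowerPart_mem_forestSpan_of_isSimple {E : List Slice}
    (hE : IsSimple (fun _ => True) E) {N : ℕ} (hd : IsDiagram 0 E N) :
    lowerPart n E ∈ forestSpan n N := by
  induction E using List.reverseRecOn generalizing N with
  | nil => exact lowerPart_mem_forestSpan (by simp [IsForest]) hd
  | append_singleton E s ih =>
    obtain ⟨K, hK, hs, hN⟩ := isDiagram_snoc.1 hd
    rw [← stackOn_lowerPart]
    refine stackOn_mem_forestSpan (fun F hF hdF => ?_) (ih (fun t ht => hE t (by simp [ht])) hK)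
    obtain ⟨i, p⟩ := s
    rcases hE _ (List.mem_append_right _ (List.mem_singleton_self _)) with hp | hp | ⟨k, -, hp⟩ <;>
      simp only at hp <;> subst hp
    · exact lowerPart_mem_forestSpan (hF.append (isForest_singleton.2 (.inl rfl)))
        (hdF.append (isDiagram_singleton.2 ⟨hs, hN⟩))
    · simp only [Piece.dom_cap, Piece.cod_cap] at hs hN
      rw [show N = K - 2 by omega]
      exact lowerPart_append_cap_mem hF hdF hs
    · simp only [Piece.dom_vertex, Piece.cod_vertex] at hs hN
      rw [show N = K + k by omega]
      exact lowerPart_append_vertex_mem hF hdF (by omega)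

theorem classOf_mem_span (g : Graph n) :
    classOf g ∈ Submodule.span ℂ[X] (Set.range fun g : BasicGraph n => classOf g.1) := by
  induction g using Quotient.inductionOn with
  | _ G =>
    obtain ⟨w, hw⟩ := G
    obtain ⟨E, hE, hs⟩ := exists_isSimple (fun _ => True) (isDiagram_cups_append hw)
      (fun _ _ _ _ => trivial)
    have h := lowerPart_mem_forestSpan_of_isSimple (n := n) hs hE.right
    have e : classOf (Graph.mk ⟨w, hw⟩) = lowerPart n E (caps n n) := by
      rw [← cl_of_isDiagram]
      exact cl_isot ((isot_bend hw).trans (isot_append_caps hE))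
    change classOf (Graph.mk ⟨w, hw⟩) ∈ _
    rw [e]
    have hle : forestSpan n (2 * n) ≤
        (Submodule.span ℂ[X] (Set.range fun g : BasicGraph n => classOf g.1)).comap
          (LinearMap.proj (R := ℂ[X]) (φ := fun _ => ChromaticAlgebra n) (caps n n)) := by
      refine Submodule.span_le.2 ?_
      rintro _ ⟨F, hF, hd, rfl⟩
      obtain ⟨s, hs, rfl⟩ := hF.exists_starWord hd
      exact Submodule.subset_span
        ⟨basicGraph hs, (cl_of_isDiagram (isDiagram_append_caps hs.isDiagram)).symm⟩
    exact hle h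

theorem span_basicGraph :
    ⊤ ≤ Submodule.span ℂ[X] (Set.range fun g : BasicGraph n => classOf g.1) := by
  intro x _
  obtain ⟨y, rfl⟩ := RingQuot.mkAlgHom_surjective ℂ[X] (Rel n) x
  induction y using MonoidAlgebra.induction_on with
  | of g => exact classOf_mem_span g
  | add a b ha hb =>
    rw [map_add]
    exact Submodule.add_mem _ (ha trivial) (hb trivial)
  | smul r a ha =>
    rw [map_smul]
    exact Submodule.smul_mem _ _ (ha trivial)

/-! ### Graphs without inner edges, with vertices of small valence -/

theorem edgeModel_act_le {s : Slice} {x : List Bool} (hx : s.offset + s.piece.dom ≤ x.length)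
    {f g : List Bool → ℕ}
    (h : ∀ y, y.length = x.length - s.piece.dom + s.piece.cod → f y ≤ g y) :
    edgeModel.act s f x ≤ edgeModel.act s g x := by
  obtain ⟨l, a, r, rfl, hl, ha⟩ := exists_append_of_le hx
  obtain ⟨i, p⟩ := s
  rw [StrandModel.act_append _ hl ha, StrandModel.act_append _ hl ha]
  refine Finset.sum_le_sum fun b hb => ?_
  split_ifs
  · refine h _ ?_
    simp at *
    omega
  · exact le_rfl

/-- The vertices allow all edge colourings. -/
theorem edgeModel_act_le_vertex (i : ℕ) (p : Piece) (f : List Bool → ℕ) (x : List Bool) :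
    edgeModel.act ⟨i, p⟩ f x ≤ edgeModel.act ⟨i, .vertex p.dom p.cod⟩ f x := by
  refine Finset.sum_le_sum fun b _ => ?_
  rw [if_pos (show edgeModel.Adm (.vertex p.dom p.cod) _ b from trivial)]
  split_ifs
  · exact le_rfl
  · exact Nat.zero_le _

theorem le_edgeModel_act_vertex {i : ℕ} {x : List Bool} {a : ℕ} (hx : i + a ≤ x.length)
    (f : List Bool → ℕ) : f x ≤ edgeModel.act ⟨i, .vertex a a⟩ f x := by
  obtain ⟨l, y, r, rfl, hl, hy⟩ := exists_append_of_le hx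
  rw [StrandModel.act_vertex _ hl hy]
  refine le_trans ?_ (Finset.single_le_sum (fun _ _ => Nat.zero_le _)
    (mem_words.2 hy : y ∈ words Bool a))
  rw [if_pos (show edgeModel.vertex _ _ from trivial)]

/-- In the chromatic algebra, vertices of valence less than three may be removed without creating
inner edges, unless the graph is zero. -/
theorem exists_valence_ge_three {m k : ℕ} {w : List Slice} (hw : IsDiagram m w k) :
    (∀ u, IsDiagram n u m → lowerPart n (u ++ w) = 0) ∨
      ∃ w', IsDiagram m w' k ∧ (∀ i a b, (⟨i, .vertex a b⟩ : Slice) ∈ w' → 3 ≤ a + b) ∧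
        (∀ u, IsDiagram n u m → lowerPart n (u ++ w) = lowerPart n (u ++ w')) ∧
        ∀ (f : List Bool → ℕ) (x : List Bool), x.length = m →
          edgeModel.ev w' f x ≤ edgeModel.ev w f x := by
  induction w generalizing m with
  | nil => exact .inr ⟨[], hw, by simp, fun _ _ => rfl, fun _ _ _ => le_rfl⟩
  | cons s w ih =>
    have hw' := hw
    rw [isDiagram_cons] at hw
    have hs : IsDiagram m [s] (m - s.piece.dom + s.piece.cod) :=
      isDiagram_singleton.2 ⟨hw.1, rfl⟩
    rcases ih hw.2 with h | ⟨w', h1, h2, h3, h4⟩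
    · refine .inl fun u hu => ?_
      have := h (u ++ [s]) (hu.append hs)
      rwa [List.append_assoc] at this
    -- If `s` may be replaced by `t`, which has no vertices of small valence, we are done.
    have key : ∀ t, IsDiagram m t (m - s.piece.dom + s.piece.cod) →
        (∀ i a b, (⟨i, .vertex a b⟩ : Slice) ∈ t → 3 ≤ a + b) →
        (∀ u, IsDiagram n u m → lowerPart n (u ++ [s]) = lowerPart n (u ++ t)) →
        (∀ (f : List Bool → ℕ) (x : List Bool), x.length = m →
          edgeModel.ev t f x ≤ edgeModel.act s f x) →
        ∃ w', IsDiagram m w' k ∧ (∀ i a b, (⟨i, .vertex a b⟩ : Slice) ∈ w' → 3 ≤ a + b) ∧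
          (∀ u, IsDiagram n u m → lowerPart n (u ++ (s :: w)) = lowerPart n (u ++ w')) ∧
          ∀ (f : List Bool → ℕ) (x : List Bool), x.length = m →
            edgeModel.ev w' f x ≤ edgeModel.ev (s :: w) f x := by
      intro t t1 t2 t3 t4
      refine ⟨t ++ w', t1.append h1, ?_, fun u hu => ?_, fun f x hx => ?_⟩
      · intro i a b h
        rcases List.mem_append.1 h with h | h
        exacts [t2 i a b h, h2 i a b h]
      · have e1 := h3 (u ++ [s]) (hu.append hs)
        have e2 := congrArg (stackOn n w') (t3 u hu)
        rw [stackOn_lowerPart, stackOn_lowerPart] at e2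
        simpa using e1.trans e2
      · rw [StrandModel.ev_append, StrandModel.ev_cons]
        refine (t4 _ x hx).trans (edgeModel_act_le (by rw [hx]; exact hw.1) fun y hy => ?_)
        exact h4 f y (by rw [hy, hx])
    by_cases hsmall : ∃ i a b, s = ⟨i, .vertex a b⟩ ∧ a + b < 3
    · obtain ⟨i, a, b, rfl, hab⟩ := hsmall
      simp only [Piece.dom_vertex, Piece.cod_vertex] at hw hs key
      have hzero : (∀ u, IsDiagram n u m → lowerPart n (u ++ [⟨i, .vertex a b⟩]) = 0) →
          ∀ u, IsDiagram n u m → lowerPart n (u ++ (⟨i, .vertex a b⟩ :: w)) = 0 := by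
        intro h u hu
        have := congrArg (stackOn n w) (h u hu)
        rw [stackOn_lowerPart, map_zero] at this
        simpa using this
      obtain ⟨rfl, rfl⟩ | ⟨rfl, rfl⟩ | ⟨rfl, rfl⟩ | ⟨rfl, rfl⟩ | ⟨rfl, rfl⟩ | ⟨rfl, rfl⟩ :
          (a = 0 ∧ b = 0) ∨ (a = 0 ∧ b = 1) ∨ (a = 1 ∧ b = 0) ∨ (a = 0 ∧ b = 2) ∨
            (a = 2 ∧ b = 0) ∨ (a = 1 ∧ b = 1) := by omega
      · refine .inr (key [] rfl (by simp) (fun u hu => ?_) fun f x hx => ?_)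
        · rw [List.append_nil]
          exact lowerPart_isolated hu hw.1
        · exact le_edgeModel_act_vertex (by omega) f
      · exact .inl (hzero fun u hu => lowerPart_univalent_up hu hw.1)
      · exact .inl (hzero fun u hu => lowerPart_univalent hu hw.1)
      · refine .inr (key [⟨i, .cup⟩] (isDiagram_singleton.2 ⟨hw.1, rfl⟩) (by simp)
          (fun u hu => lowerPart_bivalent_up hu hw.1) fun f x _ => ?_)
        exact edgeModel_act_le_vertex i .cup f x
      · refine .inr (key [⟨i, .cap⟩] (isDiagram_singleton.2 ⟨hw.1, rfl⟩) (by simp)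
          (fun u hu => ?_) fun f x _ => ?_)
        · have h := lowerPart_isot ((isot_rotate_right i 1 0 (by omega)).append_left hu)
          have h' := congrArg (stackOn n [⟨i, .cap⟩]) (lowerPart_bivalent hu (i := i) (by omega))
          rw [stackOn_lowerPart, stackOn_lowerPart, List.append_assoc] at h'
          exact h.trans h'
        · exact edgeModel_act_le_vertex i .cap f x
      · refine .inr (key [] (by rw [isDiagram_nil]; omega) (by simp) (fun u hu => ?_)
          fun f x hx => ?_)
        · rw [List.append_nil]
          exact lowerPart_bivalent hu hw.1
        · exact le_edgeModel_act_vertex (by omega) f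
    · refine .inr (key [s] hs (fun i a b h => ?_) (fun _ _ => rfl) fun f x _ => le_rfl)
      rw [List.mem_singleton] at h
      by_contra hlt
      exact hsmall ⟨i, a, b, h.symm, by omega⟩

theorem classOf_eq_zero_or_basic (G : Diagram n) (hG : G.NoInnerEdges) :
    classOf (Graph.mk G) = 0 ∨ ∃ g : BasicGraph n, classOf (Graph.mk G) = classOf g.1 := by
  have e : classOf (Graph.mk G) = lowerPart n ([] ++ G.slices) [] := by
    rw [lowerPart, List.nil_append, List.append_nil]
    exact (cl_of_isDiagram G.isDiagram).symm
  rw [e]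
  rcases exists_valence_ge_three (n := n) G.isDiagram with h | ⟨w, h1, h2, h3, h4⟩
  · left
    rw [h [] rfl]
    rfl
  · right
    have hle : edgeCount n w n ≤ edgeCount n G.slices n := h4 _ _ (by simp)
    rw [(noInnerEdges_iff G).1 hG] at hle
    have hpos := edgeCount_pos h1
    obtain ⟨s, hs, hmk⟩ := exists_starWord_of_slices h1 (by omega) h2
    refine ⟨basicGraph hs, ?_⟩
    rw [h3 [] rfl, lowerPart, List.nil_append, List.append_nil, cl_of_isDiagram h1, hmk]
    rfl

end algebra

/-! ### Flows -/

/-- The nowhere-zero flows with values in `ZMod q`, all strands being directed upwards. -/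
def flowModel (q : ℕ) : StrandModel {d : ZMod q // d ≠ 0} where
  dual d := ⟨-d.1, neg_ne_zero.2 d.2⟩
  dual_dual d := by simp
  vertex x y := (x.map Subtype.val).sum = (y.map Subtype.val).sum
  rotate_right x y d := by
    simp [← sub_eq_add_neg, eq_sub_iff_add_eq]
  rotate_left x y d := by
    simp [← sub_eq_neg_add, eq_sub_iff_add_eq, add_comm]

theorem flowModel_vertex {q : ℕ} {x y : List {d : ZMod q // d ≠ 0}} :
    (flowModel q).vertex x y ↔ (x.map Subtype.val).sum = (y.map Subtype.val).sum := Iff.rfl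

theorem flowModel_dual {q : ℕ} (d : {d : ZMod q // d ≠ 0}) : ((flowModel q).dual d).1 = -d.1 := rfl

theorem ev_add {α : Type} [Fintype α] {R : Type} [CommSemiring R] (M : StrandModel α)
    (w : List Slice) (f g : List α → R) (x : List α) :
    M.ev w (fun z => f z + g z) x = M.ev w f x + M.ev w g x := by
  induction w generalizing x with
  | nil => rfl
  | cons s w ih =>
    rw [StrandModel.ev_cons, StrandModel.ev_cons, StrandModel.ev_cons, StrandModel.act,
      StrandModel.act, StrandModel.act, ← Finset.sum_add_distrib]
    refine Finset.sum_congr rfl fun b _ => ?_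
    rw [ih]
    split_ifs <;> simp

theorem ev_middle {α : Type} [Fintype α] {R : Type} [CommSemiring R] (M : StrandModel α)
    {k : ℕ} {w : List Slice} {l x r : List α} {i : ℕ} (hl : l.length = i)
    (hx : IsDiagram x.length w k) (f : List α → R) :
    M.ev (shift i w) f (l ++ (x ++ r)) = M.ev w (fun y => f (l ++ (y ++ r))) x := by
  subst hl
  rw [M.ev_shift (x := x ++ r) (by simpa using hx.widen r.length), M.ev_widen hx]

/-- The words of `n` nonzero elements of `ZMod q`. -/
abbrev FlowWord (q n : ℕ) : Type := {x : List {d : ZMod q // d ≠ 0} // x.length = n}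

/-- The extension by zero of a function of the words of length `n` to all words. -/
def extend {q n : ℕ} (f : FlowWord q n → ℂ) (z : List {d : ZMod q // d ≠ 0}) : ℂ :=
  if h : z.length = n then f ⟨z, h⟩ else 0

theorem extend_coe {q n : ℕ} (f : FlowWord q n → ℂ) (x : FlowWord q n) : extend f x.1 = f x :=
  dif_pos x.2

section flow

variable {q : ℕ} [NeZero q]

theorem card_flow : (Fintype.card {d : ZMod q // d ≠ 0} : ℂ) = (q : ℂ) - 1 := by
  have h1 : Fintype.card {d : ZMod q // d ≠ 0} = q - 1 := by
    rw [Fintype.card_subtype_compl, ZMod.card]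
    simp
  rw [h1, Nat.cast_sub (Nat.one_le_iff_ne_zero.2 (NeZero.ne q)), Nat.cast_one]

/-- The state sums satisfy the relation for contraction and deletion: the flow through the edge is
determined by the conservation law, and it must not be zero. -/
theorem flow_contract_delete {i a b m : ℕ} (hi : i + a ≤ m)
    (f : List {d : ZMod q // d ≠ 0} → ℂ) {y : List {d : ZMod q // d ≠ 0}} (hy : y.length = m) :
    (flowModel q).ev [⟨i, .vertex a 1⟩, ⟨i, .vertex 1 b⟩] f y +
      (flowModel q).ev [⟨i, .vertex a 0⟩, ⟨i, .vertex 0 b⟩] f y =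
        (flowModel q).ev [⟨i, .vertex a b⟩] f y := by
  classical
  obtain ⟨l, x, r, rfl, hl, hx⟩ := exists_append_of_le (x := y) (i := i) (d := a) (by omega)
  simp only [StrandModel.ev_cons, StrandModel.ev_nil]
  rw [StrandModel.act_vertex _ hl hx, StrandModel.act_vertex _ hl hx,
    StrandModel.act_vertex _ hl hx, sum_words_one, sum_words_zero]
  have h1 : ∀ d : {d : ZMod q // d ≠ 0},
      (flowModel q).act ⟨i, .vertex 1 b⟩ f (l ++ ([d] ++ r)) =
      ∑ y ∈ words _ b, if d.1 = (y.map Subtype.val).sum then f (l ++ (y ++ r)) else 0 := by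
    intro d
    rw [StrandModel.act_vertex (x := [d]) (a := 1) _ hl rfl]
    refine Finset.sum_congr rfl fun y _ => ?_
    simp [flowModel_vertex]
  have h2 : (flowModel q).act ⟨i, .vertex 0 b⟩ f (l ++ ([] ++ r)) =
      ∑ y ∈ words _ b, if 0 = (y.map Subtype.val).sum then f (l ++ (y ++ r)) else 0 := by
    rw [StrandModel.act_vertex (x := []) (a := 0) _ hl rfl]
    refine Finset.sum_congr rfl fun y _ => ?_
    simp [flowModel_vertex]
  simp only [h1, h2, flowModel_vertex, List.map_cons, List.map_nil, List.sum_cons, List.sum_nil, add_zero]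
  by_cases hs : (x.map Subtype.val).sum = 0
  · rw [Finset.sum_eq_zero, hs, zero_add, if_pos rfl]
    intro d _
    rw [hs, if_neg (Ne.symm d.2)]
  · rw [if_neg hs, add_zero, Finset.sum_eq_single ⟨_, hs⟩, if_pos rfl]
    · intro d _ hd
      rw [if_neg]
      exact fun h => hd (Subtype.ext h.symm)
    · simp

/-- A loop may carry an arbitrary flow. -/
theorem flow_loop {i a k m : ℕ} {w : List Slice} (hw : IsDiagram k w 0) (hi : i + a ≤ m)
    (f : List {d : ZMod q // d ≠ 0} → ℂ) {y : List {d : ZMod q // d ≠ 0}} (hy : y.length = m) :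
    (flowModel q).ev ([⟨i, .vertex a (k + 2)⟩] ++ shift (i + 1) w ++ [⟨i, .cap⟩]) f y =
      ((q : ℂ) - 1) * (flowModel q).ev ([⟨i, .vertex a k⟩] ++ shift i w) f y := by
  classical
  obtain ⟨l, x, r, rfl, hl, hx⟩ := exists_append_of_le (x := y) (i := i) (d := a) (by omega)
  simp only [StrandModel.ev_append, StrandModel.ev_cons, StrandModel.ev_nil]
  rw [StrandModel.act_vertex _ hl hx, StrandModel.act_vertex _ hl hx, sum_words_cons,
    sum_words_snoc, Finset.mul_sum]
  refine Finset.sum_congr rfl fun y hy => ?_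
  rw [mem_words] at hy
  have hd : IsDiagram y.length w 0 := by rwa [hy]
  have h1 : ∀ e e' : {d : ZMod q // d ≠ 0},
      (flowModel q).ev (shift (i + 1) w) ((flowModel q).act ⟨i, .cap⟩ f)
        (l ++ (e :: (y ++ [e']) ++ r)) =
      if e' = (flowModel q).dual e then
        (flowModel q).ev w (fun t => f (l ++ (t ++ r))) y else 0 := by
    intro e e'
    have h := ev_middle (flowModel q) (l := l ++ [e]) (i := i + 1) (r := e' :: r) (by simp [hl]) hd
      ((flowModel q).act ⟨i, .cap⟩ f)
    have e1 : l ++ (e :: (y ++ [e']) ++ r) = l ++ [e] ++ (y ++ e' :: r) := by simp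
    rw [e1, h]
    have h' := StrandModel.ev_congr (flowModel q) hd
      (f := fun t => (flowModel q).act ⟨i, .cap⟩ f (l ++ [e] ++ (t ++ e' :: r)))
      (g := fun t => if e' = (flowModel q).dual e then f (l ++ (t ++ r)) else 0) (by
        intro t ht
        obtain rfl := List.length_eq_zero_iff.1 ht
        have := (flowModel q).act_cap (l := l) (r := r) (d := e) (e := e') hl f
        simpa using this)
    rw [h']
    split_ifs
    · rfl
    · exact ev_zero _ w y
  simp only [h1]
  rw [Finset.sum_comm]
  have h2 : ∀ e : {d : ZMod q // d ≠ 0}, (∑ e', if (flowModel q).vertex x (e :: (y ++ [e'])) then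
      if e' = (flowModel q).dual e then
        (flowModel q).ev w (fun t => f (l ++ (t ++ r))) y else 0 else 0) =
      if (flowModel q).vertex x y then
        (flowModel q).ev (shift i w) f (l ++ (y ++ r)) else 0 := by
    intro e
    rw [Finset.sum_eq_single ((flowModel q).dual e)]
    · rw [if_pos rfl, ev_middle _ hl hd]
      congr 1
      simp [flowModel, add_comm]
    · intro e' _ he
      rw [if_neg he, ite_self]
    · simp
  simp only [h2]
  rw [Finset.sum_const, nsmul_eq_mul, Finset.card_univ, card_flow]

/-- A simple closed curve may carry an arbitrary flow. -/
theorem flow_closed_curve {i m : ℕ} {w : List Slice} (hw : IsDiagram 0 w 0) (hi : i ≤ m)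
    (f : List {d : ZMod q // d ≠ 0} → ℂ) {y : List {d : ZMod q // d ≠ 0}} (hy : y.length = m) :
    (flowModel q).ev ([⟨i, .cup⟩] ++ shift (i + 1) w ++ [⟨i, .cap⟩]) f y =
      ((q : ℂ) - 1) * (flowModel q).ev (shift i w) f y := by
  classical
  obtain ⟨l, x, r, rfl, hl, hx⟩ := exists_append_of_le (x := y) (i := i) (d := 0) (by omega)
  obtain rfl := List.length_eq_zero_iff.1 hx
  simp only [StrandModel.ev_append, StrandModel.ev_cons, StrandModel.ev_nil]
  rw [List.nil_append, StrandModel.act_cup _ hl]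
  have h1 : ∀ e : {d : ZMod q // d ≠ 0},
      (flowModel q).ev (shift (i + 1) w) ((flowModel q).act ⟨i, .cap⟩ f)
        (l ++ (e :: (flowModel q).dual e :: r)) = (flowModel q).ev (shift i w) f (l ++ r) := by
    intro e
    have h := ev_middle (flowModel q) (l := l ++ [e]) (i := i + 1) (x := [])
      (r := (flowModel q).dual e :: r) (by simp [hl]) hw ((flowModel q).act ⟨i, .cap⟩ f)
    have h' := ev_middle (flowModel q) (l := l) (x := []) (r := r) hl hw f
    have e1 : l ++ (e :: (flowModel q).dual e :: r) =
      l ++ [e] ++ ([] ++ (flowModel q).dual e :: r) := by simp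
    rw [List.nil_append] at h'
    rw [e1, h, h']
    refine StrandModel.ev_congr (flowModel q) (x := []) hw fun t ht => ?_
    obtain rfl := List.length_eq_zero_iff.1 ht
    have := (flowModel q).act_cap (l := l) (r := r) (d := e) (e := (flowModel q).dual e) hl f
    simpa using this
  simp only [h1]
  rw [Finset.sum_const, nsmul_eq_mul, Finset.card_univ, card_flow]

theorem flow_univalent {i m : ℕ} (hi : i + 1 ≤ m)
    (f : List {d : ZMod q // d ≠ 0} → ℂ) {y : List {d : ZMod q // d ≠ 0}} (hy : y.length = m) :
    (flowModel q).act ⟨i, .vertex 1 0⟩ f y = 0 := by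
  classical
  obtain ⟨l, x, r, rfl, hl, hx⟩ := exists_append_of_le (x := y) (i := i) (d := 1) (by omega)
  obtain ⟨e, rfl⟩ := List.length_eq_one_iff.1 hx
  rw [StrandModel.act_vertex _ hl hx, sum_words_zero, if_neg]
  simpa [flowModel] using e.2

theorem flow_bivalent {i m : ℕ} (hi : i + 1 ≤ m)
    (f : List {d : ZMod q // d ≠ 0} → ℂ) {y : List {d : ZMod q // d ≠ 0}} (hy : y.length = m) :
    (flowModel q).act ⟨i, .vertex 1 1⟩ f y = f y := by
  classical
  obtain ⟨l, x, r, rfl, hl, hx⟩ := exists_append_of_le (x := y) (i := i) (d := 1) (by omega)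
  obtain ⟨e, rfl⟩ := List.length_eq_one_iff.1 hx
  rw [StrandModel.act_vertex _ hl hx, sum_words_one, Finset.sum_eq_single e]
  · simp [flowModel]
  · intro d _ hd
    rw [if_neg]
    intro h
    simp only [flowModel, List.map_cons, List.map_nil, List.sum_cons, List.sum_nil, add_zero] at h
    exact hd (Subtype.ext h.symm)
  · simp

theorem flow_isolated {i m : ℕ} (hi : i ≤ m)
    (f : List {d : ZMod q // d ≠ 0} → ℂ) {y : List {d : ZMod q // d ≠ 0}} (hy : y.length = m) :
    (flowModel q).act ⟨i, .vertex 0 0⟩ f y = f y := by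
  classical
  obtain ⟨l, x, r, rfl, hl, hx⟩ := exists_append_of_le (x := y) (i := i) (d := 0) (by omega)
  obtain rfl := List.length_eq_zero_iff.1 hx
  rw [StrandModel.act_vertex _ hl hx, sum_words_zero,
    if_pos (flowModel_vertex.2 rfl)]

/-- The operator given by the flows on a graph. -/
noncomputable def flowEnd {n : ℕ} (G : Diagram n) : Module.End ℂ (FlowWord q n → ℂ) where
  toFun f x := (flowModel q).ev G.slices (extend f) x.1
  map_add' f g := by
    funext x
    rw [Pi.add_apply, ← ev_add]
    congr 2
    funext z
    simp only [extend]
    split_ifs <;> simp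
  map_smul' c f := by
    funext x
    rw [Pi.smul_apply, smul_eq_mul, RingHom.id_apply, ← ev_mul_left]
    congr 2
    funext z
    simp only [extend]
    split_ifs <;> simp

theorem flowEnd_apply {n : ℕ} (G : Diagram n) (f : FlowWord q n → ℂ) (x : FlowWord q n) :
    flowEnd G f x = (flowModel q).ev G.slices (extend f) x.1 := rfl

variable (q) in
/-- The representation of the monoid of graphs by flows.  It acts on functions of the labels at the
top, therefore it reverses products. -/
noncomputable def flowRep (n : ℕ) : Graph n →* (Module.End ℂ (FlowWord q n → ℂ))ᵐᵒᵖ where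
  toFun g := .op <| Quotient.lift (flowEnd (q := q)) (fun G H h => by
    refine LinearMap.ext fun f => funext fun x => ?_
    exact (flowModel q).ev_isot (isot_of_isotopy h) x.2 _) g
  map_one' := by
    refine congrArg MulOpposite.op (LinearMap.ext fun f => funext fun x => ?_)
    exact extend_coe f x
  map_mul' a b := by
    induction a using Quotient.inductionOn with
    | _ G =>
      induction b using Quotient.inductionOn with
      | _ H =>
        refine congrArg MulOpposite.op (LinearMap.ext fun f => funext fun x => ?_)
        change (flowModel q).ev (H.slices ++ G.slices) (extend f) x.1 =
          (flowModel q).ev H.slices (extend (flowEnd G f)) x.1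
        rw [StrandModel.ev_append]
        refine StrandModel.ev_congr _ (by rw [x.2]; exact H.isDiagram) fun y hy => ?_
        exact (extend_coe (flowEnd G f) ⟨y, hy⟩).symm

theorem flowRep_mk {n : ℕ} (G : Diagram n) : flowRep q n (Graph.mk G) = .op (flowEnd G) := rfl

variable (q) in
/-- The extension of the representation by flows to the free algebra, with `Q` acting as `q`. -/
noncomputable def flowHom (n : ℕ) : FreeAlg n →+* (Module.End ℂ (FlowWord q n → ℂ))ᵐᵒᵖ :=
  MonoidAlgebra.liftNCRingHom ((algebraMap ℂ _).comp (evalRingHom (q : ℂ))) (flowRep q n)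
    fun _ _ => Algebra.commutes _ _

theorem flowHom_smul {n : ℕ} (c : ℂ[X]) (G : Diagram n) :
    flowHom q n (c • gen G) = .op (c.eval (q : ℂ) • flowEnd G) := by
  have : c • gen G = MonoidAlgebra.single (Graph.mk G) c := by
    simp [gen, MonoidAlgebra.of]
  rw [this]
  refine (MonoidAlgebra.liftNCRingHom_single _ _ _ _ _).trans ?_
  simp [flowRep_mk, Algebra.algebraMap_eq_smul_one]

theorem flowHom_gen {n : ℕ} (G : Diagram n) : flowHom q n (gen G) = .op (flowEnd G) := by
  simpa using flowHom_smul (q := q) 1 G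

/-- A local identity of state sums holds in every surrounding graph. -/
theorem flow_context {n m : ℕ} {u v x y : List Slice} {c : ℂ} (hu : IsDiagram n u m)
    (h : ∀ f z, z.length = m → (flowModel q).ev x f z = c * (flowModel q).ev y f z)
    (f : List {d : ZMod q // d ≠ 0} → ℂ) (z : List {d : ZMod q // d ≠ 0}) (hz : z.length = n) :
    (flowModel q).ev (u ++ (x ++ v)) f z = c * (flowModel q).ev (u ++ (y ++ v)) f z := by
  simp only [StrandModel.ev_append]
  rw [← ev_mul_left]
  exact StrandModel.ev_congr _ (by rwa [hz]) fun t ht => h _ t ht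

/-- The flows satisfy the defining relations of the chromatic algebra. -/
theorem flowHom_rel {n : ℕ} {a b : FreeAlg n} (h : Rel n a b) : flowHom q n a = flowHom q n b := by
  -- All relations but the first one say that one graph is a multiple of another one.
  have key : ∀ (c : ℂ) (u v x y : List Slice) (G G' : Diagram n),
      G.slices = u ++ (x ++ v) → G'.slices = u ++ (y ++ v) →
      (∀ m, (∃ k, IsDiagram m x k) → ∀ f z, z.length = m →
        (flowModel q).ev x f z = c * (flowModel q).ev y f z) →
      (MulOpposite.op (flowEnd G) : (Module.End ℂ (FlowWord q n → ℂ))ᵐᵒᵖ) =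
        .op (c • flowEnd G') := by
    intro c u v x y G G' hG hG' h
    obtain ⟨m, hu, hm⟩ := isDiagram_append.1 (hG ▸ G.isDiagram)
    obtain ⟨k, hx, -⟩ := isDiagram_append.1 hm
    refine congrArg MulOpposite.op (LinearMap.ext fun f => funext fun z => ?_)
    rw [LinearMap.smul_apply, Pi.smul_apply, flowEnd_apply, flowEnd_apply, hG, hG', smul_eq_mul]
    exact flow_context hu (h m ⟨k, hx⟩) _ _ z.2
  cases h with
  | contract_delete u v i a b G Gc Gd hG hc hd =>
    rw [map_sub, flowHom_gen, flowHom_gen, flowHom_gen, eq_sub_iff_add_eq]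
    refine congrArg MulOpposite.op (LinearMap.ext fun f => funext fun z => ?_)
    change (flowModel q).ev G.slices (extend f) z.1 + (flowModel q).ev Gd.slices (extend f) z.1 =
      (flowModel q).ev Gc.slices (extend f) z.1
    rw [hG, hc, hd]
    have hdiag := G.isDiagram
    rw [hG, List.append_assoc] at hdiag
    obtain ⟨m, hu, hm⟩ := isDiagram_append.1 hdiag
    have hi : i + a ≤ m := (isDiagram_cons.1 hm).1
    simp only [List.append_assoc, StrandModel.ev_append _ u]
    rw [← ev_add]
    refine StrandModel.ev_congr _ (by rw [z.2]; exact hu) fun t ht => ?_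
    simp only [StrandModel.ev_append]
    exact flow_contract_delete hi _ ht
  | loop u v w i a k hw G Gd hG hd =>
    rw [flowHom_gen, flowHom_smul]
    refine key _ u v ([⟨i, .vertex a (k + 2)⟩] ++ shift (i + 1) w ++ [⟨i, .cap⟩])
      ([⟨i, .vertex a k⟩] ++ shift i w) G Gd (by rw [hG]; simp) (by rw [hd]; simp) ?_
    rintro m ⟨k', hx⟩ f z hz
    rw [List.append_assoc] at hx
    simp only [eval_sub, eval_X, eval_one]
    exact flow_loop hw (isDiagram_cons.1 hx).1 f hz
  | closed_curve u v w i hw G Gd hG hd =>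
    rw [flowHom_gen, flowHom_smul]
    refine key _ u v ([⟨i, .cup⟩] ++ shift (i + 1) w ++ [⟨i, .cap⟩]) (shift i w) G Gd
      (by rw [hG]; simp) (by rw [hd]; simp) ?_
    rintro m ⟨k', hx⟩ f z hz
    rw [List.append_assoc] at hx
    simp only [eval_sub, eval_X, eval_one]
    exact flow_closed_curve hw (isDiagram_cons.1 hx).1 f hz
  | univalent u v i G hG =>
    rw [flowHom_gen, map_zero]
    refine (key 0 u v [⟨i, .vertex 1 0⟩] [⟨i, .vertex 1 0⟩] G G (by simpa using hG)
      (by simpa using hG) ?_).trans (by simp)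
    rintro m ⟨k', hx⟩ f z hz
    rw [zero_mul]
    exact flow_univalent (isDiagram_cons.1 hx).1 f hz
  | bivalent u v i G Gd hG hd =>
    rw [flowHom_gen, flowHom_gen]
    refine (key 1 u v [⟨i, .vertex 1 1⟩] [] G Gd (by simpa using hG)
      (by simpa using hd) ?_).trans (by rw [one_smul])
    rintro m ⟨k', hx⟩ f z hz
    rw [one_mul]
    exact flow_bivalent (isDiagram_cons.1 hx).1 f hz
  | isolated u v i G Gd hG hd =>
    rw [flowHom_gen, flowHom_gen]
    refine (key 1 u v [⟨i, .vertex 0 0⟩] [] G Gd (by simpa using hG)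
      (by simpa using hd) ?_).trans (by rw [one_smul])
    rintro m ⟨k', hx⟩ f z hz
    rw [one_mul]
    exact flow_isolated (isDiagram_cons.1 hx).1 f hz

/-- The number of flows with given values at the boundary is defined on the chromatic algebra, with
`Q` specialized to `q`. -/
theorem exists_flow_functional {n : ℕ} {x y : List {d : ZMod q // d ≠ 0}} (hx : x.length = n) :
    ∃ L : ChromaticAlgebra n →+ ℂ, ∀ (c : ℂ[X]) (G : Diagram n),
      L (c • classOf (Graph.mk G)) =
        c.eval (q : ℂ) * (flowModel q).ev G.slices (delta y) x := by
  let θ : ChromaticAlgebra n →+* (Module.End ℂ (FlowWord q n → ℂ))ᵐᵒᵖ :=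
    RingQuot.lift ⟨flowHom q n, fun _ _ h => flowHom_rel h⟩
  let e : (Module.End ℂ (FlowWord q n → ℂ))ᵐᵒᵖ →+ ℂ :=
    { toFun := fun t => t.unop (fun z => delta y z.1) ⟨x, hx⟩
      map_zero' := rfl
      map_add' := fun _ _ => rfl }
  refine ⟨e.comp θ.toAddMonoidHom, fun c G => ?_⟩
  have h1 : c • classOf (Graph.mk G) = RingQuot.mkRingHom (Rel n) (c • gen G) := by
    rw [← RingQuot.mkAlgHom_coe ℂ[X]]
    exact (map_smul (RingQuot.mkAlgHom ℂ[X] (Rel n)) c (gen G)).symm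
  have h2 : θ (c • classOf (Graph.mk G)) = .op (c.eval (q : ℂ) • flowEnd G) := by
    rw [h1, ← flowHom_smul]
    exact RingQuot.lift_mkRingHom_apply _ _ _
  change e (θ (c • classOf (Graph.mk G))) = _
  rw [h2]
  change c.eval (q : ℂ) * (flowModel q).ev G.slices (extend fun z => delta y z.1) x = _
  congr 1
  refine StrandModel.ev_congr _ (by rw [hx]; exact G.isDiagram) fun z hz => ?_
  exact dif_pos hz

end flow

/-! ### Generic flows on forests -/

/-- The sum of the entries of `z` at the positions selected by `χ`. -/
def selSum {A : Type} [AddCommMonoid A] (χ : List Bool) (z : List A) : A :=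
  (List.zipWith (fun c d => if c then d else 0) χ z).sum

theorem selSum_append {A : Type} [AddCommMonoid A] {χ χ' : List Bool} {z z' : List A}
    (h : χ.length = z.length) : selSum (χ ++ χ') (z ++ z') = selSum χ z + selSum χ' z' := by
  rw [selSum, List.zipWith_append h, List.sum_append, selSum, selSum]

theorem selSum_of_forall_eq {A : Type} [AddCommMonoid A] {χ : List Bool} {z : List A} {c : Bool}
    (hc : ∀ d ∈ χ, d = c) (h : χ.length = z.length) :
    selSum χ z = if c then z.sum else 0 := by
  induction χ generalizing z with
  | nil =>
    obtain rfl := List.length_eq_zero_iff.1 h.symm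
    simp [selSum]
  | cons d χ ih =>
    obtain _ | ⟨a, z⟩ := z
    · simp at h
    simp only [List.mem_cons, forall_eq_or_imp] at hc
    have := ih hc.2 (by simpa using h)
    rw [selSum] at this
    rw [selSum, List.zipWith_cons_cons, List.sum_cons, this, hc.1]
    cases c <;> simp

theorem selSum_replicate (χ : List Bool) (B : ℤ) :
    selSum χ (List.replicate χ.length B) = χ.count true * B := by
  induction χ with
  | nil => simp [selSum]
  | cons d χ ih =>
    rw [selSum] at ih
    rw [selSum, List.length_cons, List.replicate_succ, List.zipWith_cons_cons, List.sum_cons, ih]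
    cases d
    · simp
    · simp
      ring

theorem sum_map_abs_nonneg (z : List ℤ) : 0 ≤ (z.map abs).sum := by
  refine List.sum_nonneg fun a ha => ?_
  obtain ⟨b, -, rfl⟩ := List.mem_map.1 ha
  exact abs_nonneg b

theorem abs_selSum_le (χ : List Bool) (z : List ℤ) : |selSum χ z| ≤ (z.map abs).sum := by
  induction z generalizing χ with
  | nil => simp [selSum]
  | cons a z ih =>
    obtain _ | ⟨c, χ⟩ := χ
    · have : 0 ≤ ((a :: z).map abs).sum := sum_map_abs_nonneg _
      simpa [selSum] using this
    have := ih χ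
    rw [selSum] at this
    rw [selSum, List.zipWith_cons_cons, List.sum_cons, List.map_cons, List.sum_cons]
    refine (abs_add_le _ _).trans (add_le_add ?_ this)
    cases c <;> simp

theorem selSum_map_intCast {A : Type} [Ring A] (χ : List Bool) (z : List ℤ) :
    selSum χ (z.map (Int.cast : ℤ → A)) = ((selSum χ z : ℤ) : A) := by
  induction z generalizing χ with
  | nil => simp [selSum]
  | cons a z ih =>
    obtain _ | ⟨c, χ⟩ := χ
    · simp [selSum]
    have := ih χ
    rw [selSum, selSum] at this
    rw [selSum, selSum, List.map_cons, List.zipWith_cons_cons, List.zipWith_cons_cons,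
      List.sum_cons, List.sum_cons, this]
    cases c <;> simp

theorem flowModel_adm_starSlice {q : ℕ} {x : ℕ × ℕ} {b : List {d : ZMod q // d ≠ 0}}
    (hb : b.length = x.2) :
    (flowModel q).Adm (starSlice x).piece [] b ↔ (b.map Subtype.val).sum = 0 := by
  simp only [starSlice]
  split_ifs with h
  · obtain ⟨d, e, rfl⟩ := List.length_eq_two.1 (hb.trans h)
    simp only [StrandModel.Adm]
    constructor
    · rintro ⟨c, hc⟩
      simp only [List.cons.injEq, and_true] at hc
      rw [hc.1, hc.2]
      simp [flowModel_dual]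
    · intro hc
      refine ⟨d, ?_⟩
      simp only [List.cons.injEq, and_true, true_and]
      refine Subtype.ext ?_
      rw [flowModel_dual]
      simp only [List.map_cons, List.map_nil, List.sum_cons, List.sum_nil, add_zero] at hc
      exact (neg_eq_of_add_eq_zero_right hc).symm
  · simp only [StrandModel.Adm, flowModel_vertex]
    exact eq_comm

theorem flowModel_ev_cons {q : ℕ} [NeZero q] {x : ℕ × ℕ} {w : StarWord} {K : ℕ} (hw : Valid w K)
    {l b r : List {d : ZMod q // d ≠ 0}} (hl : l.length = x.1) (hb : b.length = x.2)
    (hK : (l ++ r).length = K) :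
    (flowModel q).ev (toSlices (x :: w)) (delta (l ++ (b ++ r)) : _ → ℂ) [] ≠ 0 ↔
      (b.map Subtype.val).sum = 0 ∧
        (flowModel q).ev (toSlices w) (delta (l ++ r) : _ → ℂ) [] ≠ 0 := by
  classical
  have hev := ev_snoc_star (R := ℂ) (flowModel q) hw.isDiagram (dom_starSlice x)
    (b := b) (r := r) hl (by rw [cod_starSlice, hb]) (by simpa using hK)
  simp only [toSlices]
  rw [hev, ite_ne_right_iff, flowModel_adm_starSlice hb]

/-- The total flow into a union of components vanishes. -/
theorem selSum_eq_zero_of_flow {q : ℕ} [NeZero q] {w : StarWord} {N : ℕ} (hw : Valid w N)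
    {z : List {d : ZMod q // d ≠ 0}} (hz : z.length = N) {χ : List Bool} (hχ : χ.length = N)
    (h : (flowModel q).ev (toSlices w) (delta z : _ → ℂ) [] ≠ 0)
    (h' : compModel.ev (toSlices w) (delta χ : _ → ℕ) [] ≠ 0) :
    selSum χ (z.map Subtype.val) = 0 := by
  induction w generalizing N z χ with
  | nil =>
    cases hw
    obtain rfl := List.length_eq_zero_iff.1 hz
    simp [selSum]
  | cons x w ih =>
    obtain ⟨h1, h2, h3⟩ := hw
    obtain ⟨l, b, r, rfl, hl, hb⟩ := exists_append_of_le (x := z) (i := x.1) (d := x.2) (by omega)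
    obtain ⟨l', b', r', rfl, hl', hb'⟩ := exists_append_of_le (x := χ) (i := x.1) (d := x.2)
      (by omega)
    have hlr : (l ++ r).length = N - x.2 := by
      simp only [List.length_append] at hz ⊢
      omega
    have hlr' : (l' ++ r').length = N - x.2 := by
      simp only [List.length_append] at hχ ⊢
      omega
    obtain ⟨h4, h5⟩ := (flowModel_ev_cons h3 hl hb hlr).1 h
    obtain ⟨⟨c, hc⟩, h7⟩ := (compModel_ev_cons h3 hl' hb' hlr').1 h'
    have := ih h3 hlr hlr' h5 h7
    rw [List.map_append, selSum_append (by simp; omega)] at this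
    rw [List.map_append, List.map_append, selSum_append (by simp; omega),
      selSum_append (by simp; omega), selSum_of_forall_eq hc (by simp; omega), h4, ite_self, zero_add,
      this]

/-- A word of the given length with sum zero such that no proper nonempty part of it has a sum of
absolute value less than `B`. -/
theorem exists_generic_star {k : ℕ} (hk : 2 ≤ k) {B : ℤ} (hB : 0 < B) :
    ∃ b : List ℤ, b.length = k ∧ b.sum = 0 ∧ (∀ a ∈ b, a ≠ 0) ∧
      ∀ (χ : List Bool) (s : ℤ), χ.length = k → |s| < B → s + selSum χ b = 0 →
        s = 0 ∧ ∃ c, ∀ d ∈ χ, d = c := by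
  -- All legs but one carry `B`, and the last one balances them.
  refine ⟨List.replicate (k - 1) B ++ [-((k - 1 : ℕ) * B)], by simp; omega, by simp, ?_, ?_⟩
  · have : (0 : ℤ) < (k - 1 : ℕ) * B := mul_pos (by omega) hB
    intro a ha
    simp only [List.mem_append, List.mem_replicate, List.mem_singleton] at ha
    rcases ha with ⟨-, rfl⟩ | rfl
    · exact hB.ne'
    · omega
  · intro χ s hχ hs h
    obtain rfl | ⟨t, e, rfl⟩ := List.eq_nil_or_concat χ
    · simp at hχ
      omega
    have ht : t.length = k - 1 := by
      simp at hχ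
      omega
    rw [List.concat_eq_append, ← ht, selSum_append (by simp), selSum_replicate] at h
    have hle : t.count true ≤ t.length := List.count_le_length
    have hs0 : s = 0 := by
      refine Int.eq_zero_of_abs_lt_dvd (m := B) ?_ hs
      have : s = -(t.count true * B + selSum [e] [-((t.length : ℕ) * B)]) := by omega
      rw [this, dvd_neg]
      refine dvd_add (dvd_mul_left _ _) ?_
      cases e <;> simp [selSum]
    refine ⟨hs0, e, ?_⟩
    rw [hs0, zero_add] at h
    cases e
    · have h0 : t.count true = 0 := by
        have : (t.count true : ℤ) * B = 0 := by simpa [selSum] using h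
        rcases mul_eq_zero.1 this with h | h
        · exact_mod_cast h
        · omega
      have := List.count_eq_zero.1 h0
      simp only [List.concat_eq_append, List.mem_append, List.mem_singleton]
      rintro d (hd | rfl)
      · cases d
        · rfl
        · exact absurd hd this
      · rfl
    · have h0 : t.count true = t.length := by
        have : ((t.count true : ℤ) - t.length) * B = 0 := by
          simp [selSum] at h
          linarith
        rcases mul_eq_zero.1 this with h | h <;> omega
      have := List.count_eq_length.1 h0
      simp only [List.concat_eq_append, List.mem_append, List.mem_singleton]
      rintro d (hd | rfl)
      · exact (this d hd).symm
      · rfl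

/-- Every forest has an integral flow for which only the unions of components have total flow
zero. -/
theorem exists_generic_flow {w : StarWord} {N : ℕ} (hw : Valid w N) :
    ∃ z : List ℤ, z.length = N ∧ (∀ a ∈ z, a ≠ 0) ∧
      (∀ (q : ℕ) [NeZero q] (z' : List {d : ZMod q // d ≠ 0}),
        z'.map Subtype.val = z.map Int.cast →
        (flowModel q).ev (toSlices w) (delta z' : _ → ℂ) [] ≠ 0) ∧
      ∀ χ : List Bool, χ.length = N → selSum χ z = 0 →
        compModel.ev (toSlices w) (delta χ : _ → ℕ) [] ≠ 0 := by
  induction w generalizing N with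
  | nil =>
    cases hw
    refine ⟨[], rfl, by simp, ?_, ?_⟩
    · intro q _ z' hz
      obtain rfl := List.map_eq_nil_iff.1 hz
      simp [toSlices, delta]
    · intro χ hχ _
      obtain rfl := List.length_eq_zero_iff.1 hχ
      simp [toSlices, delta]
  | cons x w ih =>
    obtain ⟨h1, h2, h3⟩ := hw
    obtain ⟨z, hz, hne, hflow, hcomp⟩ := ih h3
    obtain ⟨l, c, r, rfl, hl, hc⟩ := exists_append_of_le (x := z) (i := x.1) (d := 0) (by omega)
    obtain rfl := List.length_eq_zero_iff.1 hc
    rw [List.nil_append] at *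
    have hnonneg : 0 ≤ ((l ++ r).map abs).sum := sum_map_abs_nonneg _
    -- The flow on the new component is so large that it cannot cancel against the other ones.
    obtain ⟨b, hb, hsum, hbne, hbgen⟩ := exists_generic_star h1
      (B := ((l ++ r).map abs).sum + 1) (by omega)
    refine ⟨l ++ (b ++ r), ?_, ?_, ?_, ?_⟩
    · simp only [List.length_append] at hz ⊢
      omega
    · intro a ha
      simp only [List.mem_append] at ha hne
      rcases ha with ha | ha | ha
      · exact hne a (.inl ha)
      · exact hbne a ha
      · exact hne a (.inr ha)
    · intro q _ z' hz'
      rw [List.map_append, List.map_append] at hz'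
      obtain ⟨l', t', rfl, hl', ht'⟩ := List.map_eq_append_iff.1 hz'
      obtain ⟨b', r', rfl, hb', hr'⟩ := List.map_eq_append_iff.1 ht'
      have e1 : l'.length = l.length := by simpa using congrArg List.length hl'
      have e2 : b'.length = b.length := by simpa using congrArg List.length hb'
      have e3 : r'.length = r.length := by simpa using congrArg List.length hr'
      rw [flowModel_ev_cons h3 (by omega) (by omega)
        (by simp only [List.length_append] at hz ⊢; omega)]
      refine ⟨?_, hflow q _ (by rw [List.map_append, List.map_append, hl', hr'])⟩
      rw [hb', ← Int.cast_list_sum, hsum, Int.cast_zero]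
    · intro χ hχ hsel
      obtain ⟨l', b', r', rfl, hl', hb'⟩ := exists_append_of_le (x := χ) (i := x.1) (d := x.2)
        (by omega)
      have hlr' : (l' ++ r').length = N - x.2 := by
        simp only [List.length_append] at hχ ⊢
        omega
      rw [selSum_append (by omega), selSum_append (by omega)] at hsel
      have hs : selSum (l' ++ r') (l ++ r) = selSum l' l + selSum r' r :=
        selSum_append (by omega)
      obtain ⟨h0, hconst⟩ := hbgen b' (selSum (l' ++ r') (l ++ r)) hb'
        (Int.lt_add_one_iff.2 (abs_selSum_le _ _)) (by rw [hs]; omega)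
      exact (compModel_ev_cons h3 hl' hb' hlr').2 ⟨hconst, hcomp _ hlr' h0⟩

/-! ### Linear independence -/

theorem intCast_eq_zero_of_abs_lt {q : ℕ} {a : ℤ} (h : ((a : ℤ) : ZMod q) = 0) (ha : |a| < q) :
    a = 0 :=
  Int.eq_zero_of_abs_lt_dvd ((ZMod.intCast_zmod_eq_zero_iff_dvd a q).1 h) ha

/-- A generic flow of a forest distinguishes it from all forests with a partition that is not
coarser. -/
theorem exists_separating_flow {w : StarWord} {N : ℕ} (hw : Valid w N) :
    ∃ B : ℕ, ∀ (q : ℕ) [NeZero q], B < q → ∃ z : List {d : ZMod q // d ≠ 0}, z.length = N ∧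
      (flowModel q).ev (toSlices w) (delta z : _ → ℂ) [] ≠ 0 ∧
      ∀ w', Valid w' N → (flowModel q).ev (toSlices w') (delta z : _ → ℂ) [] ≠ 0 →
        ∀ p < N, ∀ r < N, Conn w p r → Conn w' p r := by
  obtain ⟨z, hz, hne, hflow, hcomp⟩ := exists_generic_flow hw
  have hnonneg : 0 ≤ (z.map abs).sum := sum_map_abs_nonneg _
  -- Modulo a larger number, no partial sum of the flow vanishes that is not zero in `ℤ`.
  refine ⟨(z.map abs).sum.toNat, fun q _ hq => ?_⟩
  have hlift : ∀ d ∈ z.map (Int.cast : ℤ → ZMod q), d ≠ 0 := by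
    simp only [List.mem_map, forall_exists_index, and_imp, forall_apply_eq_imp_iff₂]
    intro a ha h
    refine hne a ha (intCast_eq_zero_of_abs_lt h ?_)
    have := List.single_le_sum (l := z.map abs) (by simp) |a| (List.mem_map_of_mem ha)
    omega
  obtain ⟨z', hz'⟩ : ∃ z' : List {d : ZMod q // d ≠ 0}, z'.map Subtype.val = z.map Int.cast :=
    CanLift.prf (z.map (Int.cast : ℤ → ZMod q)) hlift
  have hlen : z'.length = N := by
    rw [← hz]
    simpa using congrArg List.length hz'
  refine ⟨z', hlen, hflow q z' hz', fun w' hw' h p hp r hr hpr => ?_⟩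
  refine conn_of_forall_colouring hw' hp hr fun χ hχ hcol => ?_
  have h0 := selSum_eq_zero_of_flow hw' hlen hχ h hcol
  rw [hz', selSum_map_intCast] at h0
  have h1 : selSum χ z = 0 := by
    refine intCast_eq_zero_of_abs_lt h0 ?_
    have := abs_selSum_le χ z
    omega
  exact (compModel_ev_toSlices hw hχ).1 (hcomp χ hχ h1) _ _ hpr

/-- The number of flows on a basic graph with given values at the boundary, as a functional on the
chromatic algebra. -/
theorem exists_flow_functional_basic {n q : ℕ} [NeZero q] {z : List {d : ZMod q // d ≠ 0}}
    (hz : z.length = 2 * n) :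
    ∃ L : ChromaticAlgebra n →+ ℂ, ∀ (c : ℂ[X]) {w : StarWord} (hw : Valid w (2 * n)),
      L (c • classOf (basicGraph hw).1) =
        c.eval (q : ℂ) * (flowModel q).ev (toSlices w) (delta z) [] := by
  have hx : ((z.drop n).map (flowModel q).dual).reverse.length = n := by simp; omega
  have hy : (z.take n).length = n := by simp; omega
  obtain ⟨L, hL⟩ := exists_flow_functional (y := z.take n) hx
  refine ⟨L, fun c w hw => ?_⟩
  have h := (flowModel q).ev_append_caps (R := ℂ) hw.isDiagram hx hy
  have e : (flowModel q).dual ∘ (flowModel q).dual = id := funext (flowModel q).dual_dual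
  rw [List.map_reverse, List.reverse_reverse, List.map_map, e, List.map_id,
    List.take_append_drop] at h
  rw [← h]
  exact hL c (diagram hw)

theorem linearIndependent_basicGraph (n : ℕ) :
    LinearIndependent ℂ[X] fun g : BasicGraph n => (classOf g.1 : ChromaticAlgebra n) := by
  classical
  refine linearIndependent_iff'ₛ.2 fun s f f' hsum => ?_
  by_contra! hne
  obtain ⟨g₁, hg₁, hc₁⟩ := hne
  let c : BasicGraph n → ℂ[X] := fun g => f g - f' g
  -- Among the graphs that occur in the relation, take one with a maximal partition.
  obtain ⟨g, hg, hmax⟩ := Finset.exists_maximalFor (fun g : BasicGraph n => g.partition.1)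
    (s.filter fun g => c g ≠ 0) ⟨g₁, by simp [c, hg₁, sub_ne_zero.2 hc₁]⟩
  obtain ⟨hgs, hcg⟩ := Finset.mem_filter.1 hg
  refine hcg ?_
  obtain ⟨w, hw, rfl⟩ := g.exists_starWord
  obtain ⟨B, hB⟩ := exists_separating_flow hw
  -- For large `q`, no other graph of the relation has a flow with the same values at the boundary as
  -- a generic flow on this graph.
  have key : ∀ q : ℕ, B < q → (c (basicGraph hw)).eval (q : ℂ) = 0 := by
    intro q hq
    have : NeZero q := ⟨by omega⟩
    obtain ⟨z, hz, h0, hsep⟩ := hB q hq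
    obtain ⟨L, hL⟩ := exists_flow_functional_basic hz
    have h : ∑ g ∈ s, (L (f g • classOf g.1) - L (f' g • classOf g.1)) = 0 := by
      rw [Finset.sum_sub_distrib, ← map_sum, ← map_sum, hsum, sub_self]
    rw [Finset.sum_eq_single (basicGraph hw), hL, hL, ← sub_mul, ← eval_sub] at h
    · exact (mul_eq_zero.1 h).resolve_right h0
    · intro g hg hne
      by_cases hcg : c g = 0
      · rw [sub_eq_zero.1 hcg, sub_self]
      obtain ⟨w', hw', rfl⟩ := g.exists_starWord
      rw [hL, hL, ← sub_mul]
      by_contra hflow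
      have hconn := hsep w' hw' (right_ne_zero_of_mul hflow)
      have hle : (basicGraph hw).partition.1 ≤ (basicGraph hw').partition.1 := by
        intro p r hpr
        rw [partition_basicGraph] at hpr ⊢
        rw [boundaryPartition_diagram] at hpr ⊢
        exact hconn _ (Fin.rev_val_lt p) _ (Fin.rev_val_lt r) hpr
      have hge := hmax (Finset.mem_filter.2 ⟨hg, hcg⟩) hle
      exact hne (BasicGraph.partition_injective n (Subtype.ext (le_antisymm hge hle)))
    · exact fun h => absurd hgs h
  refine Polynomial.eq_zero_of_infinite_isRoot _ (Set.infinite_of_injective_forall_mem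
    (f := fun k : ℕ => ((B + 1 + k : ℕ) : ℂ)) ?_ fun k => key _ (by omega))
  intro a b h
  have : B + 1 + a = B + 1 + b := Nat.cast_injective h
  omega

end Chromatic

theorem mainTheorem4 (n : ℕ) :
    (∃ b : Module.Basis (Chromatic.BasicGraph n) (Polynomial ℂ) (Chromatic.ChromaticAlgebra n),
      ∀ g : Chromatic.BasicGraph n, b g = Chromatic.classOf g.1) ∧
    (∀ G : Chromatic.Diagram n, G.NoInnerEdges →
      Chromatic.classOf (Chromatic.Graph.mk G) = 0 ∨
      ∃ g : Chromatic.BasicGraph n,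
        Chromatic.classOf (Chromatic.Graph.mk G) = Chromatic.classOf g.1) ∧
    (∃ e : Chromatic.BasicGraph n ≃ Chromatic.PlanarPartition n,
      ∀ (G : Chromatic.Diagram n) (hG : G.IsBasic),
        (e ⟨Chromatic.Graph.mk G, G, hG, rfl⟩).1 = G.boundaryPartition) := by
  refine ⟨⟨.mk (Chromatic.linearIndependent_basicGraph n) Chromatic.span_basicGraph,
    fun g => Module.Basis.mk_apply _ _ g⟩, Chromatic.classOf_eq_zero_or_basic,
    Chromatic.basicGraphEquiv n, Chromatic.BasicGraph.partition_mk⟩
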